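/- Let $a^0,a^1,b:\mathbb R\to\mathbb R$ be measurable and polynomially bounded and let $x_0\in\mathbb R$. For $f\in\{a^0,a^1,b\}$ define the Gauss transform $$H_f(p,q)=\frac1{\sqrt{2\pi q}}\int_{\mathbb R} f(u)\,e^{-\frac{(p-u)^2}{2q}}\,du,\qquad p\in\mathbb R,\ q>0,$$ and assume that $\partial_pH_f$ and $\partial_qH_f$ extend continuously to $\mathbb R\times[0,\infty)$. Then $H_f$ itself extends continuously to $\mathbb R\times[0,\infty)$, and the extension is again denoted by $H_f$. (i) The system $$G_t'=H_b(A_t,G_t)^2+2H_{a^1}(A_t,G_t)G_t,\qquad A_t'=H_{a^0}(A_t,G_t)+H_{a^1}(A_t,G_t)A_t,\qquad (A_0,G_0)=(x_0,0),$$ has a unique maximal solution $(A_t,G_t)\in\mathbb R\times[0,\infty)$, $0\le t<t_\infty$, with $0<t_\infty\le\infty$: every solution with values in $\mathbb R\times[0,\infty)$ on an interval $[0,S)$ has $S\le t_\infty$ and coincides there with $(A,G)$; and if $t_\infty<\infty$, then $|A_t|+G_t\to\infty$ as $t\uparrow t_\infty$. (ii) Let $W$ be a standard Brownian motion with respect to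 a filtration on a probability space, and let $S\le t_\infty$. Adapted is understood up to null sets, and all processes below are adapted and have a.s. continuous paths on $[0,S)$. (a) If $a^0,a^1,b$ are moreover continuous, then a process $X$ solves the McKean--Vlasov equation $$dX_t=\big(\mathrm E[a^0(X_t)]+X_t\,\mathrm E[a^1(X_t)]\big)\,dt+\mathrm E[b(X_t)]\,dW_t,\qquad X_0=x_0,$$ on $[0,S)$ if and only if it solves the linear equation $$dX_t=\big(H_{a^0}(A_t,G_t)+H_{a^1}(A_t,G_t)X_t\big)\,dt+H_b(A_t,G_t)\,dW_t,\qquad X_0=x_0,$$ on $[0,S)$. (A solution of the McKean--Vlasov equation is a process for which the expectations exist, $t\mapsto\mathrm E[a^j(X_t)]$ is locally integrable and $t\mapsto\mathrm E[b(X_t)]$ is locally square integrable on $[0,S)$, and the integrated equation holds a.s. for each $t<S$.) (b) The linear equation has a solution on $[0,S)$, and a process $X$ solves it if and only if, almost surely for each $t\in[0,S)$, $$X_t=x_0e^{\int_0^tH_{a^1}(A_s,G_s)ds}+\int_0^tH_{a^0}(A_s,G_s)e^{\int_s^tH_{a^1}(A_r,G_r)dr}ds+\int_0^tH_b(A_s,G_s)e^{\int_s^tH_{a^1}(A_r,G_r)dr}dW_s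 .$$ This $X$ is a Gaussian process on $[0,S)$ with $X_t\sim N(A_t,G_t)$ for each $t$. (c) For each $t\in[0,S)$ the integrand $f(s)=H_b(A_s,G_s)e^{\int_s^tH_{a^1}(A_r,G_r)dr}$ is continuously differentiable on $[0,t]$, and almost surely $\int_0^tf(s)\,dW_s=f(t)W_t-\int_0^tf'(s)W_s\,ds$. -/

import Mathlib

open MeasureTheory ProbabilityTheory Filter Topology Set
open scoped NNReal ENNReal

noncomputable section

namespace AffineMcKeanVlasov

/-- `f` is polynomially bounded. -/
def PolynomiallyBounded (f : ℝ → ℝ) : Prop :=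
  ∃ (C : ℝ) (k : ℕ), ∀ u, |f u| ≤ C * (1 + |u|) ^ k

/-- The Gauss transform of `f` at `p ∈ ℝ`, `q > 0`. -/
def gaussTransform (f : ℝ → ℝ) (p q : ℝ) : ℝ :=
  1 / √(2 * Real.pi * q) * ∫ u, f u * Real.exp (-(p - u) ^ 2 / (2 * q))

/-- The Gauss transform extended from `q > 0` to `q ≥ 0` by continuity. -/
def gaussTransformExt (f : ℝ → ℝ) (p q : ℝ) : ℝ :=
  extendFrom {z : ℝ × ℝ | 0 < z.2} (fun z => gaussTransform f z.1 z.2) (p, q)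

/-- The two partial derivatives of the Gauss transform of `f` on `q > 0` extend to continuous
functions on `q ≥ 0`. -/
def PartialsExtend (f : ℝ → ℝ) : Prop :=
  ∃ D₁ D₂ : ℝ × ℝ → ℝ,
    ContinuousOn D₁ {z | 0 ≤ z.2} ∧ ContinuousOn D₂ {z | 0 ≤ z.2} ∧
    ∀ p q : ℝ, 0 < q →
      HasDerivAt (fun p' => gaussTransform f p' q) (D₁ (p, q)) p ∧
      HasDerivAt (fun q' => gaussTransform f p q') (D₂ (p, q)) q

/-- `(A, G)` takes values in `ℝ × [0, ∞)` and solves the ODE system on `[0, S)`. The derivative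
within `[0, ∞)` is the right derivative at `0` and the usual derivative at `t > 0`. -/
structure IsODESolution (a₀ a₁ b : ℝ → ℝ) (x₀ : ℝ) (S : ℝ≥0∞) (A G : ℝ → ℝ) : Prop where
  initA : A 0 = x₀
  initG : G 0 = 0
  nonneg : ∀ t : ℝ≥0, (t : ℝ≥0∞) < S → 0 ≤ G t
  derivG : ∀ t : ℝ≥0, (t : ℝ≥0∞) < S →
    HasDerivWithinAt G (gaussTransformExt b (A t) (G t) ^ 2
      + 2 * gaussTransformExt a₁ (A t) (G t) * G t) (Ici 0) t
  derivA : ∀ t : ℝ≥0, (t : ℝ≥0∞) < S →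
    HasDerivWithinAt A (gaussTransformExt a₀ (A t) (G t)
      + gaussTransformExt a₁ (A t) (G t) * A t) (Ici 0) t

section Stochastic

variable {Ω : Type*} {mΩ : MeasurableSpace Ω}

/-- `W` is a standard Brownian motion with respect to the filtration `F`. Adaptedness is
understood up to null sets, that is, with respect to the completed filtration. -/
structure IsBrownianFor (P : Measure Ω) (F : Filtration ℝ≥0 mΩ) (W : ℝ≥0 → Ω → ℝ) : Prop where
  brownian : IsBrownianReal W P
  adapted : ∀ t, AEStronglyMeasurable[F t] (W t) P
  indep : ∀ s t, s ≤ t →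
    Indep (MeasurableSpace.comap (fun ω => W t ω - W s ω) inferInstance) (F s) P

/-- The step function equal to `c i` on `(τ i, τ (i+1)]` for `i < n`. -/
def stepFun (n : ℕ) (τ : ℕ → ℝ≥0) (c : ℕ → ℝ) (s : ℝ) : ℝ :=
  ∑ i ∈ Finset.range n, (Ioc (τ i : ℝ) (τ (i + 1))).indicator (fun _ => c i) s

/-- The Wiener integral of a step function. -/
def stepIntegral (W : ℝ≥0 → Ω → ℝ) (n : ℕ) (τ : ℕ → ℝ≥0) (c : ℕ → ℝ) (ω : Ω) : ℝ :=
  ∑ i ∈ Finset.range n, c i * (W (τ (i + 1)) ω - W (τ i) ω)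

/-- `Y` is (a version of) the stochastic integral `∫₀ᵗ γ(s) dW_s` of the deterministic integrand
`γ`: integrals of step functions approximate `Y` in `L²(P)` as the step functions approximate
`γ` in `L²(0, t)`. By the Itô isometry this determines `Y` almost surely. -/
def IsWienerIntegral (P : Measure Ω) (W : ℝ≥0 → Ω → ℝ) (γ : ℝ → ℝ) (t : ℝ≥0) (Y : Ω → ℝ) : Prop :=
  AEStronglyMeasurable Y P ∧
  ∀ ε : ℝ≥0∞, 0 < ε → ∃ (n : ℕ) (τ : ℕ → ℝ≥0) (c : ℕ → ℝ), Monotone τ ∧ τ n ≤ t ∧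
    eLpNorm (fun s => γ s - stepFun n τ c s) 2 (volume.restrict (Ioc 0 (t : ℝ))) < ε ∧
    eLpNorm (fun ω => Y ω - stepIntegral W n τ c ω) 2 P < ε

/-- On `[0, S)` the process `X` is adapted (up to null sets) and has a.s. continuous paths. -/
structure IsContinuousAdapted (P : Measure Ω) (F : Filtration ℝ≥0 mΩ) (S : ℝ≥0∞)
    (X : ℝ≥0 → Ω → ℝ) : Prop where
  adapted : ∀ t : ℝ≥0, (t : ℝ≥0∞) < S → AEStronglyMeasurable[F t] (X t) P
  continuous : ∀ᵐ ω ∂P, ContinuousOn (fun t => X t ω) {t : ℝ≥0 | (t : ℝ≥0∞) < S}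

/-- `X` solves `dX_t = (α(t) + β(t) X_t) dt + γ(t) dW_t`, `X_0 = x₀`, on `[0, S)`, where the
coefficients are deterministic functions of time, `α`, `β` locally integrable and `γ` locally
square integrable on `[0, S)`. -/
structure IsLinearSDESolution (P : Measure Ω) (F : Filtration ℝ≥0 mΩ) (W : ℝ≥0 → Ω → ℝ)
    (S : ℝ≥0∞) (x₀ : ℝ) (α β γ : ℝ → ℝ) (X : ℝ≥0 → Ω → ℝ) : Prop
    extends IsContinuousAdapted P F S X where
  integrable_α : ∀ t : ℝ≥0, (t : ℝ≥0∞) < S → IntervalIntegrable α volume 0 t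
  integrable_β : ∀ t : ℝ≥0, (t : ℝ≥0∞) < S → IntervalIntegrable β volume 0 t
  sq_integrable_γ : ∀ t : ℝ≥0, (t : ℝ≥0∞) < S → MemLp γ 2 (volume.restrict (Ioc 0 (t : ℝ)))
  equation : ∀ t : ℝ≥0, (t : ℝ≥0∞) < S → ∃ J : Ω → ℝ, IsWienerIntegral P W γ t J ∧
    ∀ᵐ ω ∂P, X t ω = x₀ + (∫ s in (0 : ℝ)..t, (α s + β s * X s.toNNReal ω)) + J ω

/-- `X` solves the McKean–Vlasov equation
`dX_t = (E[a₀(X_t)] + X_t E[a₁(X_t)]) dt + E[b(X_t)] dW_t`, `X_0 = x₀`, on `[0, S)`: the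
expectations exist, and `X` solves the equation with these functions of time as coefficients. -/
structure IsMcKeanVlasovSolution (P : Measure Ω) (F : Filtration ℝ≥0 mΩ) (W : ℝ≥0 → Ω → ℝ)
    (S : ℝ≥0∞) (x₀ : ℝ) (a₀ a₁ b : ℝ → ℝ) (X : ℝ≥0 → Ω → ℝ) : Prop where
  integrable_a₀ : ∀ t : ℝ≥0, (t : ℝ≥0∞) < S → Integrable (fun ω => a₀ (X t ω)) P
  integrable_a₁ : ∀ t : ℝ≥0, (t : ℝ≥0∞) < S → Integrable (fun ω => a₁ (X t ω)) P
  integrable_b : ∀ t : ℝ≥0, (t : ℝ≥0∞) < S → Integrable (fun ω => b (X t ω)) P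
  sde : IsLinearSDESolution P F W S x₀
    (fun t => ∫ ω, a₀ (X t.toNNReal ω) ∂P)
    (fun t => ∫ ω, a₁ (X t.toNNReal ω) ∂P)
    (fun t => ∫ ω, b (X t.toNNReal ω) ∂P) X

/-- `X` is given on `[0, S)` by the variation-of-constants formula
`X_t = x₀ e^{∫₀ᵗ β} + ∫₀ᵗ α(s) e^{∫ₛᵗ β} ds + ∫₀ᵗ γ(s) e^{∫ₛᵗ β} dW_s`. -/
structure IsExplicitSolution (P : Measure Ω) (F : Filtration ℝ≥0 mΩ) (W : ℝ≥0 → Ω → ℝ)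
    (S : ℝ≥0∞) (x₀ : ℝ) (α β γ : ℝ → ℝ) (X : ℝ≥0 → Ω → ℝ) : Prop
    extends IsContinuousAdapted P F S X where
  formula : ∀ t : ℝ≥0, (t : ℝ≥0∞) < S → ∃ J : Ω → ℝ,
    IsWienerIntegral P W (fun s => γ s * Real.exp (∫ r in s..t, β r)) t J ∧
    ∀ᵐ ω ∂P, X t ω = x₀ * Real.exp (∫ s in (0 : ℝ)..t, β s)
      + (∫ s in (0 : ℝ)..t, α s * Real.exp (∫ r in s..t, β r)) + J ω

end Stochastic

end AffineMcKeanVlasov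

end

noncomputable section

namespace AffineMcKeanVlasov

/-! The expectations in the McKean–Vlasov equation are deterministic functions of time, so every
solution solves a linear equation with deterministic coefficients. Variation of constants writes it
as a deterministic mean plus a Wiener integral. Hence X_t is Gaussian, and its mean m and variance v
obey linear differential equations whose coefficients are the expectations. For a Gaussian X_t and
continuous f, E[f(X_t)] is the Gauss transform H_f(m_t, v_t), so (m, v) solves the system and equals
(A, G) by uniqueness. Conversely, the linear equation along (A, G) has Gaussian solutions whose mean
and variance satisfy the same linear differential equations as A and G. Thus X_t has law N(A_t,
G_t), and the coefficients are the required expectations.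

The system starts on the boundary q = 0. Since the partial derivatives extend, H_f is continuously
differentiable up to that boundary (`PartialsExtend.gaussExt_spec`), hence Lipschitz on bounded
sets. The field is continued to q < 0 by projecting onto the closed half plane. Picard–Lindelöf with
an existence time uniform on balls then gives the maximal solution and its blow-up
(`exists_maximal_solution`). Below the axis the field never points down, which keeps G nonnegative
(`SolvesOn.snd_nonneg`).

On the stochastic side only deterministic integrands occur, and no Itô calculus is used. The Wiener
integral is the closed linear span of the pairs (1_{(0,t]}, W_t). It is isometric because both inner
products equal min(s, t), and Gaussian because characteristic functions pass to L² limits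
(`map_snd_of_mem_wienerGraph`); `isWienerIntegral_iff` links it to approximation by step functions.
The only calculus rule is `IsWiener.integral_by_parts`: weighted sums approximating ∫ k Y ds are
finite combinations of Wiener integrals, converging pathwise while their integrands converge in L².
Together with the product rule for absolutely continuous functions (`exp_integral_mul_primitive`),
which needs only integrable coefficients, it yields the equivalence of the linear equation and the
explicit formula; for Y = W it turns the stochastic integral into an ordinary one. -/

/-! ### The Gauss transform up to the boundary of the half plane -/

lemma closure_upperHalfPlane : closure {z : ℝ × ℝ | 0 < z.2} = {z : ℝ × ℝ | 0 ≤ z.2} := by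
  have : {z : ℝ × ℝ | 0 < z.2} = (univ : Set ℝ) ×ˢ Ioi (0 : ℝ) := by ext; simp
  rw [this, closure_prod_eq, closure_univ, closure_Ioi]
  ext; simp

lemma convex_upperHalfPlane : Convex ℝ {z : ℝ × ℝ | 0 < z.2} := by
  have : {z : ℝ × ℝ | 0 < z.2} = (univ : Set ℝ) ×ˢ Ioi (0 : ℝ) := by ext; simp
  rw [this]
  exact convex_univ.prod (convex_Ioi 0)

lemma convex_closedUpperHalfPlane : Convex ℝ {z : ℝ × ℝ | 0 ≤ z.2} := by
  rw [← closure_upperHalfPlane]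
  exact convex_upperHalfPlane.closure

lemma isOpen_upperHalfPlane : IsOpen {z : ℝ × ℝ | 0 < z.2} :=
  isOpen_lt continuous_const continuous_snd

/-- The extended Gauss transform as a function on the plane. -/
def gaussExt (f : ℝ → ℝ) (z : ℝ × ℝ) : ℝ := gaussTransformExt f z.1 z.2

/-- A function with bounded derivative near a boundary point of a convex set has a limit there. -/
lemma exists_tendsto_of_continuousOn_fderiv {E : Type*} [NormedAddCommGroup E] [NormedSpace ℝ E]
    {U : Set E} (hU : Convex ℝ U) {g : E → ℝ} {D : E → E →L[ℝ] ℝ}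
    (hD : ContinuousOn D (closure U)) (hg : ∀ z ∈ U, HasFDerivAt g (D z) z)
    {z : E} (hz : z ∈ closure U) : ∃ l, Tendsto g (𝓝[U] z) (𝓝 l) := by
  have h1 : ∀ᶠ y in 𝓝[closure U] z, ‖D y‖ < ‖D z‖ + 1 :=
    (hD z hz).norm.eventually_lt_const (by linarith)
  obtain ⟨r, hr, hball⟩ := Metric.mem_nhdsWithin_iff.1 h1
  have hlip : LipschitzOnWith (‖D z‖₊ + 1) g (Metric.ball z r ∩ U) := by
    refine Convex.lipschitzOnWith_of_nnnorm_hasFDerivWithin_le (f' := D)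
      (fun y hy => (hg y hy.2).hasFDerivWithinAt) (fun y hy => ?_) ((convex_ball z r).inter hU)
    have := hball ⟨hy.1, subset_closure hy.2⟩
    rw [← NNReal.coe_le_coe]
    simpa using le_of_lt this
  -- A Lipschitz extension to the whole space is continuous at `z`, so its value there is the limit.
  obtain ⟨g', hg', heq⟩ := hlip.extend_real
  refine ⟨g' z, ?_⟩
  have h2 : Tendsto g' (𝓝[U] z) (𝓝 (g' z)) := (hg'.continuous.tendsto z).mono_left nhdsWithin_le_nhds
  refine h2.congr' ?_
  filter_upwards [inter_mem (mem_nhdsWithin_of_mem_nhds (Metric.ball_mem_nhds z hr))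
    self_mem_nhdsWithin] with y hy using (heq hy).symm

/-- The extended Gauss transform is continuously differentiable on the closed half plane, and it
coincides with the Gauss transform on the open half plane. -/
lemma PartialsExtend.gaussExt_spec {f : ℝ → ℝ} (h : PartialsExtend f) :
    (∀ z : ℝ × ℝ, 0 < z.2 → gaussExt f z = gaussTransform f z.1 z.2) ∧
    ∃ D : ℝ × ℝ → ℝ × ℝ →L[ℝ] ℝ, ContinuousOn D {z | 0 ≤ z.2} ∧
      ∀ z ∈ {z : ℝ × ℝ | 0 ≤ z.2}, HasFDerivWithinAt (gaussExt f) (D z) {z | 0 ≤ z.2} z := by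
  obtain ⟨D₁, D₂, c₁, c₂, hd⟩ := h
  set g : ℝ × ℝ → ℝ := fun z => gaussTransform f z.1 z.2 with hg
  set D : ℝ × ℝ → ℝ × ℝ →L[ℝ] ℝ := fun z =>
    (ContinuousLinearMap.toSpanSingleton ℝ (D₁ z)).coprod
      (ContinuousLinearMap.toSpanSingleton ℝ (D₂ z)) with hDdef
  have hDeq : D = fun z => D₁ z • ContinuousLinearMap.fst ℝ ℝ ℝ
      + D₂ z • ContinuousLinearMap.snd ℝ ℝ ℝ := by
    funext z
    ext <;> simp [hDdef]
  have hDc : ContinuousOn D {z | 0 ≤ z.2} := by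
    rw [hDeq]
    exact (c₁.smul continuousOn_const).add (c₂.smul continuousOn_const)
  have hgD : ∀ z ∈ {z : ℝ × ℝ | 0 < z.2}, HasFDerivAt g (D z) z := by
    intro z hz
    have hn : {z : ℝ × ℝ | 0 < z.2} ∈ 𝓝 z := isOpen_upperHalfPlane.mem_nhds hz
    have hn' : {z : ℝ × ℝ | 0 ≤ z.2} ∈ 𝓝 z := mem_of_superset hn fun y (hy : 0 < y.2) => hy.le
    -- Partial derivatives that are continuous near an interior point give the total derivative.
    refine (hasStrictFDerivAt_uncurry_coprod (𝕜 := ℝ) (u := z)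
      (f := fun p q => gaussTransform f p q)
      (f₁ := fun p q => ContinuousLinearMap.toSpanSingleton ℝ (D₁ (p, q)))
      (f₂ := fun p q => ContinuousLinearMap.toSpanSingleton ℝ (D₂ (p, q))) ?_ ?_ ?_ ?_).hasFDerivAt
    · filter_upwards [hn] with v hv using (hd v.1 v.2 hv).1.hasFDerivAt
    · filter_upwards [hn] with v hv using (hd v.1 v.2 hv).2.hasFDerivAt
    · exact (ContinuousLinearMap.toSpanSingletonCLE (𝕜 := ℝ) (E := ℝ)).continuous.continuousAt.comp
        (c₁.continuousAt hn')
    · exact (ContinuousLinearMap.toSpanSingletonCLE (𝕜 := ℝ) (E := ℝ)).continuous.continuousAt.comp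
        (c₂.continuousAt hn')
  have hlim : ∀ z ∈ closure {z : ℝ × ℝ | 0 < z.2},
      ∃ l, Tendsto g (𝓝[{z : ℝ × ℝ | 0 < z.2}] z) (𝓝 l) := fun z hz =>
    exists_tendsto_of_continuousOn_fderiv convex_upperHalfPlane
      (by rwa [closure_upperHalfPlane]) hgD hz
  have hext : gaussExt f = extendFrom {z : ℝ × ℝ | 0 < z.2} g := rfl
  have heq : ∀ z ∈ {z : ℝ × ℝ | 0 < z.2}, gaussExt f z = g z := fun z hz => by
    rw [hext]
    exact extendFrom_eq (subset_closure hz)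
      ((hgD z hz).continuousAt.tendsto.mono_left nhdsWithin_le_nhds)
  have hcont : ContinuousOn (gaussExt f) (closure {z : ℝ × ℝ | 0 < z.2}) := by
    rw [hext]
    exact continuousOn_extendFrom subset_rfl hlim
  have hgD' : ∀ z ∈ {z : ℝ × ℝ | 0 < z.2}, HasFDerivAt (gaussExt f) (D z) z := fun z hz =>
    (hgD z hz).congr_of_eventuallyEq
      (mem_of_superset (isOpen_upperHalfPlane.mem_nhds hz) heq)
  refine ⟨heq, D, hDc, fun z hz => ?_⟩
  rw [← closure_upperHalfPlane] at hz hDc ⊢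
  -- The derivatives at interior points have a limit at the boundary point; on a convex set this
  -- limit is the derivative there.
  refine hasFDerivWithinAt_closure_of_tendsto_fderiv
    (fun y hy => (hgD' y hy).differentiableAt.differentiableWithinAt) convex_upperHalfPlane
    isOpen_upperHalfPlane (fun y hy => (hcont y hy).mono subset_closure) ?_
  refine ((hDc z hz).mono subset_closure).congr' ?_
  filter_upwards [self_mem_nhdsWithin] with y hy using (hgD' y hy).fderiv.symm

lemma PartialsExtend.continuousOn_gaussExt {f : ℝ → ℝ} (h : PartialsExtend f) :
    ContinuousOn (gaussExt f) {z | 0 ≤ z.2} := by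
  obtain ⟨D, -, hD⟩ := h.gaussExt_spec.2
  exact fun z hz => (hD z hz).continuousWithinAt

/-- The extended Gauss transform is Lipschitz on bounded parts of the closed half plane. -/
lemma PartialsExtend.lipschitzOnWith_gaussExt {f : ℝ → ℝ} (h : PartialsExtend f) (R : ℝ) :
    ∃ K, LipschitzOnWith K (gaussExt f) (Metric.closedBall 0 R ∩ {z | 0 ≤ z.2}) := by
  obtain ⟨D, hDc, hD⟩ := h.gaussExt_spec.2
  have hcl : IsClosed {z : ℝ × ℝ | 0 ≤ z.2} := isClosed_le continuous_const continuous_snd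
  have hK : IsCompact (Metric.closedBall (0 : ℝ × ℝ) R ∩ {z | 0 ≤ z.2}) :=
    (isCompact_closedBall _ _).inter_right hcl
  obtain ⟨C, hC⟩ := hK.exists_bound_of_continuousOn (hDc.mono inter_subset_right)
  refine ⟨C.toNNReal, Convex.lipschitzOnWith_of_nnnorm_hasFDerivWithin_le (f' := D)
    (fun z hz => (hD z hz.2).mono inter_subset_right) (fun z hz => ?_)
    ((convex_closedBall _ _).inter convex_closedUpperHalfPlane)⟩
  rw [← NNReal.coe_le_coe, coe_nnnorm]
  exact (hC z hz).trans (Real.le_coe_toNNReal C)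

/-! ### The Gauss transform as a Gaussian expectation -/

lemma gaussExt_eq_of_continuousAt_left {f : ℝ → ℝ} {p l : ℝ}
    (h : Tendsto (fun z : ℝ × ℝ => gaussTransform f z.1 z.2) (𝓝[{z | 0 < z.2}] (p, 0)) (𝓝 l)) :
    gaussExt f (p, 0) = l :=
  extendFrom_eq (by rw [closure_upperHalfPlane]; exact le_refl (0 : ℝ)) h

lemma gaussTransform_eq_integral (f : ℝ → ℝ) (p : ℝ) {q : ℝ} (hq : 0 < q) :
    gaussTransform f p q = ∫ u, f u ∂(gaussianReal p q.toNNReal) := by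
  rw [integral_gaussianReal_eq_integral_smul (by simpa using hq)]
  rw [gaussTransform, ← integral_const_mul]
  congr 1
  funext u
  simp only [gaussianPDFReal, Real.coe_toNNReal _ hq.le, smul_eq_mul]
  rw [show -(p - u) ^ 2 / (2 * q) = -(u - p) ^ 2 / (2 * q) by ring]
  ring

lemma integrable_const_add_abs_pow_gaussianReal {c : ℝ} (hc : 0 ≤ c) (k : ℕ) (m : ℝ) (v : ℝ≥0) :
    Integrable (fun u : ℝ => (c + |u|) ^ k) (gaussianReal m v) := by
  have h0 : MemLp (fun u : ℝ => |u|) k (gaussianReal m v) := by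
    have := (memLp_id_gaussianReal (μ := m) (v := v) (k : ℝ≥0)).norm
    simpa using this
  have h1 : MemLp (fun u : ℝ => c + |u|) k (gaussianReal m v) :=
    MemLp.add (f := fun _ => c) (memLp_const c) h0
  have h2 := h1.integrable_norm_pow'
  refine h2.congr (.of_forall fun u => ?_)
  have : 0 ≤ c + |u| := by positivity
  simp only [Real.norm_eq_abs, abs_of_nonneg this]

lemma PolynomiallyBounded.integrable_gaussianReal {f : ℝ → ℝ} (hf : Measurable f)
    (h : PolynomiallyBounded f) (m : ℝ) (v : ℝ≥0) : Integrable f (gaussianReal m v) := by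
  obtain ⟨C, k, hC⟩ := h
  exact ((integrable_const_add_abs_pow_gaussianReal zero_le_one k m v).const_mul C).mono'
    hf.aestronglyMeasurable (.of_forall hC)

/-- Moving the parameters from the law into the integrand leaves one fixed measure, so that
dominated convergence can be used as q tends to 0. -/
lemma integral_gaussianReal_eq_standard {f : ℝ → ℝ} (hf : Measurable f) (p : ℝ) {q : ℝ}
    (hq : 0 ≤ q) :
    ∫ u, f u ∂(gaussianReal p q.toNNReal) = ∫ x, f (p + √q * x) ∂(gaussianReal 0 1) := by
  have : gaussianReal p q.toNNReal = (gaussianReal 0 1).map (fun x => p + √q * x) := by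
    rw [show (fun x => p + √q * x) = (fun x => p + x) ∘ (fun x => √q * x) from rfl,
      ← Measure.map_map (by fun_prop) (by fun_prop), gaussianReal_map_const_mul, gaussianReal_map_const_add]
    congr 1
    · simp
    · ext; simp [Real.sq_sqrt hq, Real.coe_toNNReal _ hq]
  rw [this, integral_map (by fun_prop) hf.aestronglyMeasurable]

/-- For continuous `f` the Gauss transform tends to `f p` at the boundary point `(p, 0)`. -/
lemma tendsto_gaussTransform_zero {f : ℝ → ℝ} (hf : Continuous f) (h : PolynomiallyBounded f)
    (p : ℝ) : Tendsto (fun z : ℝ × ℝ => gaussTransform f z.1 z.2) (𝓝[{z | 0 < z.2}] (p, 0))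
      (𝓝 (f p)) := by
  obtain ⟨C, k, hC⟩ := h
  have hC0 : 0 ≤ C := by simpa using (abs_nonneg _).trans (hC 0)
  have h1 : Tendsto (fun z : ℝ × ℝ => ∫ x, f (z.1 + √z.2 * x) ∂(gaussianReal 0 1))
      (𝓝[{z | 0 < z.2}] (p, 0)) (𝓝 (∫ _, f p ∂(gaussianReal 0 1))) := by
    -- Close to (p, 0) one has |z.1| < |p| + 1 and √z.2 ≤ 1, whence 1 + |z.1 + √z.2 x| ≤ |p| + 2 +
    -- |x|.
    refine tendsto_integral_filter_of_dominated_convergence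
      (fun x => C * (|p| + 2 + |x|) ^ k) ?_ ?_ ?_ ?_
    · exact .of_forall fun z => (hf.comp (by fun_prop)).aestronglyMeasurable
    · have h2 : {z : ℝ × ℝ | |z.1| < |p| + 1 ∧ z.2 < 1} ∈ 𝓝 (p, (0 : ℝ)) := by
        refine (IsOpen.and (isOpen_lt (by fun_prop) (by fun_prop))
          (isOpen_lt (by fun_prop) (by fun_prop))).mem_nhds ?_
        simp
      filter_upwards [mem_nhdsWithin_of_mem_nhds h2, self_mem_nhdsWithin] with z hz hz0
      refine .of_forall fun x => (hC _).trans ?_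
      refine mul_le_mul_of_nonneg_left (pow_le_pow_left₀ (by positivity) ?_ k) hC0
      have h3 : √z.2 ≤ 1 := by rw [Real.sqrt_le_one]; exact hz.2.le
      calc 1 + |z.1 + √z.2 * x| ≤ 1 + (|z.1| + |√z.2 * x|) := by gcongr; exact abs_add_le _ _
        _ ≤ 1 + (|p| + 1 + 1 * |x|) := by
          rw [abs_mul, abs_of_nonneg (Real.sqrt_nonneg _)]
          gcongr
          exact hz.1.le
        _ = |p| + 2 + |x| := by ring
    · exact (integrable_const_add_abs_pow_gaussianReal (by positivity) k 0 1).const_mul C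
    · refine .of_forall fun x => ?_
      have : Continuous fun z : ℝ × ℝ => f (z.1 + √z.2 * x) := by fun_prop
      simpa using (this.tendsto (p, 0)).mono_left nhdsWithin_le_nhds
  simp only [integral_const, probReal_univ, one_smul] at h1
  refine h1.congr' ?_
  filter_upwards [self_mem_nhdsWithin] with z hz
  rw [gaussTransform_eq_integral f z.1 hz,
    integral_gaussianReal_eq_standard hf.measurable z.1 (le_of_lt hz)]

/-- For continuous `f` the extended Gauss transform is the expectation under a normal law. -/
lemma integral_gaussianReal_eq_gaussExt {f : ℝ → ℝ} (hf : Continuous f)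
    (h : PolynomiallyBounded f) (hd : PartialsExtend f) (m : ℝ) {v : ℝ} (hv : 0 ≤ v) :
    ∫ u, f u ∂(gaussianReal m v.toNNReal) = gaussExt f (m, v) := by
  rcases hv.eq_or_lt with rfl | hv
  -- With variance zero the law is the Dirac mass at `m`; here the continuity of `f` is
  -- indispensable.
  · rw [gaussExt_eq_of_continuousAt_left (tendsto_gaussTransform_zero hf h m)]
    simp
  · rw [hd.gaussExt_spec.1 (m, v) hv, gaussTransform_eq_integral f m hv]

/-! ### Maximal solutions of autonomous equations -/

section MaximalSolution

variable {E : Type*} [NormedAddCommGroup E] [NormedSpace ℝ E]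

/-- `z` solves the autonomous equation `z' = V z`, `z 0 = z₀`, on `[0, s]`. -/
def SolvesOn (V : E → E) (z₀ : E) (s : ℝ) (z : ℝ → E) : Prop :=
  z 0 = z₀ ∧ ∀ t ∈ Icc 0 s, HasDerivWithinAt z (V (z t)) (Icc 0 s) t

variable {V : E → E} {z₀ : E}

lemma SolvesOn.mono {s s' : ℝ} {z : ℝ → E} (h : SolvesOn V z₀ s z) (hs : s' ≤ s) :
    SolvesOn V z₀ s' z :=
  ⟨h.1, fun t ht => (h.2 t ⟨ht.1, ht.2.trans hs⟩).mono (Icc_subset_Icc_right hs)⟩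

lemma SolvesOn.continuousOn {s : ℝ} {z : ℝ → E} (h : SolvesOn V z₀ s z) :
    ContinuousOn z (Icc 0 s) := fun t ht => (h.2 t ht).continuousWithinAt

/-- Both curves are bounded on the compact interval, so one Lipschitz constant on a ball containing
them suffices for Grönwall's uniqueness theorem. -/
lemma SolvesOn.eqOn (hV : ∀ R, ∃ K, LipschitzOnWith K V (Metric.closedBall 0 R)) {s : ℝ}
    {z z' : ℝ → E} (h : SolvesOn V z₀ s z) (h' : SolvesOn V z₀ s z') : EqOn z z' (Icc 0 s) := by
  obtain ⟨R, hR⟩ := isCompact_Icc.exists_bound_of_continuousOn h.continuousOn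
  obtain ⟨R', hR'⟩ := isCompact_Icc.exists_bound_of_continuousOn h'.continuousOn
  obtain ⟨K, hK⟩ := hV (max R R')
  have key : ∀ {y : ℝ → E}, SolvesOn V z₀ s y → ∀ t ∈ Ico 0 s,
      HasDerivWithinAt y (V (y t)) (Ici t) t := fun {y} hy t ht =>
    (hy.2 t ⟨ht.1, ht.2.le⟩).mono_of_mem_nhdsWithin
      (mem_of_superset (Icc_mem_nhdsGE ht.2) (Icc_subset_Icc_left ht.1))
  refine ODE_solution_unique_of_mem_Icc_right (v := fun _ => V) (K := K)
    (s := fun _ => Metric.closedBall 0 (max R R')) (fun _ _ => hK)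
    h.continuousOn (key h) (fun t ht => ?_) h'.continuousOn (key h') (fun t ht => ?_)
    (h.1.trans h'.1.symm)
  · simpa using Or.inl (hR t ⟨ht.1, ht.2.le⟩)
  · simpa using Or.inr (hR' t ⟨ht.1, ht.2.le⟩)

/-- The point is the order of the quantifiers: the existence time depends on the bound `R` alone.
This uniformity is what forces blow-up at a finite end point. -/
lemma exists_uniform_local_solution [CompleteSpace E]
    (hV : ∀ R, ∃ K, LipschitzOnWith K V (Metric.closedBall 0 R)) (R : ℝ) :
    ∃ δ > 0, ∀ x : E, ‖x‖ ≤ R → ∀ t₀ : ℝ, ∃ z : ℝ → E, z t₀ = x ∧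
      ∀ t ∈ Icc t₀ (t₀ + δ), HasDerivWithinAt z (V (z t)) (Icc t₀ (t₀ + δ)) t := by
  obtain ⟨K, hK⟩ := hV (|R| + 1)
  set L : ℝ≥0 := ‖V 0‖₊ + K * (‖R‖₊ + 1) with hL
  have hb : ∀ y ∈ Metric.closedBall (0 : E) (|R| + 1), ‖V y‖ ≤ L := fun y hy => by
    have h1 := hK.norm_sub_le hy (Metric.mem_closedBall_self (by positivity))
    have h2 : ‖y‖ ≤ |R| + 1 := by simpa using hy
    calc ‖V y‖ = ‖V 0 + (V y - V 0)‖ := by congr 1; abel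
      _ ≤ ‖V 0‖ + K * (|R| + 1) := by
        refine (norm_add_le _ _).trans (by gcongr; refine h1.trans ?_; rw [sub_zero]; gcongr)
      _ = L := by simp [hL]
  -- `L` bounds the field on the ball of radius |R| + 1, which contains the unit ball about `x`.
  -- During a time 1 / (L + 1) the solution moves by at most L / (L + 1) ≤ 1.
  refine ⟨1 / (L + 1), by positivity, fun x hx t₀ => ?_⟩
  have hδ : (0 : ℝ) < 1 / (L + 1) := by positivity
  have hsub : Metric.closedBall x ((1 : ℝ≥0) : ℝ) ⊆ Metric.closedBall 0 (|R| + 1) := by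
    refine Metric.closedBall_subset_closedBall' ?_
    simp only [NNReal.coe_one, dist_zero_right]
    linarith [le_abs_self R]
  have hPL : IsPicardLindelof (fun _ => V) (tmin := t₀) (tmax := t₀ + 1 / (L + 1))
      ⟨t₀, ⟨le_rfl, by linarith⟩⟩ x 1 0 L K := by
    refine IsPicardLindelof.of_time_independent (fun y hy => hb y (hsub hy)) (hK.mono hsub) ?_
    simp only [add_sub_cancel_left, sub_self, NNReal.coe_one, NNReal.coe_zero, sub_zero]
    rw [max_eq_left hδ.le, mul_one_div, div_le_one (by positivity)]
    linarith
  exact hPL.exists_eq_forall_mem_Icc_hasDerivWithinAt₀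

lemma SolvesOn.concat {s δ : ℝ} (hs : 0 ≤ s) (hδ : 0 ≤ δ) {z z' : ℝ → E} (h : SolvesOn V z₀ s z)
    (h0 : z' s = z s)
    (h' : ∀ t ∈ Icc s (s + δ), HasDerivWithinAt z' (V (z' t)) (Icc s (s + δ)) t) :
    SolvesOn V z₀ (s + δ) (fun t => if t ≤ s then z t else z' t) := by
  set w : ℝ → E := fun t => if t ≤ s then z t else z' t with hw
  have w1 : ∀ t ≤ s, w t = z t := fun t ht => if_pos ht
  have w2 : ∀ t, s ≤ t → w t = z' t := fun t ht => by
    rcases ht.eq_or_lt with rfl | ht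
    · rw [w1 _ le_rfl, h0]
    · exact if_neg ht.not_ge
  refine ⟨(w1 0 hs).trans h.1, fun t ht => ?_⟩
  rw [← Icc_union_Icc_eq_Icc hs (by linarith : s ≤ s + δ)]
  -- Each closed piece is treated separately. At a time outside a piece the derivative within that
  -- piece is vacuous.
  refine HasDerivWithinAt.union ?_ ?_
  · by_cases hts : t ≤ s
    · rw [w1 t hts]
      exact (h.2 t ⟨ht.1, hts⟩).congr (fun u hu => w1 u hu.2) (w1 t hts)
    · refine hasDerivWithinAt_iff_hasFDerivWithinAt.2 (HasFDerivWithinAt.of_notMem_closure ?_)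
      rw [closure_Icc]
      exact fun hmem => hts hmem.2
  · by_cases hts : s ≤ t
    · rw [w2 t hts]
      exact (h' t ⟨hts, ht.2⟩).congr (fun u hu => w2 u hu.1) (w2 t hts)
    · refine hasDerivWithinAt_iff_hasFDerivWithinAt.2 (HasFDerivWithinAt.of_notMem_closure ?_)
      rw [closure_Icc]
      exact fun hmem => hts hmem.1

lemma solvesOn_of_hasDerivWithinAt_Ici {S : ℝ≥0∞} {z : ℝ → E} (h0 : z 0 = z₀)
    (h : ∀ t : ℝ≥0, (t : ℝ≥0∞) < S → HasDerivWithinAt z (V (z t)) (Ici 0) t) {s : ℝ≥0}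
    (hs : (s : ℝ≥0∞) < S) : SolvesOn V z₀ s z := by
  refine ⟨h0, fun t ht => ?_⟩
  lift t to ℝ≥0 using ht.1
  exact (h t (lt_of_le_of_lt (by exact_mod_cast ht.2) hs)).mono Icc_subset_Ici_self

/-- Existence, uniqueness, and blow-up of the maximal solution of an autonomous equation whose
vector field is Lipschitz on bounded sets. -/
theorem exists_maximal_solution [CompleteSpace E]
    (hV : ∀ R, ∃ K, LipschitzOnWith K V (Metric.closedBall 0 R)) (z₀ : E) :
    ∃ (T : ℝ≥0∞) (z : ℝ → E), 0 < T ∧ z 0 = z₀ ∧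
      (∀ t : ℝ≥0, (t : ℝ≥0∞) < T → HasDerivWithinAt z (V (z t)) (Ici 0) t) ∧
      (T ≠ ∞ → Tendsto (fun t => ‖z t‖) (𝓝[<] T.toReal) atTop) ∧
      ∀ (S : ℝ≥0∞) (z' : ℝ → E), z' 0 = z₀ →
        (∀ t : ℝ≥0, (t : ℝ≥0∞) < S → HasDerivWithinAt z' (V (z' t)) (Ici 0) t) →
        S ≤ T ∧ ∀ t : ℝ≥0, (t : ℝ≥0∞) < S → z' t = z t := by
  -- The maximal time is the supremum of all end points of solutions on closed intervals.
  set I : Set ℝ≥0 := {s | ∃ z, SolvesOn V z₀ s z} with hI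
  have hex : ∀ s : ℝ≥0, ∃ z, s ∈ I → SolvesOn V z₀ s z := fun s => by
    by_cases hs : s ∈ I
    · obtain ⟨z, hz⟩ := hs
      exact ⟨z, fun _ => hz⟩
    · exact ⟨fun _ => z₀, fun h => absurd h hs⟩
  choose Z hZ using hex
  set T : ℝ≥0∞ := ⨆ s ∈ I, (s : ℝ≥0∞) with hT
  -- At time t the chosen solution on [0, t] is evaluated at its own end point; by uniqueness every
  -- other choice gives the same value.
  set z : ℝ → E := fun t => Z t.toNNReal t with hz
  have hle : ∀ s ∈ I, (s : ℝ≥0∞) ≤ T := fun s hs => le_iSup₂ (f := fun s (_ : s ∈ I) => (s : ℝ≥0∞)) s hs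
  have hzeq : ∀ s : ℝ≥0, ∀ y, SolvesOn V z₀ s y → ∀ t ∈ Icc (0 : ℝ) s, z t = y t := by
    intro s y hy t ht
    lift t to ℝ≥0 using ht.1
    have hyt : SolvesOn V z₀ t y := hy.mono ht.2
    have : SolvesOn V z₀ t (Z t) := hZ t ⟨y, hyt⟩
    simp only [hz, Real.toNNReal_coe]
    exact this.eqOn hV hyt ⟨t.2, le_rfl⟩
  have h0I : (0 : ℝ≥0) ∈ I := by
    -- On the one-point interval a straight line with the right slope is a solution.
    refine ⟨fun t => z₀ + t • V z₀, by simp, fun t ht => ?_⟩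
    have : t = 0 := by simpa using ht
    subst this
    simpa using (((hasDerivAt_id (0 : ℝ)).smul_const (V z₀)).const_add z₀).hasDerivWithinAt
  have hsol : ∀ s ∈ I, SolvesOn V z₀ s z := fun s hs => by
    refine ⟨?_, fun t ht => ?_⟩
    · rw [hzeq s _ (hZ s hs) 0 ⟨le_rfl, s.2⟩, (hZ s hs).1]
    · rw [hzeq s _ (hZ s hs) t ht]
      exact ((hZ s hs).2 t ht).congr (hzeq s _ (hZ s hs)) (hzeq s _ (hZ s hs) t ht)
  have hext : ∀ R : ℝ, ∃ δ > 0, ∀ s ∈ I, ‖z s‖ ≤ R → s + δ ∈ I := by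
    intro R
    obtain ⟨δ, hδ, hloc⟩ := exists_uniform_local_solution hV R
    refine ⟨δ.toNNReal, by simpa using hδ, fun s hs hR => ?_⟩
    obtain ⟨y, hy0, hy⟩ := hloc (z s) hR s
    have h1 : ((s + δ.toNNReal : ℝ≥0) : ℝ) = s + δ := by simp [hδ.le]
    exact ⟨_, by rw [h1]; exact (hsol s hs).concat s.2 hδ.le hy0 hy⟩
  have hpos : 0 < T := by
    obtain ⟨δ, hδ, h⟩ := hext ‖z 0‖
    have h1 := hle _ (h 0 h0I le_rfl)
    exact lt_of_lt_of_le (by simpa using hδ) h1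
  refine ⟨T, z, hpos, (hsol 0 h0I).1, fun t ht => ?_, fun hTtop => ?_, fun S z' h0 h' => ?_⟩
  · obtain ⟨s, hs, hts⟩ : ∃ s ∈ I, (t : ℝ≥0∞) < s := by simpa [hT, lt_iSup_iff] using ht
    have hts' : (t : ℝ) < s := by exact_mod_cast hts
    exact ((hsol s hs).2 t ⟨t.2, hts'.le⟩).mono_of_mem_nhdsWithin
      (by
        rw [← Ici_inter_Iic]
        exact inter_mem self_mem_nhdsWithin (mem_nhdsWithin_of_mem_nhds (Iic_mem_nhds hts')))
  · refine tendsto_atTop.2 fun R => ?_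
    -- Otherwise the norm is below `R` at times arbitrarily close to T. From such a time after T − δ
    -- the solution continues for a further time δ, beyond T.
    by_contra hcon
    obtain ⟨δ, hδ, h⟩ := hext R
    have hTpos : 0 < T.toReal := ENNReal.toReal_pos hpos.ne' hTtop
    have hev : Ioo (max 0 (T.toReal - δ)) T.toReal ∈ 𝓝[<] T.toReal :=
      Ioo_mem_nhdsLT (max_lt hTpos (by have : (0 : ℝ) < δ := hδ; linarith))
    obtain ⟨t, ht, hmem⟩ := ((Filter.not_eventually.1 hcon).and_eventually hev).exists
    have ht0 : 0 ≤ t := (le_max_left _ _).trans hmem.1.le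
    lift t to ℝ≥0 using ht0
    have htT : (t : ℝ≥0∞) < T := by
      rw [← ENNReal.ofReal_toReal hTtop, ← ENNReal.ofReal_coe_nnreal]
      exact (ENNReal.ofReal_lt_ofReal_iff hTpos).2 hmem.2
    obtain ⟨s, hs, hts⟩ : ∃ s ∈ I, (t : ℝ≥0∞) < s := by simpa [hT, lt_iSup_iff] using htT
    have htI : t ∈ I := ⟨z, (hsol s hs).mono (by exact_mod_cast hts.le)⟩
    have h1 := hle _ (h t htI (not_le.1 ht).le)
    have h2 : ((t + δ : ℝ≥0) : ℝ) ≤ T.toReal := by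
      simpa only [ENNReal.coe_toReal] using ENNReal.toReal_mono hTtop h1
    have h3 := (le_max_right _ _).trans_lt hmem.1
    push_cast at h2
    linarith
  · have hmem : ∀ t : ℝ≥0, (t : ℝ≥0∞) < S → t ∈ I := fun t ht =>
      ⟨z', solvesOn_of_hasDerivWithinAt_Ici h0 h' ht⟩
    refine ⟨le_of_forall_lt fun c hc => ?_, fun t ht => ?_⟩
    · obtain ⟨c', hc', hcS⟩ := ENNReal.lt_iff_exists_nnreal_btwn.1 hc
      exact hc'.trans_le (hle c' (hmem c' hcS))
    · exact (hzeq t z' (solvesOn_of_hasDerivWithinAt_Ici h0 h' ht) t ⟨t.2, le_rfl⟩).symm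

end MaximalSolution

/-! ### The system for mean and variance -/

section System

variable {a₀ a₁ b : ℝ → ℝ}

/-- The point of the closed upper half plane below or equal to which a point is moved up. -/
def liftUp (z : ℝ × ℝ) : ℝ × ℝ := (z.1, max z.2 0)

lemma liftUp_of_nonneg {z : ℝ × ℝ} (h : 0 ≤ z.2) : liftUp z = z := by
  simp [liftUp, h]

lemma liftUp_mem (z : ℝ × ℝ) : liftUp z ∈ {z : ℝ × ℝ | 0 ≤ z.2} :=
  le_max_right z.2 0

lemma lipschitzWith_liftUp : LipschitzWith 1 liftUp := by
  have h := LipschitzWith.prod_fst (α := ℝ) (β := ℝ)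
  have h2 := (LipschitzWith.prod_snd (α := ℝ) (β := ℝ)).max_const 0
  have h3 := h.prodMk h2
  rw [max_self] at h3
  exact h3

/-- The vector field of the system for `(A, G)`, extended from `q ≥ 0` to the whole plane. -/
def systemField (a₀ a₁ b : ℝ → ℝ) (z : ℝ × ℝ) : ℝ × ℝ :=
  (gaussExt a₀ (liftUp z) + gaussExt a₁ (liftUp z) * z.1,
    gaussExt b (liftUp z) ^ 2 + 2 * gaussExt a₁ (liftUp z) * (liftUp z).2)

/-- On a bounded set Lipschitz functions are bounded, which controls f (g − g') + (f − f') g'. -/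
lemma LipschitzOnWith.exists_mul {α : Type*} [PseudoMetricSpace α] {s : Set α} {f g : α → ℝ}
    (hs : Bornology.IsBounded s)
    (hf : ∃ K, LipschitzOnWith K f s) (hg : ∃ K, LipschitzOnWith K g s) :
    ∃ K, LipschitzOnWith K (fun x => f x * g x) s := by
  obtain ⟨K, hK⟩ := hf
  obtain ⟨L, hL⟩ := hg
  have bdd : ∀ {h : α → ℝ} {C : ℝ≥0}, LipschitzOnWith C h s → ∃ M : ℝ≥0, ∀ x ∈ s, |h x| ≤ M := by
    intro h C hh
    rcases s.eq_empty_or_nonempty with rfl | ⟨y, hy⟩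
    · exact ⟨0, fun x hx => absurd hx (notMem_empty x)⟩
    obtain ⟨r, hr⟩ := Metric.isBounded_iff.1 hs
    refine ⟨(|h y| + C * r).toNNReal, fun x hx => le_trans ?_ (Real.le_coe_toNNReal _)⟩
    have h1 := hh.dist_le_mul x hx y hy
    have h2 : C * dist x y ≤ C * r := by gcongr; exact hr hx hy
    rw [Real.dist_eq] at h1
    have h3 := abs_sub_abs_le_abs_sub (h x) (h y)
    linarith
  obtain ⟨M, hM⟩ := bdd hK
  obtain ⟨N, hN⟩ := bdd hL
  refine ⟨M * L + K * N, LipschitzOnWith.of_dist_le_mul fun x hx y hy => ?_⟩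
  have h1 := hK.dist_le_mul x hx y hy
  have h2 := hL.dist_le_mul x hx y hy
  rw [Real.dist_eq] at h1 h2 ⊢
  calc |f x * g x - f y * g y| = |f x * (g x - g y) + (f x - f y) * g y| := by ring_nf
    _ ≤ |f x| * |g x - g y| + |f x - f y| * |g y| := by
      rw [← abs_mul, ← abs_mul]; exact abs_add_le _ _
    _ ≤ M * (L * dist x y) + (K * dist x y) * N := by
      gcongr
      · exact hM x hx
      · exact hN y hy
    _ = ↑(M * L + K * N) * dist x y := by push_cast; ring

lemma LipschitzOnWith.exists_add {α : Type*} [PseudoMetricSpace α] {s : Set α} {f g : α → ℝ}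
    (hf : ∃ K, LipschitzOnWith K f s) (hg : ∃ K, LipschitzOnWith K g s) :
    ∃ K, LipschitzOnWith K (fun x => f x + g x) s := by
  obtain ⟨K, hK⟩ := hf
  obtain ⟨L, hL⟩ := hg
  exact ⟨K + L, hK.add hL⟩

lemma lipschitzOnWith_systemField (da₀ : PartialsExtend a₀) (da₁ : PartialsExtend a₁)
    (db : PartialsExtend b) (R : ℝ) :
    ∃ K, LipschitzOnWith K (systemField a₀ a₁ b) (Metric.closedBall 0 R) := by
  have hb := Metric.isBounded_closedBall (x := (0 : ℝ × ℝ)) (r := R)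
  have hmaps : MapsTo liftUp (Metric.closedBall 0 R)
      (Metric.closedBall 0 R ∩ {z : ℝ × ℝ | 0 ≤ z.2}) := fun z hz => by
    refine ⟨?_, liftUp_mem z⟩
    have h0 : liftUp 0 = 0 := by simp [liftUp]
    have := lipschitzWith_liftUp.dist_le_mul z 0
    rw [h0] at this
    rw [Metric.mem_closedBall] at hz ⊢
    simpa using this.trans (by simpa using hz)
  have key : ∀ {f : ℝ → ℝ}, PartialsExtend f →
      ∃ K, LipschitzOnWith K (fun z => gaussExt f (liftUp z)) (Metric.closedBall 0 R) := by
    intro f hf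
    obtain ⟨K, hK⟩ := hf.lipschitzOnWith_gaussExt R
    exact ⟨K * 1, hK.comp lipschitzWith_liftUp.lipschitzOnWith hmaps⟩
  have hfst : ∃ K, LipschitzOnWith K (fun z : ℝ × ℝ => z.1) (Metric.closedBall 0 R) :=
    ⟨1, LipschitzWith.prod_fst.lipschitzOnWith⟩
  have hsnd : ∃ K, LipschitzOnWith K (fun z : ℝ × ℝ => (liftUp z).2) (Metric.closedBall 0 R) :=
    ⟨1 * 1, (LipschitzWith.prod_snd.comp lipschitzWith_liftUp).lipschitzOnWith⟩
  have hc : ∃ K, LipschitzOnWith K (fun _ : ℝ × ℝ => (2 : ℝ)) (Metric.closedBall 0 R) :=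
    ⟨0, (LipschitzWith.const 2).lipschitzOnWith⟩
  obtain ⟨K, hK⟩ := LipschitzOnWith.exists_add (key da₀)
    (LipschitzOnWith.exists_mul hb (key da₁) hfst)
  obtain ⟨L, hL⟩ := LipschitzOnWith.exists_add (LipschitzOnWith.exists_mul hb (key db) (key db))
    (LipschitzOnWith.exists_mul hb (LipschitzOnWith.exists_mul hb hc (key da₁)) hsnd)
  refine ⟨max K L, ?_⟩
  have h := hK.prodMk hL
  simp only [← sq] at h
  exact h

lemma IsODESolution.hasDerivWithinAt_systemField {x₀ : ℝ} {S : ℝ≥0∞} {A G : ℝ → ℝ}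
    (h : IsODESolution a₀ a₁ b x₀ S A G) (t : ℝ≥0) (ht : (t : ℝ≥0∞) < S) :
    HasDerivWithinAt (fun t => (A t, G t)) (systemField a₀ a₁ b (A t, G t)) (Ici 0) t := by
  have := (h.derivA t ht).prodMk (h.derivG t ht)
  simpa [systemField, liftUp_of_nonneg (z := (A t, G t)) (h.nonneg t ht), gaussExt] using this

lemma HasDerivWithinAt.fst_snd_real {z : ℝ → ℝ × ℝ} {z' : ℝ × ℝ} {s : Set ℝ} {t : ℝ}
    (h : HasDerivWithinAt z z' s t) :
    HasDerivWithinAt (fun t => (z t).1) z'.1 s t ∧ HasDerivWithinAt (fun t => (z t).2) z'.2 s t :=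
  ⟨((ContinuousLinearMap.fst ℝ ℝ ℝ).hasFDerivAt.comp_hasDerivWithinAt t h),
    ((ContinuousLinearMap.snd ℝ ℝ ℝ).hasFDerivAt.comp_hasDerivWithinAt t h)⟩

/-- For q ≤ 0 the term carrying the factor max q 0 vanishes, and the second component of the field
is a square. The curve therefore cannot descend below the axis. -/
lemma SolvesOn.snd_nonneg {x₀ s : ℝ} {z : ℝ → ℝ × ℝ}
    (h : SolvesOn (systemField a₀ a₁ b) (x₀, 0) s z) : ∀ t ∈ Icc 0 s, 0 ≤ (z t).2 := by
  have hd : ∀ t ∈ Icc 0 s, HasDerivWithinAt (fun t => -(z t).2)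
      (-(systemField a₀ a₁ b (z t)).2) (Icc 0 s) t :=
    fun t ht => (HasDerivWithinAt.fst_snd_real (h.2 t ht)).2.neg
  -- The derivative of −q is only ≤ 0 at a contact point, while the comparison principle needs a
  -- strict inequality; the barrier ε (1 + t) has slope ε > 0.
  have key : ∀ ε > 0, ∀ t ∈ Icc 0 s, -(z t).2 ≤ ε * (1 + t) := by
    intro ε hε t ht
    have hB : ∀ t, HasDerivAt (fun t : ℝ => ε * (1 + t)) ε t := fun t => by
      simpa using ((hasDerivAt_id t).const_add 1).const_mul ε
    refine image_le_of_deriv_right_lt_deriv_boundary (a := 0) (b := s)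
      (fun u hu => (hd u hu).continuousWithinAt)
      (fun u hu => (hd u ⟨hu.1, hu.2.le⟩).mono_of_mem_nhdsWithin
        (mem_of_superset (Icc_mem_nhdsGE hu.2) (Icc_subset_Icc_left hu.1)))
      ?_ hB (fun u hu heq => ?_) ht
    · simp only [h.1]; simpa using hε.le
    · have hneg : (z u).2 ≤ 0 := by
        have : 0 ≤ ε * (1 + u) := mul_nonneg hε.le (by linarith [hu.1])
        linarith
      simp only [systemField, liftUp, max_eq_right hneg, mul_zero, add_zero]
      linarith [sq_nonneg (gaussExt b ((z u).1, 0))]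
  intro t ht
  by_contra! hneg
  have h1 : 0 < 1 + t := by linarith [ht.1]
  -- With this ε the barrier at time t equals half of −q(t), which is impossible as −q(t) > 0.
  have := key (-(z t).2 / (2 * (1 + t))) (by apply div_pos <;> linarith) t ht
  rw [div_mul_eq_mul_div, le_div_iff₀ (by positivity)] at this
  nlinarith

/-- The system has a unique maximal solution, and its norm explodes at a finite end point. -/
theorem exists_maximal_IsODESolution (da₀ : PartialsExtend a₀) (da₁ : PartialsExtend a₁)
    (db : PartialsExtend b) (x₀ : ℝ) :
    ∃ (T : ℝ≥0∞) (A G : ℝ → ℝ), 0 < T ∧ IsODESolution a₀ a₁ b x₀ T A G ∧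
      (T ≠ ∞ → Tendsto (fun t => |A t| + |G t|) (𝓝[<] T.toReal) atTop) ∧
      ∀ (S : ℝ≥0∞) (A' G' : ℝ → ℝ), IsODESolution a₀ a₁ b x₀ S A' G' →
        S ≤ T ∧ ∀ t : ℝ≥0, (t : ℝ≥0∞) < S → A' t = A t ∧ G' t = G t := by
  obtain ⟨T, z, hT, h0, hd, hblow, huniq⟩ :=
    exists_maximal_solution (lipschitzOnWith_systemField da₀ da₁ db) (x₀, 0)
  have hnn : ∀ t : ℝ≥0, (t : ℝ≥0∞) < T → 0 ≤ (z t).2 := fun t ht =>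
    (solvesOn_of_hasDerivWithinAt_Ici h0 hd ht).snd_nonneg t ⟨t.2, le_rfl⟩
  refine ⟨T, fun t => (z t).1, fun t => (z t).2, hT, ⟨?_, ?_, hnn, ?_, ?_⟩, fun h => ?_, ?_⟩
  · rw [h0]
  · rw [h0]
  · intro t ht
    have := (HasDerivWithinAt.fst_snd_real (hd t ht)).2
    simpa [systemField, liftUp_of_nonneg (hnn t ht), gaussExt] using this
  · intro t ht
    have := (HasDerivWithinAt.fst_snd_real (hd t ht)).1
    simpa [systemField, liftUp_of_nonneg (hnn t ht), gaussExt] using this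
  · refine tendsto_atTop_mono (fun t => ?_) (hblow h)
    rw [Prod.norm_def, Real.norm_eq_abs, Real.norm_eq_abs]
    exact max_le (by linarith [abs_nonneg (z t).2]) (by linarith [abs_nonneg (z t).1])
  · intro S A' G' h
    obtain ⟨h1, h2⟩ := huniq S (fun t => (A' t, G' t)) (by rw [h.initA, h.initG])
      h.hasDerivWithinAt_systemField
    exact ⟨h1, fun t ht => ⟨congrArg Prod.fst (h2 t ht), congrArg Prod.snd (h2 t ht)⟩⟩

end System

/-! ### Variation of constants along a path -/

section Primitives

/-- An absolutely continuous function is bounded above by some C, and exp is Lipschitz on (−∞, C].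
-/
lemma AbsolutelyContinuousOnInterval.exp_comp {f : ℝ → ℝ} {a b : ℝ}
    (hf : AbsolutelyContinuousOnInterval f a b) :
    AbsolutelyContinuousOnInterval (fun x => Real.exp (f x)) a b := by
  obtain ⟨C, hC⟩ := hf.exists_bound
  have hlip : LipschitzOnWith (Real.exp C).toNNReal Real.exp (Iic C) := by
    refine Convex.lipschitzOnWith_of_nnnorm_deriv_le (fun x _ => Real.differentiableAt_exp)
      (fun x hx => ?_) (convex_Iic C)
    rw [← NNReal.coe_le_coe, Real.deriv_exp, Real.coe_toNNReal _ (Real.exp_pos _).le, coe_nnnorm,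
      Real.norm_eq_abs, Real.abs_exp]
    exact Real.exp_le_exp.2 hx
  rw [absolutelyContinuousOnInterval_iff] at hf ⊢
  intro ε hε
  obtain ⟨δ, hδ, h⟩ := hf (ε / Real.exp C) (by positivity)
  refine ⟨δ, hδ, fun E hE hlt => ?_⟩
  have h1 := h E hE hlt
  rw [lt_div_iff₀ (Real.exp_pos C), Finset.sum_mul] at h1
  refine lt_of_le_of_lt (Finset.sum_le_sum fun i hi => ?_) h1
  have hmem : ∀ x ∈ uIcc a b, f x ∈ Iic C := fun x hx => (le_abs_self _).trans (hC x hx)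
  have h2 := hlip.dist_le_mul _ (hmem _ (hE.1 i hi).1) _ (hmem _ (hE.1 i hi).2)
  rwa [Real.coe_toNNReal _ (Real.exp_pos _).le, mul_comm] at h2

/-- The product rule for the exponential of a primitive times a primitive. -/
lemma exp_integral_mul_primitive {β h : ℝ → ℝ} {t : ℝ} (w₀ : ℝ)
    (hβ : IntervalIntegrable β volume 0 t) (hh : IntervalIntegrable h volume 0 t) :
    Real.exp (∫ r in (0 : ℝ)..t, β r) * (w₀ + ∫ r in (0 : ℝ)..t, h r) =
      w₀ + ∫ s in (0 : ℝ)..t, Real.exp (∫ r in (0 : ℝ)..s, β r) *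
        (h s + β s * (w₀ + ∫ r in (0 : ℝ)..s, h r)) := by
  have acB := hβ.absolutelyContinuousOnInterval_intervalIntegral (c := 0) (by simp)
  have acH := hh.absolutelyContinuousOnInterval_intervalIntegral (c := 0) (by simp)
  have acW : AbsolutelyContinuousOnInterval (fun s => w₀ + ∫ r in (0 : ℝ)..s, h r) 0 t :=
    ((LipschitzWith.const w₀).lipschitzOnWith (s := uIcc 0 t)).absolutelyContinuousOnInterval.add acH
  -- As β and h are merely integrable, the primitives are differentiable only almost everywhere;
  -- absolute continuity makes integration by parts valid nevertheless.
  have key := (AbsolutelyContinuousOnInterval.exp_comp acB).integral_deriv_mul_eq_sub acW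
  simp only [intervalIntegral.integral_same, Real.exp_zero, add_zero, one_mul] at key
  rw [eq_sub_iff_add_eq] at key
  rw [← key, add_comm]
  congr 1
  refine intervalIntegral.integral_congr_ae ?_
  filter_upwards [hβ.ae_hasDerivAt_integral, hh.ae_hasDerivAt_integral] with s h1 h2 hs
  have hs' := uIoc_subset_uIcc hs
  rw [(h1 hs' 0 (by simp)).exp.deriv, ((h2 hs' 0 (by simp)).const_add w₀).deriv]
  ring

lemma continuousOn_primitive_zero {β : ℝ → ℝ} {t : ℝ} (ht : 0 ≤ t)
    (hβ : IntervalIntegrable β volume 0 t) :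
    ContinuousOn (fun s => ∫ r in (0 : ℝ)..s, β r) (Icc 0 t) := by
  have := (hβ.absolutelyContinuousOnInterval_intervalIntegral (c := 0) (by simp)).continuousOn
  rwa [uIcc_of_le ht] at this

lemma IntervalIntegrable.mul_continuousOn_Icc {f g : ℝ → ℝ} {t : ℝ} (ht : 0 ≤ t)
    (hf : IntervalIntegrable f volume 0 t) (hg : ContinuousOn g (Icc 0 t)) :
    IntervalIntegrable (fun s => f s * g s) volume 0 t :=
  hf.mul_continuousOn (by rwa [uIcc_of_le ht])

/-- Variation of constants: from the integral equation to the explicit formula. -/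
lemma variation_of_constants {α β x : ℝ → ℝ} {t : ℝ} (x₀ : ℝ) (ht : 0 ≤ t)
    (hα : IntervalIntegrable α volume 0 t) (hβ : IntervalIntegrable β volume 0 t)
    (hx : ContinuousOn x (Icc 0 t)) {y : ℝ → ℝ}
    (hy : ∀ s ∈ Icc 0 t, y s = x s - x₀ - ∫ r in (0 : ℝ)..s, (α r + β r * x r)) :
    ContinuousOn y (Icc 0 t) ∧
    Real.exp (-∫ r in (0 : ℝ)..t, β r) * x t =
      x₀ + (∫ s in (0 : ℝ)..t, α s * Real.exp (-∫ r in (0 : ℝ)..s, β r)) +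
        (Real.exp (-∫ r in (0 : ℝ)..t, β r) * y t +
          ∫ s in (0 : ℝ)..t, β s * Real.exp (-∫ r in (0 : ℝ)..s, β r) * y s) := by
  have hh : IntervalIntegrable (fun r => α r + β r * x r) volume 0 t :=
    hα.add (IntervalIntegrable.mul_continuousOn_Icc ht hβ hx)
  have hyc : ContinuousOn y (Icc 0 t) :=
    ((hx.sub continuousOn_const).sub (continuousOn_primitive_zero ht hh)).congr hy
  refine ⟨hyc, ?_⟩
  have hE : ContinuousOn (fun s => Real.exp (-∫ r in (0 : ℝ)..s, β r)) (Icc 0 t) :=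
    (continuousOn_primitive_zero ht hβ).neg.rexp
  -- The integrating factor is applied to x − y, which is absolutely continuous; the noise part y is
  -- never differentiated.
  have key := exp_integral_mul_primitive x₀ hβ.neg hh
  simp only [Pi.neg_apply, intervalIntegral.integral_neg] at key
  have h1 : ∫ s in (0 : ℝ)..t, Real.exp (-∫ r in (0 : ℝ)..s, β r) *
        (α s + β s * x s + -β s * (x₀ + ∫ r in (0 : ℝ)..s, (α r + β r * x r))) =
      ∫ s in (0 : ℝ)..t, (α s * Real.exp (-∫ r in (0 : ℝ)..s, β r) +
        β s * Real.exp (-∫ r in (0 : ℝ)..s, β r) * y s) := by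
    refine intervalIntegral.integral_congr fun s hs => ?_
    rw [uIcc_of_le ht] at hs
    simp only [hy s hs]
    ring
  rw [h1, intervalIntegral.integral_add (IntervalIntegrable.mul_continuousOn_Icc ht hα hE)
    (IntervalIntegrable.mul_continuousOn_Icc ht (IntervalIntegrable.mul_continuousOn_Icc ht hβ hE)
      hyc)] at key
  have h2 : x₀ + ∫ r in (0 : ℝ)..t, (α r + β r * x r) = x t - y t := by
    rw [hy t ⟨ht, le_rfl⟩]; ring
  rw [h2] at key
  linarith

/-- Variation of constants: from the explicit formula to the integral equation. -/
lemma integral_equation_of_explicit {α β x : ℝ → ℝ} {t : ℝ} (x₀ : ℝ) (ht : 0 ≤ t)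
    (hα : IntervalIntegrable α volume 0 t) (hβ : IntervalIntegrable β volume 0 t)
    (hx : ContinuousOn x (Icc 0 t)) {z : ℝ → ℝ}
    (hz : ∀ s ∈ Icc 0 t, z s = Real.exp (-∫ r in (0 : ℝ)..s, β r) * x s - x₀ -
      ∫ r in (0 : ℝ)..s, α r * Real.exp (-∫ u in (0 : ℝ)..r, β u)) :
    ContinuousOn z (Icc 0 t) ∧
    x t - x₀ - (∫ r in (0 : ℝ)..t, (α r + β r * x r)) =
      Real.exp (∫ r in (0 : ℝ)..t, β r) * z t -
        ∫ s in (0 : ℝ)..t, β s * Real.exp (∫ r in (0 : ℝ)..s, β r) * z s := by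
  have hE : ContinuousOn (fun s => Real.exp (∫ r in (0 : ℝ)..s, β r)) (Icc 0 t) :=
    (continuousOn_primitive_zero ht hβ).rexp
  have hE' : ContinuousOn (fun s => Real.exp (-∫ r in (0 : ℝ)..s, β r)) (Icc 0 t) :=
    (continuousOn_primitive_zero ht hβ).neg.rexp
  have hh : IntervalIntegrable (fun r => α r * Real.exp (-∫ u in (0 : ℝ)..r, β u)) volume 0 t :=
    IntervalIntegrable.mul_continuousOn_Icc ht hα hE'
  have hzc : ContinuousOn z (Icc 0 t) :=
    (((hE'.mul hx).sub continuousOn_const).sub (continuousOn_primitive_zero ht hh)).congr hz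
  refine ⟨hzc, ?_⟩
  have hsolve : ∀ s ∈ Icc 0 t, Real.exp (∫ r in (0 : ℝ)..s, β r) *
      (x₀ + ∫ r in (0 : ℝ)..s, α r * Real.exp (-∫ u in (0 : ℝ)..r, β u)) =
      x s - Real.exp (∫ r in (0 : ℝ)..s, β r) * z s := fun s hs => by
    have h0 : Real.exp (∫ r in (0 : ℝ)..s, β r) * Real.exp (-∫ r in (0 : ℝ)..s, β r) = 1 := by
      rw [← Real.exp_add]; simp
    rw [hz s hs]
    linear_combination (x s) * h0
  -- Here the absolutely continuous part is e^{−∫β} x − z, and multiplication by e^{∫β} undoes the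
  -- integrating factor.
  have key := exp_integral_mul_primitive x₀ hβ hh
  have h1 : ∫ s in (0 : ℝ)..t, Real.exp (∫ r in (0 : ℝ)..s, β r) *
        (α s * Real.exp (-∫ u in (0 : ℝ)..s, β u) +
          β s * (x₀ + ∫ r in (0 : ℝ)..s, α r * Real.exp (-∫ u in (0 : ℝ)..r, β u))) =
      ∫ s in (0 : ℝ)..t, ((α s + β s * x s) -
        β s * Real.exp (∫ r in (0 : ℝ)..s, β r) * z s) := by
    refine intervalIntegral.integral_congr fun s hs => ?_
    rw [uIcc_of_le ht] at hs
    have h0 : Real.exp (∫ r in (0 : ℝ)..s, β r) * Real.exp (-∫ r in (0 : ℝ)..s, β r) = 1 := by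
      rw [← Real.exp_add]; simp
    have := hsolve s hs
    linear_combination α s * h0 + β s * this
  rw [h1, intervalIntegral.integral_sub
    (hα.add (IntervalIntegrable.mul_continuousOn_Icc ht hβ hx))
    (IntervalIntegrable.mul_continuousOn_Icc ht (IntervalIntegrable.mul_continuousOn_Icc ht hβ hE)
      hzc), hsolve t ⟨ht, le_rfl⟩] at key
  linarith

end Primitives

/-! ### Weighted sums for time integrals -/

section Discretization

/-- The largest multiple of `1 / (n + 1)` below `s`. -/
def gridFloor (n : ℕ) (s : ℝ) : ℝ := ⌊((n : ℝ) + 1) * s⌋₊ / ((n : ℝ) + 1)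

/-- The number of grid points with mesh `1 / (n + 1)` in `[0, t]`. -/
def gridCard (t : ℝ) (n : ℕ) : ℕ := ⌊((n : ℝ) + 1) * t⌋₊ + 1

/-- The integral of `k` over the part of `(0, t]` in the `i`-th cell of the grid. -/
def gridWeight (k : ℝ → ℝ) (t : ℝ) (n i : ℕ) : ℝ :=
  ∫ s in Ioc 0 t, indicator {s | ⌊((n : ℝ) + 1) * s⌋₊ = i} k s

lemma gridFloor_nonneg (n : ℕ) (s : ℝ) : 0 ≤ gridFloor n s := by
  unfold gridFloor; positivity

lemma gridFloor_le (n : ℕ) {s : ℝ} (hs : 0 ≤ s) : gridFloor n s ≤ s := by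
  unfold gridFloor
  rw [div_le_iff₀ (by positivity), mul_comm]
  exact Nat.floor_le (by positivity)

lemma tendsto_gridFloor {s : ℝ} (hs : 0 ≤ s) :
    Tendsto (fun n => gridFloor n s) atTop (𝓝 s) := by
  have h1 : Tendsto (fun n : ℕ => s - 1 / ((n : ℝ) + 1)) atTop (𝓝 s) := by
    simpa using (tendsto_const_nhds (x := s)).sub tendsto_one_div_add_atTop_nhds_zero_nat
  refine tendsto_of_tendsto_of_tendsto_of_le_of_le h1 tendsto_const_nhds (fun n => ?_)
    (fun n => gridFloor_le n hs)
  have hn : (0 : ℝ) < n + 1 := by positivity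
  simp only [gridFloor]
  rw [le_div_iff₀ hn, sub_mul, one_div, inv_mul_cancel₀ hn.ne', mul_comm]
  linarith [Nat.lt_floor_add_one (((n : ℝ) + 1) * s)]

lemma gridPoint_le {t : ℝ} (ht : 0 ≤ t) {n i : ℕ} (hi : i < gridCard t n) :
    (i : ℝ) / ((n : ℝ) + 1) ≤ t := by
  rw [div_le_iff₀ (by positivity), mul_comm]
  have : i ≤ ⌊((n : ℝ) + 1) * t⌋₊ := Nat.lt_succ_iff.1 hi
  exact (Nat.le_floor_iff (by positivity)).1 this

lemma measurableSet_gridCell (n i : ℕ) : MeasurableSet {s : ℝ | ⌊((n : ℝ) + 1) * s⌋₊ = i} :=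
  (Nat.measurable_floor.comp (measurable_const_mul ((n : ℝ) + 1))) (measurableSet_singleton i)

lemma sum_grid_indicator (k F : ℝ → ℝ) {t : ℝ} (n : ℕ) {s : ℝ} (hs : s ∈ Ioc 0 t) :
    ∑ i ∈ Finset.range (gridCard t n),
      indicator {s | ⌊((n : ℝ) + 1) * s⌋₊ = i} k s * F (i / ((n : ℝ) + 1)) =
      k s * F (gridFloor n s) := by
  rw [Finset.sum_eq_single ⌊((n : ℝ) + 1) * s⌋₊]
  · simp [gridFloor]
  · intro i _ hi
    rw [indicator_of_notMem (by simpa using hi.symm), zero_mul]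
  · intro h
    refine absurd (Finset.mem_range.2 (Nat.lt_succ_of_le (Nat.floor_le_floor ?_))) h
    gcongr
    exact hs.2

lemma integrable_gridCell {k : ℝ → ℝ} {t : ℝ} (hk : IntegrableOn k (Ioc 0 t)) (n i : ℕ) :
    Integrable (indicator {s | ⌊((n : ℝ) + 1) * s⌋₊ = i} k) (volume.restrict (Ioc 0 t)) :=
  hk.indicator (measurableSet_gridCell n i)

lemma integrableOn_mul_gridFloor {k : ℝ → ℝ} {t : ℝ} (hk : IntegrableOn k (Ioc 0 t)) (F : ℝ → ℝ)
    (n : ℕ) : IntegrableOn (fun s => k s * F (gridFloor n s)) (Ioc 0 t) := by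
  have : Integrable (fun s => ∑ i ∈ Finset.range (gridCard t n),
      indicator {s | ⌊((n : ℝ) + 1) * s⌋₊ = i} k s * F (i / ((n : ℝ) + 1)))
      (volume.restrict (Ioc 0 t)) :=
    integrable_finsetSum _ fun i _ => (integrable_gridCell hk n i).mul_const _
  refine this.congr ?_
  filter_upwards [ae_restrict_mem measurableSet_Ioc] with s hs using sum_grid_indicator k F n hs

/-- The weights integrate `k` exactly over each cell and only `F` is sampled, so convergence needs
no regularity of `k`. The left side is a finite linear combination of values of `F`, and thus a
combination of Wiener integrals or of adapted variables when `F` is a path. -/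
lemma sum_gridWeight {k : ℝ → ℝ} {t : ℝ} (hk : IntegrableOn k (Ioc 0 t)) (F : ℝ → ℝ) (n : ℕ) :
    ∑ i ∈ Finset.range (gridCard t n), gridWeight k t n i * F (i / ((n : ℝ) + 1)) =
      ∫ s in Ioc 0 t, k s * F (gridFloor n s) := by
  simp only [gridWeight, ← integral_mul_const]
  rw [← integral_finsetSum _ fun i _ => (integrable_gridCell hk n i).mul_const _]
  refine setIntegral_congr_fun measurableSet_Ioc fun s hs => ?_
  exact sum_grid_indicator k F n hs

lemma abs_sum_gridWeight_le {k : ℝ → ℝ} {t : ℝ} (hk : IntegrableOn k (Ioc 0 t)) {F : ℝ → ℝ}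
    (hF : ∀ s, |F s| ≤ 1) (n : ℕ) :
    |∑ i ∈ Finset.range (gridCard t n), gridWeight k t n i * F (i / ((n : ℝ) + 1))| ≤
      ∫ s in Ioc 0 t, |k s| := by
  rw [sum_gridWeight hk]
  refine norm_integral_le_of_norm_le (f := fun s => k s * F (gridFloor n s)) hk.abs
    (.of_forall fun s => ?_)
  rw [Real.norm_eq_abs, abs_mul]
  exact mul_le_of_le_one_right (abs_nonneg _) (hF _)

lemma tendsto_sum_gridWeight {k : ℝ → ℝ} {t : ℝ} (hk : IntegrableOn k (Ioc 0 t)) {F : ℝ → ℝ}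
    {C : ℝ} (hC : ∀ s ∈ Icc 0 t, |F s| ≤ C)
    (hF : ∀ᵐ s ∂volume.restrict (Ioc 0 t), Tendsto (fun n => F (gridFloor n s)) atTop (𝓝 (F s))) :
    Tendsto (fun n => ∑ i ∈ Finset.range (gridCard t n),
      gridWeight k t n i * F (i / ((n : ℝ) + 1))) atTop (𝓝 (∫ s in Ioc 0 t, k s * F s)) := by
  simp only [sum_gridWeight hk]
  refine tendsto_integral_of_dominated_convergence (fun s => |k s| * C)
    (fun n => (integrableOn_mul_gridFloor hk F n).aestronglyMeasurable) (hk.abs.mul_const C)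
    (fun n => ?_) ?_
  · filter_upwards [ae_restrict_mem measurableSet_Ioc] with s hs
    rw [Real.norm_eq_abs, abs_mul]
    gcongr
    exact hC _ ⟨gridFloor_nonneg n s, (gridFloor_le n hs.1.le).trans hs.2⟩
  · filter_upwards [hF] with s hs using hs.const_mul _

lemma tendsto_sum_gridWeight_of_continuousOn {k : ℝ → ℝ} {t : ℝ} (hk : IntegrableOn k (Ioc 0 t))
    {F : ℝ → ℝ} (hF : ContinuousOn F (Icc 0 t)) :
    Tendsto (fun n => ∑ i ∈ Finset.range (gridCard t n),
      gridWeight k t n i * F (i / ((n : ℝ) + 1))) atTop (𝓝 (∫ s in Ioc 0 t, k s * F s)) := by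
  obtain ⟨C, hC⟩ := isCompact_Icc.exists_bound_of_continuousOn hF
  refine tendsto_sum_gridWeight hk hC ?_
  filter_upwards [ae_restrict_mem measurableSet_Ioc] with s hs
  have h1 := (hF s ⟨hs.1.le, hs.2⟩).tendsto
  refine h1.comp (tendsto_nhdsWithin_iff.2 ⟨tendsto_gridFloor hs.1.le, .of_forall fun n =>
    ⟨gridFloor_nonneg n s, (gridFloor_le n hs.1.le).trans hs.2⟩⟩)

/-- In the integration by parts an integrand on (0, s] enters as the indicator of u ≤ s; these sums
produce the kernel of the limit. -/
lemma tendsto_sum_gridWeight_indicator_Ici {k : ℝ → ℝ} {t : ℝ} (hk : IntegrableOn k (Ioc 0 t))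
    {u : ℝ} (hu : u ∈ Ioc 0 t) :
    Tendsto (fun n => ∑ i ∈ Finset.range (gridCard t n),
      gridWeight k t n i * (Ici u).indicator (fun _ => (1 : ℝ)) (i / ((n : ℝ) + 1))) atTop
      (𝓝 (∫ s in u..t, k s)) := by
  have h : ∫ s in Ioc 0 t, k s * (Ici u).indicator (fun _ => (1 : ℝ)) s = ∫ s in u..t, k s := by
    rw [intervalIntegral.integral_of_le hu.2, ← integral_Icc_eq_integral_Ioc (x := u)]
    have : (fun s => k s * (Ici u).indicator (fun _ => (1 : ℝ)) s) = (Ici u).indicator k := by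
      funext s; by_cases hs : s ∈ Ici u <;> simp [hs]
    rw [this, setIntegral_indicator measurableSet_Ici]
    congr 2
    ext s
    simp only [mem_inter_iff, mem_Ioc, mem_Ici, mem_Icc]
    have := hu.1
    constructor
    · rintro ⟨⟨_, h2⟩, h3⟩; exact ⟨h3, h2⟩
    · rintro ⟨h1, h2⟩; exact ⟨⟨by linarith, h2⟩, h1⟩
  rw [← h]
  refine tendsto_sum_gridWeight (C := 1) hk (fun s _ => ?_) ?_
  · by_cases hs : s ∈ Ici u <;> simp [hs]
  -- At s = u the sample points may approach from below, where the indicator is 0; a single point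
  -- does not matter.
  · have hne : ∀ᵐ s ∂volume.restrict (Ioc 0 t), s ≠ u :=
      ae_restrict_of_ae (by simp [ae_iff, measure_singleton])
    filter_upwards [ae_restrict_mem measurableSet_Ioc, hne] with s hs hsu
    refine tendsto_const_nhds.congr' ?_
    rcases lt_or_gt_of_ne hsu with hlt | hgt
    · refine .of_forall fun n => ?_
      have hlt' := (gridFloor_le n hs.1.le).trans_lt hlt
      simp [indicator, hlt.not_ge, hlt'.not_ge]
    · filter_upwards [(tendsto_gridFloor hs.1.le).eventually_const_le hgt] with n hn
      simp [indicator, hgt.le, hn]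

end Discretization

/-! ### The Wiener integral as an isometry, and its law -/

section WienerIsometry

variable {Ω : Type*} {mΩ : MeasurableSpace Ω} {P : Measure Ω} {W : ℝ≥0 → Ω → ℝ}

lemma memLp_indicator_Ioc (t : ℝ≥0) :
    MemLp ((Ioc 0 (t : ℝ)).indicator fun _ => (1 : ℝ)) 2 volume :=
  memLp_indicator_const 2 measurableSet_Ioc 1 (Or.inr (by simp))

lemma IsPreBrownianReal.memLp_two (hW : IsPreBrownianReal W P) (t : ℝ≥0) : MemLp (W t) 2 P :=
  (hW.isGaussianProcess.hasGaussianLaw_eval t).memLp_two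

/-- The pair of the indicator function of `(0, t]` and `W t`. -/
def wienerGenerator (hW : IsPreBrownianReal W P) (t : ℝ≥0) :
    Lp ℝ 2 (volume : Measure ℝ) × Lp ℝ 2 P :=
  ((memLp_indicator_Ioc t).toLp _, (IsPreBrownianReal.memLp_two hW t).toLp _)

/-- The graph of the Wiener integral, the closed span of the pairs `(1_{(0, t]}, W t)`. -/
def wienerGraph (hW : IsPreBrownianReal W P) :
    Submodule ℝ (Lp ℝ 2 (volume : Measure ℝ) × Lp ℝ 2 P) :=
  (Submodule.span ℝ (range (wienerGenerator hW))).topologicalClosure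

/-- `Y` is the Wiener integral over `(0, ∞)` of the square integrable function `f`. -/
def IsWiener (hW : IsPreBrownianReal W P) (f : ℝ → ℝ) (Y : Ω → ℝ) : Prop :=
  ∃ x ∈ wienerGraph hW, f =ᵐ[volume] x.1 ∧ Y =ᵐ[P] x.2

/-- Both sides are min(s, t): the length of an intersection of intervals, and the covariance of
Brownian motion. -/
lemma inner_wienerGenerator (hW : IsPreBrownianReal W P) (s t : ℝ≥0) :
    inner ℝ (wienerGenerator hW s).1 (wienerGenerator hW t).1 =
      inner ℝ (wienerGenerator hW s).2 (wienerGenerator hW t).2 := by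
  have : IsProbabilityMeasure P := hW.isGaussianProcess.isProbabilityMeasure
  rw [L2.inner_def, L2.inner_def]
  have h1 : ∫ u, inner ℝ ((wienerGenerator hW s).1 u) ((wienerGenerator hW t).1 u) =
      min (s : ℝ) t := by
    have : (fun u => inner ℝ ((wienerGenerator hW s).1 u) ((wienerGenerator hW t).1 u))
        =ᵐ[volume] (Ioc 0 (min (s : ℝ) t)).indicator fun _ => (1 : ℝ) := by
      filter_upwards [(memLp_indicator_Ioc s).coeFn_toLp, (memLp_indicator_Ioc t).coeFn_toLp]
        with u h1 h2
      simp only [wienerGenerator, h1, h2]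
      by_cases a : u ∈ Ioc 0 (s : ℝ) <;> by_cases b : u ∈ Ioc 0 (t : ℝ) <;>
        simp_all [indicator]
      grind
    rw [integral_congr_ae this, integral_indicator measurableSet_Ioc]
    simp
  have h2 : ∫ ω, inner ℝ ((wienerGenerator hW s).2 ω) ((wienerGenerator hW t).2 ω) ∂P =
      min (s : ℝ) t := by
    have : (fun ω => inner ℝ ((wienerGenerator hW s).2 ω) ((wienerGenerator hW t).2 ω))
        =ᵐ[P] (W s * W t) := by
      filter_upwards [(IsPreBrownianReal.memLp_two hW s).coeFn_toLp,
        (IsPreBrownianReal.memLp_two hW t).coeFn_toLp] with ω h1 h2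
      simp only [wienerGenerator, h1, h2]
      simp [mul_comm]
    rw [integral_congr_ae this]
    have hc := hW.covariance_eval s t
    rw [covariance_eq_sub (IsPreBrownianReal.memLp_two hW s) (IsPreBrownianReal.memLp_two hW t),
      hW.integral_eval, hW.integral_eval] at hc
    simpa using hc
  rw [h1, h2]

/-- Equality of inner products spreads from generators to the span by bilinearity, and equality of
norms is a closed condition. -/
lemma norm_fst_eq_norm_snd_of_mem_wienerGraph {hW : IsPreBrownianReal W P}
    {x : Lp ℝ 2 (volume : Measure ℝ) × Lp ℝ 2 P} (hx : x ∈ wienerGraph hW) : ‖x.1‖ = ‖x.2‖ := by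
  have key : ∀ x ∈ Submodule.span ℝ (range (wienerGenerator hW)),
      ∀ y ∈ Submodule.span ℝ (range (wienerGenerator hW)),
      inner ℝ x.1 y.1 = inner ℝ x.2 y.2 := by
    intro x hx y hy
    induction hx, hy using Submodule.span_induction₂ with
    | mem_mem x y hx hy =>
      obtain ⟨s, rfl⟩ := hx
      obtain ⟨t, rfl⟩ := hy
      exact inner_wienerGenerator hW s t
    | zero_left y hy => simp
    | zero_right x hx => simp
    | add_left x y z _ _ _ h1 h2 => simp [inner_add_left, h1, h2]
    | add_right x y z _ _ _ h1 h2 => simp [inner_add_right, h1, h2]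
    | smul_left r x y _ _ h => simp [inner_smul_left, h]
    | smul_right r x y _ _ h => simp [inner_smul_right, h]
  have hcl : IsClosed {x : Lp ℝ 2 (volume : Measure ℝ) × Lp ℝ 2 P | ‖x.1‖ = ‖x.2‖} :=
    isClosed_eq (by fun_prop) (by fun_prop)
  refine closure_minimal (fun x hx => ?_) hcl hx
  have := key x hx x hx
  rw [real_inner_self_eq_norm_sq, real_inner_self_eq_norm_sq] at this
  exact (sq_eq_sq₀ (norm_nonneg _) (norm_nonneg _)).1 this

section Law

/-- The function x ↦ e^{iux} is |u|-Lipschitz, and on a probability space the L¹ norm is at most the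
L² norm. -/
lemma continuous_integral_exp_Lp [IsProbabilityMeasure P] (u : ℝ) :
    Continuous fun Y : Lp ℝ 2 P => ∫ ω, Complex.exp (u * Y ω * Complex.I) ∂P := by
  have hint : ∀ Y : Lp ℝ 2 P, Integrable (fun ω => Complex.exp (u * Y ω * Complex.I)) P := by
    intro Y
    refine (integrable_const (1 : ℝ)).mono' ?_ (.of_forall fun ω => ?_)
    · have : AEStronglyMeasurable Y P := Lp.aestronglyMeasurable Y
      have h2 : Continuous fun y : ℝ => Complex.exp (u * y * Complex.I) := by fun_prop
      exact h2.comp_aestronglyMeasurable this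
    · rw [← Complex.ofReal_mul, Complex.norm_exp_ofReal_mul_I]
  refine (LipschitzWith.of_dist_le_mul (K := ‖u‖₊) fun Y Z => ?_).continuous
  rw [dist_eq_norm, ← integral_sub (hint Y) (hint Z)]
  have hYZ : MemLp (Y - Z : Lp ℝ 2 P) 1 P := (Lp.memLp (Y - Z)).mono_exponent (by norm_num)
  have h1 : Integrable (fun ω => ‖(Y - Z : Lp ℝ 2 P) ω‖) P := (memLp_one_iff_integrable.1 hYZ).norm
  calc ‖∫ ω, (Complex.exp (u * Y ω * Complex.I) - Complex.exp (u * Z ω * Complex.I)) ∂P‖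
      ≤ ∫ ω, |u| * ‖(Y - Z : Lp ℝ 2 P) ω‖ ∂P := by
        refine norm_integral_le_of_norm_le (h1.const_mul _) ?_
        filter_upwards [Lp.coeFn_sub Y Z] with ω hω
        have e : Complex.exp (u * Y ω * Complex.I) - Complex.exp (u * Z ω * Complex.I) =
            Complex.exp ((u * Z ω : ℝ) * Complex.I) *
              (Complex.exp (Complex.I * ((u * (Y ω - Z ω) : ℝ) : ℂ)) - 1) := by
          rw [mul_sub, ← Complex.exp_add, mul_one]
          congr 1
          · congr 1; push_cast; ring
          · congr 1; push_cast; ring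
        rw [e, norm_mul, Complex.norm_exp_ofReal_mul_I, one_mul, hω]
        refine Real.norm_exp_I_mul_ofReal_sub_one_le.trans ?_
        simp
    _ = |u| * (eLpNorm (Y - Z : Lp ℝ 2 P) 1 P).toReal := by
        rw [integral_const_mul, eLpNorm_one_eq_lintegral_enorm,
          integral_norm_eq_lintegral_enorm hYZ.1]
    _ ≤ ‖u‖₊ * dist Y Z := by
        rw [dist_eq_norm, Lp.norm_def, coe_nnnorm, Real.norm_eq_abs]
        gcongr
        · exact Lp.eLpNorm_ne_top _
        · exact eLpNorm_le_eLpNorm_of_exponent_le (by norm_num) (Lp.aestronglyMeasurable _)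

lemma integral_sq_Lp_eq_norm_sq {α : Type*} {mα : MeasurableSpace α} {μ : Measure α}
    (x : Lp ℝ 2 μ) : ∫ a, x a ^ 2 ∂μ = ‖x‖ ^ 2 := by
  rw [← real_inner_self_eq_norm_sq, L2.inner_def]
  simp [sq]

/-- A finite linear combination of values of W is Gaussian and centered, so its L² norm determines
the law. -/
lemma map_snd_of_mem_span {hW : IsPreBrownianReal W P}
    {x : Lp ℝ 2 (volume : Measure ℝ) × Lp ℝ 2 P}
    (hx : x ∈ Submodule.span ℝ (range (wienerGenerator hW))) :
    P.map x.2 = gaussianReal 0 (‖x.2‖ ^ 2).toNNReal := by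
  have : IsProbabilityMeasure P := hW.isGaussianProcess.isProbabilityMeasure
  obtain ⟨c, rfl⟩ := Finsupp.mem_span_range_iff_exists_finsupp.1 hx
  set x := c.sum fun i a => a • wienerGenerator hW i with hxdef
  have hx2 : x.2 =ᵐ[P] ∑ t ∈ c.support, (fun ω => c t • W t ω) := by
    have h1 : x.2 = ∑ t ∈ c.support, c t • (wienerGenerator hW t).2 := by
      simp [hxdef, Finsupp.sum, Prod.snd_sum]
    rw [h1]
    refine (Lp.coeFn_finsetSum _ _).trans ?_
    refine (eventuallyEq_sum fun t _ => ?_)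
    filter_upwards [Lp.coeFn_smul (c t) (wienerGenerator hW t).2,
      (IsPreBrownianReal.memLp_two hW t).coeFn_toLp] with ω h1 h2
    rw [h1, Pi.smul_apply, wienerGenerator, h2]
  have hG : HasGaussianLaw x.2 P :=
    ((hW.isGaussianProcess.smul c).hasGaussianLaw_sum (I := c.support)).congr hx2.symm
  have hmean : P[x.2] = 0 := by
    rw [integral_congr_ae hx2]
    simp only [Finset.sum_apply]
    rw [integral_finsetSum (f := fun t ω => c t • W t ω) _
      fun t _ => (hW.integrable_eval t).smul (c t)]
    refine Finset.sum_eq_zero fun t _ => ?_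
    rw [integral_smul, hW.integral_eval, smul_zero]
  rw [hG.map_eq_gaussianReal, hmean, variance_of_integral_eq_zero hG.aemeasurable hmean,
    integral_sq_Lp_eq_norm_sq]

/-- Having the characteristic function of a centered Gaussian with matching norm is a closed
condition in L², so it passes from the span to its closure. -/
lemma map_snd_of_mem_wienerGraph {hW : IsPreBrownianReal W P}
    {x : Lp ℝ 2 (volume : Measure ℝ) × Lp ℝ 2 P} (hx : x ∈ wienerGraph hW) :
    P.map x.2 = gaussianReal 0 (‖x.2‖ ^ 2).toNNReal := by
  have : IsProbabilityMeasure P := hW.isGaussianProcess.isProbabilityMeasure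
  have hm : ∀ Y : Lp ℝ 2 P, AEMeasurable Y P := fun Y => (Lp.aestronglyMeasurable Y).aemeasurable
  have hprob : ∀ Y : Lp ℝ 2 P, IsProbabilityMeasure (P.map Y) := fun Y =>
    Measure.isProbabilityMeasure_map (hm Y)
  have hchar : ∀ (Y : Lp ℝ 2 P) (u : ℝ),
      charFun (P.map Y) u = ∫ ω, Complex.exp (u * Y ω * Complex.I) ∂P := fun Y u => by
    rw [charFun_apply_real, integral_map (hm Y) (by fun_prop)]
  have hg : ∀ (Y : Lp ℝ 2 P) (u : ℝ), charFun (gaussianReal 0 (‖Y‖ ^ 2).toNNReal) u =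
      Complex.exp (-((‖Y‖ ^ 2 : ℝ) * u ^ 2 / 2)) := fun Y u => by
    rw [charFun_gaussianReal]
    simp
  refine Measure.ext_of_charFun (funext fun u => ?_)
  have hcl : IsClosed {x : Lp ℝ 2 (volume : Measure ℝ) × Lp ℝ 2 P |
      ∫ ω, Complex.exp (u * x.2 ω * Complex.I) ∂P =
        Complex.exp (-((‖x.2‖ ^ 2 : ℝ) * u ^ 2 / 2))} := by
    refine isClosed_eq ((continuous_integral_exp_Lp u).comp continuous_snd) ?_
    fun_prop
  rw [hchar, hg]
  refine closure_minimal (fun y hy => ?_) hcl hx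
  rw [mem_ofPred_eq, ← hchar, ← hg, map_snd_of_mem_span hy]

end Law

namespace IsWiener

variable {hW : IsPreBrownianReal W P} {f g : ℝ → ℝ} {Y Z : Ω → ℝ}

lemma memLp_right (h : IsWiener hW f Y) : MemLp Y 2 P := by
  obtain ⟨x, -, -, h2⟩ := h
  exact (memLp_congr_ae h2).2 (Lp.memLp x.2)

lemma congr (h : IsWiener hW f Y) (hf : g =ᵐ[volume] f) (hY : Z =ᵐ[P] Y) : IsWiener hW g Z := by
  obtain ⟨x, hx, h1, h2⟩ := h
  exact ⟨x, hx, hf.trans h1, hY.trans h2⟩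

lemma indicator_Ioc (hW : IsPreBrownianReal W P) (t : ℝ≥0) :
    IsWiener hW ((Ioc 0 (t : ℝ)).indicator fun _ => 1) (W t) :=
  ⟨wienerGenerator hW t, Submodule.le_topologicalClosure _ (Submodule.subset_span ⟨t, rfl⟩),
    (memLp_indicator_Ioc t).coeFn_toLp.symm,
    (IsPreBrownianReal.memLp_two hW t).coeFn_toLp.symm⟩

lemma zero (hW : IsPreBrownianReal W P) : IsWiener hW (fun _ => 0) (fun _ => 0) :=
  ⟨0, zero_mem _, (Lp.coeFn_zero ℝ 2 volume).symm, (Lp.coeFn_zero ℝ 2 P).symm⟩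

lemma add (h : IsWiener hW f Y) (h' : IsWiener hW g Z) :
    IsWiener hW (fun s => f s + g s) (fun ω => Y ω + Z ω) := by
  obtain ⟨x, hx, h1, h2⟩ := h
  obtain ⟨y, hy, h1', h2'⟩ := h'
  exact ⟨x + y, add_mem hx hy, (h1.add h1').trans (Lp.coeFn_add x.1 y.1).symm,
    (h2.add h2').trans (Lp.coeFn_add x.2 y.2).symm⟩

lemma const_mul (c : ℝ) (h : IsWiener hW f Y) :
    IsWiener hW (fun s => c * f s) (fun ω => c * Y ω) := by
  obtain ⟨x, hx, h1, h2⟩ := h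
  exact ⟨c • x, Submodule.smul_mem _ c hx, (h1.const_smul c).trans (Lp.coeFn_smul c x.1).symm,
    (h2.const_smul c).trans (Lp.coeFn_smul c x.2).symm⟩

lemma sub (h : IsWiener hW f Y) (h' : IsWiener hW g Z) :
    IsWiener hW (fun s => f s - g s) (fun ω => Y ω - Z ω) := by
  simpa [sub_eq_add_neg] using h.add (h'.const_mul (-1))

lemma sum {ι : Type*} (I : Finset ι) {f : ι → ℝ → ℝ} {Y : ι → Ω → ℝ}
    (h : ∀ i ∈ I, IsWiener hW (f i) (Y i)) :
    IsWiener hW (fun s => ∑ i ∈ I, f i s) (fun ω => ∑ i ∈ I, Y i ω) := by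
  classical
  induction I using Finset.induction_on with
  | empty => simpa using zero hW
  | insert i I hi ih =>
    simp only [Finset.sum_insert hi]
    exact (h i (Finset.mem_insert_self i I)).add
      (ih fun j hj => h j (Finset.mem_insert_of_mem hj))

/-- The Itô isometry. -/
lemma eLpNorm_eq (h : IsWiener hW f Y) : eLpNorm f 2 volume = eLpNorm Y 2 P := by
  obtain ⟨x, hx, h1, h2⟩ := h
  rw [eLpNorm_congr_ae h1, eLpNorm_congr_ae h2, ← Lp.enorm_def, ← Lp.enorm_def,
    ← ofReal_norm, ← ofReal_norm, norm_fst_eq_norm_snd_of_mem_wienerGraph hx]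

/-- A Wiener integral is centered Gaussian, with variance the squared norm of the integrand. -/
lemma hasLaw (h : IsWiener hW f Y) :
    HasLaw Y (gaussianReal 0 (∫ s, f s ^ 2).toNNReal) P := by
  refine ⟨h.memLp_right.1.aemeasurable, ?_⟩
  obtain ⟨x, hx, h1, h2⟩ := h
  have h3 : ∫ s, f s ^ 2 = ∫ s, x.1 s ^ 2 := integral_congr_ae (by
    filter_upwards [h1] with s hs; rw [hs])
  rw [Measure.map_congr h2, map_snd_of_mem_wienerGraph hx, h3, integral_sq_Lp_eq_norm_sq,
    norm_fst_eq_norm_snd_of_mem_wienerGraph hx]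

lemma of_tendsto {f : ℕ → ℝ → ℝ} {Y : ℕ → Ω → ℝ} {f' : ℝ → ℝ} {Y' : Ω → ℝ}
    (h : ∀ n, IsWiener hW (f n) (Y n)) (hf' : MemLp f' 2 volume) (hY' : MemLp Y' 2 P)
    (hf : Tendsto (fun n => eLpNorm (fun s => f n s - f' s) 2 volume) atTop (𝓝 0))
    (hY : Tendsto (fun n => eLpNorm (fun ω => Y n ω - Y' ω) 2 P) atTop (𝓝 0)) :
    IsWiener hW f' Y' := by
  choose x hx h1 h2 using h
  refine ⟨(hf'.toLp f', hY'.toLp Y'), ?_, hf'.coeFn_toLp.symm, hY'.coeFn_toLp.symm⟩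
  refine (Submodule.isClosed_topologicalClosure _).mem_of_tendsto (f := x) (b := atTop) ?_
    (.of_forall hx)
  refine Tendsto.prodMk_nhds ?_ ?_
  · refine (Lp.tendsto_Lp_iff_tendsto_eLpNorm (fun n => (x n).1) f' hf').2 (hf.congr fun n => ?_)
    refine eLpNorm_congr_ae ?_
    filter_upwards [h1 n] with s hs; simp [hs]
  · refine (Lp.tendsto_Lp_iff_tendsto_eLpNorm (fun n => (x n).2) Y' hY').2 (hY.congr fun n => ?_)
    refine eLpNorm_congr_ae ?_
    filter_upwards [h2 n] with s hs; simp [hs]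

/-- By the isometry, convergent integrands have integrals forming a Cauchy sequence in L²(P). -/
lemma exists_of_tendsto {f : ℕ → ℝ → ℝ} {Y : ℕ → Ω → ℝ} {f' : ℝ → ℝ}
    (h : ∀ n, IsWiener hW (f n) (Y n)) (hf' : MemLp f' 2 volume)
    (hf : Tendsto (fun n => eLpNorm (fun s => f n s - f' s) 2 volume) atTop (𝓝 0)) :
    ∃ Y', IsWiener hW f' Y' ∧
      Tendsto (fun n => eLpNorm (fun ω => Y n ω - Y' ω) 2 P) atTop (𝓝 0) := by
  choose x hx h1 h2 using h
  have hx1 : Tendsto (fun n => (x n).1) atTop (𝓝 (hf'.toLp f')) := by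
    refine (Lp.tendsto_Lp_iff_tendsto_eLpNorm (fun n => (x n).1) f' hf').2 (hf.congr fun n => ?_)
    refine eLpNorm_congr_ae ?_
    filter_upwards [h1 n] with s hs; simp [hs]
  have hdist : ∀ n m, dist (x n).2 (x m).2 = dist (x n).1 (x m).1 := fun n m => by
    rw [dist_eq_norm, dist_eq_norm]
    exact (norm_fst_eq_norm_snd_of_mem_wienerGraph (sub_mem (hx n) (hx m))).symm
  have hc : CauchySeq fun n => (x n).2 := by
    rw [Metric.cauchySeq_iff]
    simp only [hdist]
    exact Metric.cauchySeq_iff.1 hx1.cauchySeq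
  obtain ⟨y, hy⟩ := cauchySeq_tendsto_of_complete hc
  have hY : Tendsto (fun n => eLpNorm (fun ω => Y n ω - y ω) 2 P) atTop (𝓝 0) := by
    refine ((Lp.tendsto_Lp_iff_tendsto_eLpNorm' (fun n => (x n).2) y).1 hy).congr fun n => ?_
    refine eLpNorm_congr_ae ?_
    filter_upwards [h2 n] with s hs; simp [hs]
  exact ⟨y, of_tendsto (fun n => ⟨x n, hx n, h1 n, h2 n⟩) hf' (Lp.memLp y) hf hY, hY⟩

/-- The L² limit exists by isometry, and a subsequence converges to it almost surely. A pathwise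
limit is thus identified without dominating the integrals in ω. -/
lemma of_tendsto_ae {f : ℕ → ℝ → ℝ} {Y : ℕ → Ω → ℝ} {f' : ℝ → ℝ} {Y' : Ω → ℝ}
    (h : ∀ n, IsWiener hW (f n) (Y n)) (hf' : MemLp f' 2 volume)
    (hf : Tendsto (fun n => eLpNorm (fun s => f n s - f' s) 2 volume) atTop (𝓝 0))
    (hY : ∀ᵐ ω ∂P, Tendsto (fun n => Y n ω) atTop (𝓝 (Y' ω))) : IsWiener hW f' Y' := by
  obtain ⟨Z, hZ, hlim⟩ := exists_of_tendsto h hf' hf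
  obtain ⟨φ, hφ, hae⟩ := (tendstoInMeasure_of_tendsto_eLpNorm (by norm_num)
    (fun n => (h n).memLp_right.1) hZ.memLp_right.1 hlim).exists_seq_tendsto_ae
  refine hZ.congr (ae_eq_refl _) ?_
  filter_upwards [hY, hae] with ω h1 h2
  exact tendsto_nhds_unique (h1.comp hφ.tendsto_atTop) h2

end IsWiener

end WienerIsometry

/-! ### Density of step functions -/

section StepApproximation

/-- Dominated convergence in `L²`. -/
lemma tendsto_eLpNorm_two_zero {α : Type*} {mα : MeasurableSpace α} {μ : Measure α}
    {f : ℕ → α → ℝ} {h : α → ℝ} (hf : ∀ n, AEStronglyMeasurable (f n) μ) (hh : MemLp h 2 μ)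
    (hle : ∀ n, ∀ᵐ a ∂μ, |f n a| ≤ h a)
    (hlim : ∀ᵐ a ∂μ, Tendsto (fun n => f n a) atTop (𝓝 0)) :
    Tendsto (fun n => eLpNorm (f n) 2 μ) atTop (𝓝 0) := by
  have h1 : Tendsto (fun n => ∫⁻ a, ‖f n a‖ₑ ^ (2 : ℝ) ∂μ) atTop (𝓝 (∫⁻ _, 0 ∂μ)) := by
    refine tendsto_lintegral_of_dominated_convergence' (fun a => ‖h a‖ₑ ^ (2 : ℝ))
      (fun n => (hf n).enorm.pow_const _) (fun n => ?_) ?_ ?_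
    · filter_upwards [hle n] with a ha
      refine ENNReal.rpow_le_rpow ?_ (by norm_num)
      rw [enorm_le_iff_norm_le]
      exact ha.trans (le_abs_self _)
    · have := hh.eLpNorm_lt_top
      rw [eLpNorm_lt_top_iff_lintegral_rpow_enorm_lt_top (by norm_num) (by norm_num)] at this
      simpa using this.ne
    · filter_upwards [hlim] with a ha
      have h2 : Tendsto (fun n => ‖f n a‖ₑ) atTop (𝓝 0) := by
        simpa using ha.enorm
      simpa using h2.ennrpow_const (2 : ℝ)
  rw [lintegral_zero] at h1
  have h2 := h1.ennrpow_const (1 / 2 : ℝ)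
  rw [ENNReal.zero_rpow_of_pos (by norm_num)] at h2
  refine h2.congr fun n => ?_
  rw [eLpNorm_eq_lintegral_rpow_enorm_toReal (by norm_num) (by norm_num)]
  simp

/-- Cells are now open on the left, so the ceiling replaces the floor. Capping the grid at t keeps
the partition inside [0, t] and changes nothing for points of (0, t]. -/
lemma mem_Ioc_grid_iff (n i : ℕ) {s t : ℝ} (hs : s ∈ Ioc 0 t) :
    s ∈ Ioc (min t (i / ((n : ℝ) + 1))) (min t ((i + 1 : ℕ) / ((n : ℝ) + 1))) ↔
      ⌈((n : ℝ) + 1) * s⌉₊ = i + 1 := by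
  have hn : (0 : ℝ) < n + 1 := by positivity
  have h1 : min t (i / ((n : ℝ) + 1)) < s ↔ i < ⌈((n : ℝ) + 1) * s⌉₊ := by
    rw [Nat.lt_ceil, min_lt_iff, div_lt_iff₀ hn, mul_comm s]
    exact or_iff_right hs.2.not_gt
  have h2 : s ≤ min t ((i + 1 : ℕ) / ((n : ℝ) + 1)) ↔ ⌈((n : ℝ) + 1) * s⌉₊ ≤ i + 1 := by
    rw [Nat.ceil_le, le_min_iff, le_div_iff₀ hn, mul_comm s]
    exact and_iff_right hs.2
  rw [mem_Ioc, h1, h2]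
  omega

lemma stepFun_grid (n : ℕ) (t : ℝ≥0) (g : ℝ → ℝ) {s : ℝ} (hs : s ∈ Ioc 0 (t : ℝ)) :
    stepFun ⌈((n : ℝ) + 1) * t⌉₊ (fun i => min t (i / ((n : ℝ≥0) + 1)))
      (fun i => g (i / ((n : ℝ) + 1))) s =
      g ((⌈((n : ℝ) + 1) * s⌉₊ - 1 : ℕ) / ((n : ℝ) + 1)) := by
  have hn : (0 : ℝ) < n + 1 := by positivity
  have hpos : 0 < ⌈((n : ℝ) + 1) * s⌉₊ := Nat.ceil_pos.2 (mul_pos hn hs.1)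
  simp only [stepFun]
  have hcoe : ∀ i : ℕ, ((min t ((i : ℝ≥0) / ((n : ℝ≥0) + 1)) : ℝ≥0) : ℝ) =
      min (t : ℝ) (i / ((n : ℝ) + 1)) := fun i => by push_cast; rfl
  simp only [hcoe]
  rw [Finset.sum_eq_single (⌈((n : ℝ) + 1) * s⌉₊ - 1)]
  · rw [indicator_of_mem]
    rw [mem_Ioc_grid_iff n _ hs]
    omega
  · intro i _ hi
    rw [indicator_of_notMem]
    rw [mem_Ioc_grid_iff n _ hs]
    omega
  · intro hnot
    refine absurd (Finset.mem_range.2 ?_) hnot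
    have : ⌈((n : ℝ) + 1) * s⌉₊ ≤ ⌈((n : ℝ) + 1) * t⌉₊ := Nat.ceil_le_ceil (by gcongr; exact hs.2)
    omega

lemma measurable_stepFun (n : ℕ) (τ : ℕ → ℝ≥0) (c : ℕ → ℝ) : Measurable (stepFun n τ c) := by
  unfold stepFun
  exact Finset.measurable_fun_sum _ fun i _ => measurable_const.indicator measurableSet_Ioc

/-- Step functions are dense in `L²(0, t)`. -/
lemma exists_stepFun_eLpNorm_lt {γ : ℝ → ℝ} {t : ℝ≥0}
    (hγ : MemLp γ 2 (volume.restrict (Ioc 0 (t : ℝ)))) {ε : ℝ≥0∞} (hε : 0 < ε) :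
    ∃ (n : ℕ) (τ : ℕ → ℝ≥0) (c : ℕ → ℝ), Monotone τ ∧ τ n ≤ t ∧
      eLpNorm (fun s => γ s - stepFun n τ c s) 2 (volume.restrict (Ioc 0 (t : ℝ))) < ε := by
  set μ := volume.restrict (Ioc 0 (t : ℝ)) with hμ
  have hε2 : ε / 2 ≠ 0 := (ENNReal.half_pos hε.ne').ne'
  have hε0 : min (ε / 2) 1 ≠ 0 := by simp [hε2]
  -- Half of ε is spent on a continuous, compactly supported approximation, which is bounded; the
  -- other half on sampling it at grid points.
  obtain ⟨g, hgc, hg, hgcont, hgL⟩ := hγ.exists_hasCompactSupport_eLpNorm_sub_le (by norm_num) hε0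
  obtain ⟨C, hC⟩ := hgcont.bounded_above_of_compact_support hgc
  have hlim : Tendsto (fun n : ℕ => eLpNorm (fun s => g s -
      stepFun ⌈((n : ℝ) + 1) * t⌉₊ (fun i => min t (i / ((n : ℝ≥0) + 1)))
        (fun i => g (i / ((n : ℝ) + 1))) s) 2 μ) atTop (𝓝 0) := by
    refine tendsto_eLpNorm_two_zero (h := fun _ => C + C)
      (fun n => hgcont.aestronglyMeasurable.sub (measurable_stepFun _ _ _).aestronglyMeasurable)
      (memLp_const _) (fun n => ?_) ?_
    · filter_upwards [ae_restrict_mem measurableSet_Ioc] with s hs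
      rw [stepFun_grid n t g hs]
      exact (abs_sub _ _).trans (add_le_add (hC _) (hC _))
    · filter_upwards [ae_restrict_mem measurableSet_Ioc] with s hs
      have h1 : Tendsto (fun n : ℕ => ((⌈((n : ℝ) + 1) * s⌉₊ - 1 : ℕ) : ℝ) / ((n : ℝ) + 1)) atTop
          (𝓝 s) := by
        have h2 : Tendsto (fun n : ℕ => s - 1 / ((n : ℝ) + 1)) atTop (𝓝 s) := by
          simpa using (tendsto_const_nhds (x := s)).sub tendsto_one_div_add_atTop_nhds_zero_nat
        refine tendsto_of_tendsto_of_tendsto_of_le_of_le h2 tendsto_const_nhds (fun n => ?_)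
          (fun n => ?_)
        all_goals
          have hn : (0 : ℝ) < n + 1 := by positivity
          have hpos : 0 < ⌈((n : ℝ) + 1) * s⌉₊ := Nat.ceil_pos.2 (mul_pos hn hs.1)
          simp only [Nat.cast_sub (Nat.succ_le_of_lt hpos), Nat.cast_one, Nat.succ_eq_add_one,
            zero_add]
        · rw [le_div_iff₀ hn, sub_mul, one_div, inv_mul_cancel₀ hn.ne', mul_comm]
          linarith [Nat.le_ceil (((n : ℝ) + 1) * s)]
        · rw [div_le_iff₀ hn, mul_comm s]
          linarith [Nat.ceil_lt_add_one (mul_pos hn hs.1).le]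
      have h3 := (hgcont.tendsto s).comp h1
      have h4 := (tendsto_const_nhds (x := g s)).sub h3
      rw [sub_self] at h4
      refine h4.congr fun n => ?_
      rw [stepFun_grid n t g hs]
      rfl
  have hev := hlim.eventually_lt_const (ENNReal.half_pos hε.ne')
  -- The sum of the two halves gives a strict bound only for finite ε. For ε = ∞ the empty step
  -- function will do.
  by_cases hεtop : ε = ∞
  · refine ⟨0, fun _ => 0, fun _ => 0, fun _ _ _ => le_rfl, zero_le, ?_⟩
    rw [hεtop]
    simpa [stepFun] using hγ.eLpNorm_lt_top
  obtain ⟨n, hn⟩ := hev.exists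
  refine ⟨⌈((n : ℝ) + 1) * t⌉₊, fun i => min t (i / ((n : ℝ≥0) + 1)), fun i => g (i / ((n : ℝ) + 1)), ?_,
    min_le_left _ _, ?_⟩
  · intro i j hij
    dsimp only
    gcongr
  · have h5 : eLpNorm (γ - g) 2 μ ≤ ε / 2 := hg.trans (min_le_left _ _)
    have h6 := eLpNorm_add_le (p := 2) (hγ.1.sub hgL.1)
      (hgL.1.sub (measurable_stepFun ⌈((n : ℝ) + 1) * t⌉₊ (fun i => min t (i / ((n : ℝ≥0) + 1)))
        (fun i => g (i / ((n : ℝ) + 1)))).aestronglyMeasurable (μ := μ)) (by norm_num)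
    have h7 : (fun s => γ s - stepFun ⌈((n : ℝ) + 1) * t⌉₊ (fun i => min t (i / ((n : ℝ≥0) + 1)))
        (fun i => g (i / ((n : ℝ) + 1))) s) = (γ - g) + (g - stepFun ⌈((n : ℝ) + 1) * t⌉₊
        (fun i => min t (i / ((n : ℝ≥0) + 1))) (fun i => g (i / ((n : ℝ) + 1)))) := by
      funext s; simp
    rw [h7]
    refine h6.trans_lt ?_
    rw [← ENNReal.add_halves ε]
    exact ENNReal.add_lt_add_of_le_of_lt (ne_top_of_le_ne_top (ENNReal.div_ne_top hεtop two_ne_zero) h5) h5 hn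

end StepApproximation

/-! ### Step-function definition and integration by parts -/

section WienerIntegral

variable {Ω : Type*} {mΩ : MeasurableSpace Ω} {P : Measure Ω} {W : ℝ≥0 → Ω → ℝ}
  {hW : IsPreBrownianReal W P}

lemma IsWiener.stepFun (hW : IsPreBrownianReal W P) (n : ℕ) {τ : ℕ → ℝ≥0} (hτ : Monotone τ)
    (c : ℕ → ℝ) : IsWiener hW (stepFun n τ c) (stepIntegral W n τ c) := by
  refine IsWiener.sum (hW := hW) (Finset.range n)
    (f := fun i => (Ioc (τ i : ℝ) (τ (i + 1))).indicator fun _ => c i)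
    (Y := fun i ω => c i * (W (τ (i + 1)) ω - W (τ i) ω)) fun i _ => ?_
  refine (((IsWiener.indicator_Ioc hW (τ (i + 1))).sub (IsWiener.indicator_Ioc hW (τ i))).const_mul
    (c i)).congr (.of_forall fun s => ?_) (ae_eq_refl _)
  have h1 : (τ i : ℝ) ≤ τ (i + 1) := by exact_mod_cast hτ (Nat.le_succ i)
  have h0 : (0 : ℝ) ≤ τ i := (τ i).2
  simp only [indicator, mem_Ioc]
  split_ifs <;> first | (exfalso; grind) | simp

lemma stepFun_eq_zero {n : ℕ} {τ : ℕ → ℝ≥0} (hτ : Monotone τ) {t : ℝ≥0} (ht : τ n ≤ t)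
    (c : ℕ → ℝ) {s : ℝ} (hs : s ∉ Ioc 0 (t : ℝ)) : stepFun n τ c s = 0 := by
  refine Finset.sum_eq_zero fun i hi => indicator_of_notMem (fun hmem => hs ⟨?_, ?_⟩) _
  · exact lt_of_le_of_lt (τ i).2 hmem.1
  · refine hmem.2.trans ?_
    exact_mod_cast (hτ (Finset.mem_range.1 hi)).trans ht

lemma eLpNorm_indicator_sub_stepFun (γ : ℝ → ℝ) {n : ℕ} {τ : ℕ → ℝ≥0} (hτ : Monotone τ) {t : ℝ≥0}
    (ht : τ n ≤ t) (c : ℕ → ℝ) :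
    eLpNorm (fun s => (Ioc 0 (t : ℝ)).indicator γ s - stepFun n τ c s) 2 volume =
      eLpNorm (fun s => γ s - stepFun n τ c s) 2 (volume.restrict (Ioc 0 (t : ℝ))) := by
  rw [← eLpNorm_indicator_eq_eLpNorm_restrict measurableSet_Ioc]
  congr 1
  funext s
  by_cases hs : s ∈ Ioc 0 (t : ℝ)
  · simp [hs]
  · simp [hs, stepFun_eq_zero hτ ht c hs]

lemma memLp_indicator_Ioc_of_restrict {γ : ℝ → ℝ} {t : ℝ≥0}
    (hγ : MemLp γ 2 (volume.restrict (Ioc 0 (t : ℝ)))) :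
    MemLp ((Ioc 0 (t : ℝ)).indicator γ) 2 volume :=
  (memLp_indicator_iff_restrict measurableSet_Ioc).2 hγ

/-- For square integrable integrands the definition by step functions gives the extension of the
isometry. -/
lemma isWienerIntegral_iff {γ : ℝ → ℝ} {t : ℝ≥0} {Y : Ω → ℝ}
    (hγ : MemLp γ 2 (volume.restrict (Ioc 0 (t : ℝ)))) :
    IsWienerIntegral P W γ t Y ↔ IsWiener hW ((Ioc 0 (t : ℝ)).indicator γ) Y := by
  constructor
  · rintro ⟨hY, happ⟩
    have hpos : ∀ k : ℕ, (0 : ℝ≥0∞) < (k + 1 : ℝ≥0∞)⁻¹ := fun k => by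
      simp [ENNReal.inv_pos]
    choose n τ c hτ ht h1 h2 using fun k : ℕ => happ _ (hpos k)
    have hstep := fun k => IsWiener.stepFun hW (n k) (hτ k) (c k)
    have hlim : Tendsto (fun k : ℕ => (k + 1 : ℝ≥0∞)⁻¹) atTop (𝓝 0) := by
      have := (tendsto_add_atTop_iff_nat 1).2 ENNReal.tendsto_inv_nat_nhds_zero
      simpa using this
    -- Square integrability of `Y` is not part of the definition; it follows from the finite
    -- distance to one step integral.
    have hYL : MemLp Y 2 P := by
      have h3 : MemLp (fun ω => Y ω - stepIntegral W (n 0) (τ 0) (c 0) ω) 2 P :=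
        ⟨hY.sub (hstep 0).memLp_right.1, (h2 0).trans_le le_top⟩
      have h4 := h3.add (hstep 0).memLp_right
      rwa [show (fun ω => Y ω - stepIntegral W (n 0) (τ 0) (c 0) ω) +
        stepIntegral W (n 0) (τ 0) (c 0) = Y by funext ω; simp] at h4
    refine IsWiener.of_tendsto hstep (memLp_indicator_Ioc_of_restrict hγ) hYL ?_ ?_
    · refine tendsto_of_tendsto_of_tendsto_of_le_of_le tendsto_const_nhds hlim
        (fun _ => zero_le) (fun k => ?_)
      have := (h1 k).le
      rw [← eLpNorm_indicator_sub_stepFun γ (hτ k) (ht k)] at this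
      rwa [← eLpNorm_neg, show (-fun s => stepFun (n k) (τ k) (c k) s -
        (Ioc 0 (t : ℝ)).indicator γ s) = fun s => (Ioc 0 (t : ℝ)).indicator γ s -
        stepFun (n k) (τ k) (c k) s by funext s; simp]
    · refine tendsto_of_tendsto_of_tendsto_of_le_of_le tendsto_const_nhds hlim
        (fun _ => zero_le) (fun k => ?_)
      rw [← eLpNorm_neg, show (-fun ω => stepIntegral W (n k) (τ k) (c k) ω - Y ω) =
        fun ω => Y ω - stepIntegral W (n k) (τ k) (c k) ω by funext s; simp]
      exact (h2 k).le
  · intro h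
    refine ⟨h.memLp_right.1, fun ε hε => ?_⟩
    obtain ⟨n, τ, c, hτ, ht, hlt⟩ := exists_stepFun_eLpNorm_lt hγ hε
    refine ⟨n, τ, c, hτ, ht, hlt, ?_⟩
    -- By the isometry, approximating the integrand already approximates the integral.
    rw [← (h.sub (IsWiener.stepFun hW n hτ c)).eLpNorm_eq,
      eLpNorm_indicator_sub_stepFun γ hτ ht]
    exact hlt

/-- Integration by parts for Wiener integrals: if `Y s` is the Wiener integral of `g` over `(0, s]`
and has continuous paths, then `c Y t - ∫₀ᵗ k(s) Y s ds` is the Wiener integral of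
`g(u) (c - ∫ᵤᵗ k)` over `(0, t]`. -/
theorem IsWiener.integral_by_parts {g k : ℝ → ℝ} {t : ℝ≥0} {Y : ℝ≥0 → Ω → ℝ}
    (hg : MemLp g 2 (volume.restrict (Ioc 0 (t : ℝ))))
    (hk : IntervalIntegrable k volume 0 t)
    (hY : ∀ s ≤ t, IsWiener hW ((Ioc 0 (s : ℝ)).indicator g) (Y s))
    (hcont : ∀ᵐ ω ∂P, ContinuousOn (fun s : ℝ => Y s.toNNReal ω) (Icc 0 t)) (c : ℝ) :
    IsWiener hW ((Ioc 0 (t : ℝ)).indicator fun u => g u * (c - ∫ s in u..t, k s))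
      (fun ω => c * Y t ω - ∫ s in (0 : ℝ)..t, k s * Y s.toNNReal ω) := by
  have ht : (0 : ℝ) ≤ t := t.2
  have hkt : IntegrableOn k (Ioc 0 (t : ℝ)) := (intervalIntegrable_iff_integrableOn_Ioc_of_le ht).1 hk
  -- Replacing the time integral of k Y by a weighted sum over grid points replaces the tail
  -- integral of k over [u, t] by `φ n u`, since u ∈ (0, s] means s ∈ [u, ∞) for u > 0.
  set φ : ℕ → ℝ → ℝ := fun n u => ∑ i ∈ Finset.range (gridCard t n),
    gridWeight k t n i * (Ici u).indicator (fun _ => (1 : ℝ)) (i / ((n : ℝ) + 1)) with hφ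
  have hind : ∀ u x : ℝ, |(Ici u).indicator (fun _ => (1 : ℝ)) x| ≤ 1 := fun u x => by
    by_cases h : x ∈ Ici u <;> simp [h]
  have hφle : ∀ n u, |φ n u| ≤ ∫ s in Ioc 0 (t : ℝ), |k s| := fun n u =>
    abs_sum_gridWeight_le hkt (hind u) n
  have happrox : ∀ n, IsWiener hW ((Ioc 0 (t : ℝ)).indicator fun u => g u * (c - φ n u))
      (fun ω => c * Y t ω - ∑ i ∈ Finset.range (gridCard t n), gridWeight k t n i *
        Y ((i : ℝ) / ((n : ℝ) + 1)).toNNReal ω) := by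
    intro n
    refine (((hY t le_rfl).const_mul c).sub (IsWiener.sum (hW := hW)
      (Finset.range (gridCard t n)) (f := fun i u => gridWeight k t n i *
        (Ioc 0 (((i : ℝ) / ((n : ℝ) + 1)).toNNReal : ℝ)).indicator g u)
      (Y := fun i ω => gridWeight k t n i * Y ((i : ℝ) / ((n : ℝ) + 1)).toNNReal ω)
      fun i hi => (hY _ ?_).const_mul _)).congr (.of_forall fun u => ?_) (ae_eq_refl _)
    · rw [Real.toNNReal_le_iff_le_coe]
      exact gridPoint_le ht (Finset.mem_range.1 hi)
    · dsimp only
      by_cases hu : u ∈ Ioc 0 (t : ℝ)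
      · rw [indicator_of_mem hu, indicator_of_mem hu, mul_sub, hφ, Finset.mul_sum]
        congr 1
        · ring
        · refine Finset.sum_congr rfl fun i _ => ?_
          rw [Real.coe_toNNReal _ (by positivity)]
          by_cases hui : u ≤ (i : ℝ) / ((n : ℝ) + 1)
          · rw [indicator_of_mem (show _ ∈ Ici u from hui),
              indicator_of_mem (show u ∈ Ioc 0 _ from ⟨hu.1, hui⟩)]
            ring
          · rw [indicator_of_notMem (show _ ∉ Ici u from hui),
              indicator_of_notMem (show u ∉ Ioc 0 _ from fun h => hui h.2)]
            ring
      · rw [indicator_of_notMem hu, indicator_of_notMem hu, Finset.sum_eq_zero]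
        · ring
        · intro i hi
          rw [indicator_of_notMem, mul_zero]
          rw [Real.coe_toNNReal _ (by positivity)]
          exact fun h => hu ⟨h.1, h.2.trans (gridPoint_le ht (Finset.mem_range.1 hi))⟩
  have hKcont : ContinuousOn (fun u => ∫ s in u..t, k s) (Icc 0 t) := by
    have h1 := continuousOn_primitive_zero ht hk
    refine (continuousOn_const (c := ∫ s in (0 : ℝ)..t, k s).sub h1).congr fun u hu => ?_
    have h2 : IntervalIntegrable k volume 0 u :=
      hk.mono_set (by rw [uIcc_of_le hu.1, uIcc_of_le ht]; exact Icc_subset_Icc_right hu.2)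
    simp only [Pi.sub_apply]
    rw [eq_sub_iff_add_eq, add_comm]
    exact intervalIntegral.integral_add_adjacent_intervals h2 (h2.symm.trans hk)
  have hbound : ∀ u ∈ Ioc 0 (t : ℝ), |∫ s in u..t, k s| ≤ ∫ s in Ioc 0 (t : ℝ), |k s| :=
    fun u hu => le_of_tendsto (tendsto_sum_gridWeight_indicator_Ici hkt hu).abs
      (.of_forall fun n => hφle n u)
  set M := ∫ s in Ioc 0 (t : ℝ), |k s| with hM
  have hKmeas : AEStronglyMeasurable (fun u => ∫ s in u..t, k s)
      (volume.restrict (Ioc 0 (t : ℝ))) :=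
    (hKcont.mono Ioc_subset_Icc_self).aestronglyMeasurable measurableSet_Ioc
  have hlimit : MemLp (fun u => g u * (c - ∫ s in u..t, k s)) 2
      (volume.restrict (Ioc 0 (t : ℝ))) := by
    refine (hg.norm.const_mul (|c| + M)).of_le (hg.1.mul
      (aestronglyMeasurable_const.sub hKmeas)) ?_
    filter_upwards [ae_restrict_mem measurableSet_Ioc] with u hu
    have hM0 : 0 ≤ M := (abs_nonneg _).trans (hbound u hu)
    rw [norm_mul, norm_mul, norm_norm, Real.norm_eq_abs (|c| + M),
      abs_of_nonneg (by positivity : 0 ≤ |c| + M), mul_comm]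
    gcongr
    exact (abs_sub _ _).trans (add_le_add le_rfl (hbound u hu))
  -- Two limits remain: the integrands converge in L², dominated by 2 M |g|, and the sums converge
  -- for each continuous path.
  refine IsWiener.of_tendsto_ae happrox (memLp_indicator_Ioc_of_restrict hlimit) ?_ ?_
  · have h1 : ∀ n, (fun u => (Ioc 0 (t : ℝ)).indicator (fun u => g u * (c - φ n u)) u -
        (Ioc 0 (t : ℝ)).indicator (fun u => g u * (c - ∫ s in u..t, k s)) u) =
        (Ioc 0 (t : ℝ)).indicator fun u => g u * ((∫ s in u..t, k s) - φ n u) := fun n => by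
      funext u
      by_cases hu : u ∈ Ioc 0 (t : ℝ)
      · simp only [indicator_of_mem hu]; ring
      · simp only [indicator_of_notMem hu, sub_zero]
    simp only [h1, eLpNorm_indicator_eq_eLpNorm_restrict measurableSet_Ioc]
    have hφmeas : ∀ n, Measurable (φ n) := fun n => by
      refine Finset.measurable_fun_sum _ fun i _ => Measurable.const_mul ?_ _
      have : (fun u => (Ici u).indicator (fun _ => (1 : ℝ)) ((i : ℝ) / ((n : ℝ) + 1))) =
          (Iic ((i : ℝ) / ((n : ℝ) + 1))).indicator fun _ => 1 := by
        funext u; simp [indicator]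
      rw [this]
      exact measurable_const.indicator measurableSet_Iic
    refine tendsto_eLpNorm_two_zero (h := fun u => (M + M) * ‖g u‖) (fun n => hg.1.mul
      (hKmeas.sub (hφmeas n).aestronglyMeasurable)) (hg.norm.const_mul _) (fun n => ?_) ?_
    · filter_upwards [ae_restrict_mem measurableSet_Ioc] with u hu
      rw [abs_mul, mul_comm, Real.norm_eq_abs]
      gcongr
      exact (abs_sub _ _).trans (add_le_add (hbound u hu) (hφle n u))
    · filter_upwards [ae_restrict_mem measurableSet_Ioc] with u hu
      have h2 := tendsto_sum_gridWeight_indicator_Ici hkt hu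
      have h3 := ((tendsto_const_nhds (x := ∫ s in u..t, k s)).sub h2).const_mul (g u)
      simpa using h3
  · filter_upwards [hcont] with ω hω
    have := tendsto_sum_gridWeight_of_continuousOn hkt hω
    rw [← intervalIntegral.integral_of_le ht] at this
    exact (tendsto_const_nhds (x := c * Y t ω)).sub this

end WienerIntegral

/-! ### Exponentials of primitives -/

section ExponentialPrimitives

lemma intervalIntegrable_of_mem_Icc {f : ℝ → ℝ} {s t : ℝ}
    (hf : IntervalIntegrable f volume 0 t) (hs : s ∈ Icc 0 t) :
    IntervalIntegrable f volume 0 s :=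
  hf.mono_set (by
    rw [uIcc_of_le hs.1, uIcc_of_le (hs.1.trans hs.2)]; exact Icc_subset_Icc_right hs.2)

lemma integral_eq_primitive_sub {f : ℝ → ℝ} {s t : ℝ}
    (hf : IntervalIntegrable f volume 0 t) (hs : s ∈ Icc 0 t) :
    ∫ r in s..t, f r = (∫ r in (0 : ℝ)..t, f r) - ∫ r in (0 : ℝ)..s, f r :=
  (intervalIntegral.integral_interval_sub_left hf (intervalIntegrable_of_mem_Icc hf hs)).symm

/-- This is the fundamental theorem for e^{∫β} with β only integrable. It evaluates the kernel c −
∫ᵤᵗ k of the integration by parts. -/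
lemma exp_primitive_sub_integral {β : ℝ → ℝ} {s t : ℝ}
    (hβ : IntervalIntegrable β volume 0 t) (hs : s ∈ Icc 0 t) :
    Real.exp (∫ r in (0 : ℝ)..t, β r) -
      ∫ u in s..t, β u * Real.exp (∫ r in (0 : ℝ)..u, β r) =
    Real.exp (∫ r in (0 : ℝ)..s, β r) := by
  have ht : 0 ≤ t := hs.1.trans hs.2
  have key : ∀ u ∈ Icc 0 t, Real.exp (∫ r in (0 : ℝ)..u, β r) =
      1 + ∫ v in (0 : ℝ)..u, β v * Real.exp (∫ r in (0 : ℝ)..v, β r) := fun u hu => by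
    have := exp_integral_mul_primitive (h := fun _ => 0) 1 (intervalIntegrable_of_mem_Icc hβ hu)
      intervalIntegrable_const
    simpa [mul_comm] using this
  have hint := IntervalIntegrable.mul_continuousOn_Icc ht hβ (continuousOn_primitive_zero ht hβ).rexp
  rw [integral_eq_primitive_sub hint hs, key t ⟨ht, le_rfl⟩, key s hs]
  ring

lemma exp_neg_primitive_add_integral {β : ℝ → ℝ} {s t : ℝ}
    (hβ : IntervalIntegrable β volume 0 t) (hs : s ∈ Icc 0 t) :
    Real.exp (-∫ r in (0 : ℝ)..t, β r) -
      ∫ u in s..t, -(β u * Real.exp (-∫ r in (0 : ℝ)..u, β r)) =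
    Real.exp (-∫ r in (0 : ℝ)..s, β r) := by
  have := exp_primitive_sub_integral hβ.neg hs
  simpa using this

lemma exp_integral_eq {β : ℝ → ℝ} {s t : ℝ}
    (hβ : IntervalIntegrable β volume 0 t) (hs : s ∈ Icc 0 t) :
    Real.exp (∫ r in s..t, β r) =
      Real.exp (∫ r in (0 : ℝ)..t, β r) * Real.exp (-∫ r in (0 : ℝ)..s, β r) := by
  rw [integral_eq_primitive_sub hβ hs, ← Real.exp_add, sub_eq_add_neg]

lemma integral_mul_exp_integral {α β : ℝ → ℝ} {t : ℝ} (ht : 0 ≤ t)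
    (hβ : IntervalIntegrable β volume 0 t) :
    ∫ s in (0 : ℝ)..t, α s * Real.exp (∫ r in s..t, β r) =
      Real.exp (∫ r in (0 : ℝ)..t, β r) *
        ∫ s in (0 : ℝ)..t, α s * Real.exp (-∫ r in (0 : ℝ)..s, β r) := by
  rw [← intervalIntegral.integral_const_mul]
  refine intervalIntegral.integral_congr fun s hs => ?_
  rw [uIcc_of_le ht] at hs
  simp only [exp_integral_eq hβ hs]
  ring

lemma exp_mul_exp_neg_cancel (x : ℝ) : Real.exp x * Real.exp (-x) = 1 := by
  rw [← Real.exp_add, add_neg_cancel, Real.exp_zero]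

lemma memLp_mul_continuousOn {γ φ : ℝ → ℝ} {t : ℝ}
    (hγ : MemLp γ 2 (volume.restrict (Ioc 0 t))) (hφ : ContinuousOn φ (Icc 0 t)) :
    MemLp (fun s => γ s * φ s) 2 (volume.restrict (Ioc 0 t)) := by
  obtain ⟨C, hC⟩ := isCompact_Icc.exists_bound_of_continuousOn hφ
  refine (hγ.norm.const_mul C).of_le (hγ.1.mul ((hφ.mono Ioc_subset_Icc_self).aestronglyMeasurable
    measurableSet_Ioc)) ?_
  filter_upwards [ae_restrict_mem measurableSet_Ioc] with s hs
  have h := hC s (Ioc_subset_Icc_self hs)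
  have hC0 : 0 ≤ C := (norm_nonneg _).trans h
  rw [norm_mul, norm_mul, norm_norm, Real.norm_of_nonneg hC0, mul_comm]
  gcongr

end ExponentialPrimitives

/-! ### Linear equation and explicit formula -/

section Solutions

variable {Ω : Type*} {mΩ : MeasurableSpace Ω} {P : Measure Ω} {F : Filtration ℝ≥0 mΩ}
  {W : ℝ≥0 → Ω → ℝ} {S : ℝ≥0∞} {x₀ : ℝ} {α β γ : ℝ → ℝ} {X : ℝ≥0 → Ω → ℝ}

lemma IsContinuousAdapted.continuousOn_path (h : IsContinuousAdapted P F S X) {t : ℝ≥0}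
    (ht : (t : ℝ≥0∞) < S) :
    ∀ᵐ ω ∂P, ContinuousOn (fun s : ℝ => X s.toNNReal ω) (Icc 0 (t : ℝ)) := by
  filter_upwards [h.continuous] with ω hω
  refine hω.comp continuous_real_toNNReal.continuousOn fun s hs => ?_
  refine lt_of_le_of_lt ?_ ht
  rw [ENNReal.coe_le_coe]
  exact Real.toNNReal_le_iff_le_coe.2 hs.2

lemma continuousOn_of_forall_Icc {f : ℝ≥0 → ℝ}
    (h : ∀ t : ℝ≥0, (t : ℝ≥0∞) < S → ContinuousOn (fun s : ℝ => f s.toNNReal) (Icc 0 (t : ℝ))) :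
    ContinuousOn f {t : ℝ≥0 | (t : ℝ≥0∞) < S} := by
  intro t ht
  obtain ⟨u, htu, hu⟩ := ENNReal.lt_iff_exists_nnreal_btwn.1 (show (t : ℝ≥0∞) < S from ht)
  rw [ENNReal.coe_lt_coe] at htu
  have h1 : ContinuousOn f (Iic u) := by
    have := (h u hu).comp (f := fun s : ℝ≥0 => (s : ℝ)) (s := Iic u)
      NNReal.continuous_coe.continuousOn (fun s hs => ⟨s.2, hs⟩)
    simpa [Function.comp_def] using this
  exact (h1.continuousAt (Iic_mem_nhds htu)).continuousWithinAt

/-- The integrand of the explicit formula is square integrable. -/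
lemma memLp_mul_exp_integral {t : ℝ} (ht : 0 ≤ t) (hβ : IntervalIntegrable β volume 0 t)
    (hγ : MemLp γ 2 (volume.restrict (Ioc 0 t))) :
    MemLp (fun s => γ s * Real.exp (∫ r in s..t, β r)) 2 (volume.restrict (Ioc 0 t)) := by
  refine memLp_mul_continuousOn hγ ?_
  refine (continuousOn_const.mul (continuousOn_primitive_zero ht hβ).neg.rexp).congr
    fun s hs => exp_integral_eq hβ hs

/-- Write B for the primitive of β and Y for the noise part ∫ γ dW. Integration by parts with c =
e^{−B_t} and k = −β e^{−B} turns e^{−B_t} Y_t + ∫ β e^{−B} Y ds into ∫ γ e^{−B} dW. Pathwise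
variation of constants identifies the former as e^{−B_t} X_t − x₀ − ∫ α e^{−B} ds. -/
theorem IsLinearSDESolution.isExplicitSolution (hW : IsPreBrownianReal W P)
    (h : IsLinearSDESolution P F W S x₀ α β γ X) : IsExplicitSolution P F W S x₀ α β γ X := by
  refine ⟨h.toIsContinuousAdapted, fun t ht => ?_⟩
  have ht0 : (0 : ℝ) ≤ t := t.2
  have hα := h.integrable_α t ht
  have hβ := h.integrable_β t ht
  have hγ := h.sq_integrable_γ t ht
  -- The equation supplies an unrelated version of the integral for each time. Solving it for the
  -- noise gives versions with continuous paths, as integration by parts requires.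
  set Y : ℝ≥0 → Ω → ℝ := fun s ω =>
    X s ω - x₀ - ∫ r in (0 : ℝ)..s, (α r + β r * X r.toNNReal ω) with hY
  have hYW : ∀ s ≤ t, IsWiener hW ((Ioc 0 (s : ℝ)).indicator γ) (Y s) := fun s hs => by
    have hsS : (s : ℝ≥0∞) < S := lt_of_le_of_lt (ENNReal.coe_le_coe.2 hs) ht
    obtain ⟨J, hJ, hXJ⟩ := h.equation s hsS
    refine ((isWienerIntegral_iff (h.sq_integrable_γ s hsS)).1 hJ).congr (ae_eq_refl _) ?_
    filter_upwards [hXJ] with ω hω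
    simp only [hY, hω]
    ring
  have hpath := h.continuousOn_path ht
  have hvar := hpath.mono fun ω hω => variation_of_constants x₀ ht0 hα hβ hω
    (y := fun s => Y s.toNNReal ω) fun s hs => by simp [hY, Real.coe_toNNReal s hs.1]
  have hE : ContinuousOn (fun s => Real.exp (-∫ r in (0 : ℝ)..s, β r)) (Icc 0 (t : ℝ)) :=
    (continuousOn_primitive_zero ht0 hβ).neg.rexp
  have key := IsWiener.integral_by_parts hγ (k := fun s => -(β s * Real.exp (-∫ r in (0 : ℝ)..s, β r)))
    (IntervalIntegrable.mul_continuousOn_Icc ht0 hβ hE).neg hYW (hvar.mono fun _ h => h.1)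
    (Real.exp (-∫ r in (0 : ℝ)..t, β r))
  refine ⟨_, (isWienerIntegral_iff (hW := hW) (memLp_mul_exp_integral ht0 hβ hγ)).2
    ((key.const_mul (Real.exp (∫ r in (0 : ℝ)..t, β r))).congr (.of_forall fun s => ?_)
      (ae_eq_refl _)), ?_⟩
  · by_cases hs : s ∈ Ioc 0 (t : ℝ)
    · have hs' := Ioc_subset_Icc_self hs
      simp only [indicator_of_mem hs, exp_neg_primitive_add_integral hβ hs', exp_integral_eq hβ hs']
      ring
    · simp only [indicator_of_notMem hs, mul_zero]
  · filter_upwards [hvar] with ω hω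
    have h1 := hω.2
    simp only [Real.toNNReal_coe] at h1
    rw [integral_mul_exp_integral ht0 hβ]
    have h2 := exp_mul_exp_neg_cancel (∫ r in (0 : ℝ)..t, β r)
    simp only [neg_mul, intervalIntegral.integral_neg]
    linear_combination (-(X t ω)) * h2 + Real.exp (∫ r in (0 : ℝ)..t, β r) * h1

/-- The same argument in reverse: Z is a continuous version of ∫ γ e^{−B} dW, with B the primitive
of β. The choice c = e^{B_t}, k = β e^{B} makes the kernel e^{B_u}, which cancels the discount
factor. -/
theorem IsExplicitSolution.isLinearSDESolution (hW : IsPreBrownianReal W P)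
    (hα : ∀ t : ℝ≥0, (t : ℝ≥0∞) < S → IntervalIntegrable α volume 0 t)
    (hβ : ∀ t : ℝ≥0, (t : ℝ≥0∞) < S → IntervalIntegrable β volume 0 t)
    (hγ : ∀ t : ℝ≥0, (t : ℝ≥0∞) < S → MemLp γ 2 (volume.restrict (Ioc 0 (t : ℝ))))
    (h : IsExplicitSolution P F W S x₀ α β γ X) : IsLinearSDESolution P F W S x₀ α β γ X := by
  refine ⟨h.toIsContinuousAdapted, hα, hβ, hγ, fun t ht => ?_⟩
  have ht0 : (0 : ℝ) ≤ t := t.2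
  have hαt := hα t ht
  have hβt := hβ t ht
  have hγt := hγ t ht
  have hE := (continuousOn_primitive_zero ht0 hβt).rexp
  have hE' : ContinuousOn (fun s => Real.exp (-∫ r in (0 : ℝ)..s, β r)) (Icc 0 (t : ℝ)) :=
    (continuousOn_primitive_zero ht0 hβt).neg.rexp
  set Z : ℝ≥0 → Ω → ℝ := fun s ω => Real.exp (-∫ r in (0 : ℝ)..s, β r) * X s ω - x₀ -
    ∫ r in (0 : ℝ)..s, α r * Real.exp (-∫ u in (0 : ℝ)..r, β u) with hZ
  have hZW : ∀ s ≤ t, IsWiener hW ((Ioc 0 (s : ℝ)).indicator fun u =>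
      γ u * Real.exp (-∫ r in (0 : ℝ)..u, β r)) (Z s) := fun s hs => by
    have hsS : (s : ℝ≥0∞) < S := lt_of_le_of_lt (ENNReal.coe_le_coe.2 hs) ht
    obtain ⟨J, hJ, hXJ⟩ := h.formula s hsS
    have hJ' := (isWienerIntegral_iff (hW := hW)
      (memLp_mul_exp_integral s.coe_nonneg (hβ s hsS) (hγ s hsS))).1 hJ
    have h2 := exp_mul_exp_neg_cancel (∫ r in (0 : ℝ)..s, β r)
    refine (hJ'.const_mul (Real.exp (-∫ r in (0 : ℝ)..s, β r))).congr (.of_forall fun u => ?_) ?_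
    · by_cases hu : u ∈ Ioc 0 (s : ℝ)
      · simp only [indicator_of_mem hu, exp_integral_eq (hβ s hsS) (Ioc_subset_Icc_self hu)]
        linear_combination (-(γ u * Real.exp (-∫ r in (0 : ℝ)..u, β r))) * h2
      · simp only [indicator_of_notMem hu, mul_zero]
    · filter_upwards [hXJ] with ω hω
      rw [integral_mul_exp_integral s.coe_nonneg (hβ s hsS)] at hω
      simp only [hZ, hω]
      linear_combination (x₀ + ∫ r in (0 : ℝ)..s, α r * Real.exp (-∫ u in (0 : ℝ)..r, β u)) * h2
  have hvar := (h.continuousOn_path ht).mono fun ω hω =>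
    integral_equation_of_explicit x₀ ht0 hαt hβt hω (z := fun s => Z s.toNNReal ω)
      fun s hs => by simp [hZ, Real.coe_toNNReal s hs.1]
  have key := IsWiener.integral_by_parts (memLp_mul_continuousOn hγt hE')
    (k := fun s => β s * Real.exp (∫ r in (0 : ℝ)..s, β r))
    (IntervalIntegrable.mul_continuousOn_Icc ht0 hβt hE) hZW (hvar.mono fun _ h => h.1)
    (Real.exp (∫ r in (0 : ℝ)..t, β r))
  refine ⟨_, (isWienerIntegral_iff (hW := hW) hγt).2
    (key.congr (.of_forall fun s => ?_) (ae_eq_refl _)), ?_⟩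
  · by_cases hs : s ∈ Ioc 0 (t : ℝ)
    · have h2 := exp_mul_exp_neg_cancel (∫ r in (0 : ℝ)..s, β r)
      simp only [indicator_of_mem hs, exp_primitive_sub_integral hβt (Ioc_subset_Icc_self hs)]
      linear_combination (-(γ s)) * h2
    · simp only [indicator_of_notMem hs]
  · filter_upwards [hvar] with ω hω
    have h1 := hω.2
    simp only [Real.toNNReal_coe] at h1
    linear_combination h1

/-- The Wiener integral of a continuously differentiable function is an ordinary integral. -/
theorem IsWiener.of_hasDerivWithinAt (hW : IsBrownianReal W P) {f f' : ℝ → ℝ} {t : ℝ≥0}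
    (hf : ∀ s ∈ Icc 0 (t : ℝ), HasDerivWithinAt f (f' s) (Icc 0 (t : ℝ)) s)
    (hf' : ContinuousOn f' (Icc 0 (t : ℝ))) :
    IsWiener hW.toIsPreBrownianReal ((Ioc 0 (t : ℝ)).indicator f)
      (fun ω => f t * W t ω - ∫ s in (0 : ℝ)..t, f' s * W s.toNNReal ω) := by
  have ht : (0 : ℝ) ≤ t := t.2
  have hint : IntervalIntegrable f' volume 0 t :=
    ContinuousOn.intervalIntegrable (by rwa [uIcc_of_le ht])
  have hcont : ContinuousOn f (Icc 0 (t : ℝ)) := fun s hs => (hf s hs).continuousWithinAt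
  -- For g = 1 and Y = W the new integrand is f(t) − ∫ᵤᵗ f' = f(u).
  refine (IsWiener.integral_by_parts (hW := hW.toIsPreBrownianReal) (g := fun _ => 1) (k := f')
    (Y := W) (memLp_const 1) hint (fun s _ => IsWiener.indicator_Ioc _ s) ?_ (f t)).congr
    (.of_forall fun u => ?_) (ae_eq_refl _)
  · filter_upwards [hW.cont] with ω hω
    exact (hω.comp continuous_real_toNNReal).continuousOn
  · by_cases hu : u ∈ Ioc 0 (t : ℝ)
    · have h1 : ∫ s in u..t, f' s = f t - f u := by
        refine intervalIntegral.integral_eq_sub_of_hasDerivAt_of_le hu.2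
          (hcont.mono (Icc_subset_Icc_left hu.1.le)) (fun s hs => ?_)
          (ContinuousOn.intervalIntegrable ?_)
        · exact (hf s ⟨(hu.1.trans hs.1).le, hs.2.le⟩).hasDerivAt
            (Icc_mem_nhds (hu.1.trans hs.1) hs.2)
        · rw [uIcc_of_le hu.2]; exact hf'.mono (Icc_subset_Icc_left hu.1.le)
      simp [indicator_of_mem hu, h1]
    · simp only [indicator_of_notMem hu]

end Solutions

/-! ### Existence of an adapted continuous solution -/

section Existence

variable {Ω : Type*} {mΩ : MeasurableSpace Ω} {P : Measure Ω} {F : Filtration ℝ≥0 mΩ}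
  {W : ℝ≥0 → Ω → ℝ} {S : ℝ≥0∞} {x₀ : ℝ} {α β γ γ' : ℝ → ℝ} {X : ℝ≥0 → Ω → ℝ}

/-- Measurability refers to `m`, while `P` lives on the larger σ-algebra. The limit of
`m`-measurable versions is measurable everywhere and agrees with `g` almost surely. -/
lemma AEStronglyMeasurable.of_tendsto_ae_sub {m : MeasurableSpace Ω} {f : ℕ → Ω → ℝ} {g : Ω → ℝ}
    (hf : ∀ n, AEStronglyMeasurable[m] (f n) P)
    (hlim : ∀ᵐ ω ∂P, Tendsto (fun n => f n ω) atTop (𝓝 (g ω))) :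
    AEStronglyMeasurable[m] g P := by
  refine ⟨fun ω => limUnder atTop fun n => (hf n).mk (f n) ω,
    StronglyMeasurable.limUnder fun n => (hf n).stronglyMeasurable_mk, ?_⟩
  filter_upwards [ae_all_iff.2 fun n => (hf n).ae_eq_mk, hlim] with ω h1 h2
  simp only [← h1]
  exact h2.limUnder_eq.symm

/-- Integrals of adapted continuous processes are adapted. -/
lemma aestronglyMeasurable_integral_mul {k : ℝ → ℝ} {t : ℝ≥0}
    (hk : IntervalIntegrable k volume 0 t) (hX : ∀ s ≤ t, AEStronglyMeasurable[F s] (X s) P)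
    (hcont : ∀ᵐ ω ∂P, ContinuousOn (fun s : ℝ => X s.toNNReal ω) (Icc 0 (t : ℝ))) :
    AEStronglyMeasurable[F t] (fun ω => ∫ s in (0 : ℝ)..t, k s * X s.toNNReal ω) P := by
  refine AEStronglyMeasurable.of_tendsto_ae_sub (f := fun n ω =>
    ∑ i ∈ Finset.range (gridCard t n), gridWeight k t n i *
      X ((i : ℝ) / ((n : ℝ) + 1)).toNNReal ω) (fun n => ?_) ?_
  · have key : AEStronglyMeasurable[F t] (∑ i ∈ Finset.range (gridCard t n), fun ω =>
        gridWeight k t n i * X ((i : ℝ) / ((n : ℝ) + 1)).toNNReal ω) P := by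
      refine Finset.sum_induction _ (fun f : Ω → ℝ => AEStronglyMeasurable[F t] f P)
        (fun _ _ h h' => h.add h') aestronglyMeasurable_const fun i hi => ?_
      have hle : ((i : ℝ) / ((n : ℝ) + 1)).toNNReal ≤ t := by
        rw [Real.toNNReal_le_iff_le_coe]
        exact gridPoint_le t.coe_nonneg (Finset.mem_range.1 hi)
      exact ((hX _ hle).mono (F.mono hle)).const_mul _
    exact key.congr (.of_forall fun ω => Finset.sum_apply ω _ _)
  · filter_upwards [hcont] with ω hω
    rw [intervalIntegral.integral_of_le t.coe_nonneg]
    exact tendsto_sum_gridWeight_of_continuousOn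
      ((intervalIntegrable_iff_integrableOn_Ioc_of_le t.coe_nonneg).1 hk) hω

lemma intervalIntegrable_of_continuousOn_Icc {f : ℝ → ℝ} {t : ℝ} (ht : 0 ≤ t)
    (hf : ContinuousOn f (Icc 0 t)) : IntervalIntegrable f volume 0 t :=
  ContinuousOn.intervalIntegrable (by rwa [uIcc_of_le ht])

lemma memLp_of_continuousOn_Icc {f : ℝ → ℝ} {t : ℝ} (hf : ContinuousOn f (Icc 0 t)) :
    MemLp f 2 (volume.restrict (Ioc 0 t)) := by
  have := memLp_mul_continuousOn (γ := fun _ => 1) (memLp_const 1) hf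
  simpa using this

lemma hasDerivWithinAt_primitive {f : ℝ → ℝ} {t : ℝ} (hf : ContinuousOn f (Icc 0 t)) {s : ℝ}
    (hs : s ∈ Icc 0 t) :
    HasDerivWithinAt (fun u => ∫ r in (0 : ℝ)..u, f r) (f s) (Icc 0 t) s := by
  have : Fact (s ∈ Icc 0 t) := ⟨hs⟩
  exact intervalIntegral.integral_hasDerivWithinAt_right
    (intervalIntegrable_of_continuousOn_Icc hs.1 (hf.mono (Icc_subset_Icc_right hs.2)))
    (hf.stronglyMeasurableAtFilter_nhdsWithin measurableSet_Icc s) (hf s hs)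

/-- The derivative of the discounted diffusion coefficient. -/
lemma hasDerivWithinAt_mul_exp_neg {t : ℝ} (hβ : ContinuousOn β (Icc 0 t))
    (hγ : ∀ s ∈ Icc 0 t, HasDerivWithinAt γ (γ' s) (Icc 0 t) s) {s : ℝ} (hs : s ∈ Icc 0 t) :
    HasDerivWithinAt (fun u => γ u * Real.exp (-∫ r in (0 : ℝ)..u, β r))
      ((γ' s - γ s * β s) * Real.exp (-∫ r in (0 : ℝ)..s, β r)) (Icc 0 t) s := by
  refine ((hγ s hs).mul (hasDerivWithinAt_primitive hβ hs).neg.exp).congr_deriv ?_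
  simp only [Pi.neg_apply]
  ring

lemma continuousOn_deriv_mul_exp_neg {t : ℝ} (ht : 0 ≤ t) (hβ : ContinuousOn β (Icc 0 t))
    (hγ : ContinuousOn γ (Icc 0 t)) (hγ' : ContinuousOn γ' (Icc 0 t)) :
    ContinuousOn (fun s => (γ' s - γ s * β s) * Real.exp (-∫ r in (0 : ℝ)..s, β r)) (Icc 0 t) :=
  (hγ'.sub (hγ.mul hβ)).mul
    (continuousOn_primitive_zero ht (intervalIntegrable_of_continuousOn_Icc ht hβ)).neg.rexp

/-- The integrand of the explicit formula is continuously differentiable if `γ` is. -/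
lemma hasDerivWithinAt_mul_exp_integral {t : ℝ} (ht : 0 ≤ t) (hβ : ContinuousOn β (Icc 0 t))
    (hγ : ∀ s ∈ Icc 0 t, HasDerivWithinAt γ (γ' s) (Icc 0 t) s) {s : ℝ} (hs : s ∈ Icc 0 t) :
    HasDerivWithinAt (fun u => γ u * Real.exp (∫ r in u..t, β r))
      (Real.exp (∫ r in (0 : ℝ)..t, β r) *
        ((γ' s - γ s * β s) * Real.exp (-∫ r in (0 : ℝ)..s, β r))) (Icc 0 t) s := by
  refine ((hasDerivWithinAt_mul_exp_neg hβ hγ hs).const_mul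
    (Real.exp (∫ r in (0 : ℝ)..t, β r))).congr_of_mem (fun u hu => ?_) hs
  rw [exp_integral_eq (intervalIntegrable_of_continuousOn_Icc ht hβ) hu]
  ring

/-- The solution of the linear equation, with the Wiener integral written as an ordinary
integral. -/
def explicitSolution (W : ℝ≥0 → Ω → ℝ) (x₀ : ℝ) (α β γ γ' : ℝ → ℝ) (t : ℝ≥0) (ω : Ω) : ℝ :=
  Real.exp (∫ r in (0 : ℝ)..t, β r) *
    (x₀ + (∫ s in (0 : ℝ)..t, α s * Real.exp (-∫ r in (0 : ℝ)..s, β r)) +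
      (γ t * Real.exp (-∫ r in (0 : ℝ)..t, β r) * W t ω -
        ∫ s in (0 : ℝ)..t, (γ' s - γ s * β s) * Real.exp (-∫ r in (0 : ℝ)..s, β r) *
          W s.toNNReal ω))

/-- For continuously differentiable γ the noise term is a function of the path of W, so continuity
and adaptedness can be read off. -/
theorem isExplicitSolution_explicitSolution (hW : IsBrownianFor P F W)
    (hα : ∀ t : ℝ≥0, (t : ℝ≥0∞) < S → ContinuousOn α (Icc 0 (t : ℝ)))
    (hβ : ∀ t : ℝ≥0, (t : ℝ≥0∞) < S → ContinuousOn β (Icc 0 (t : ℝ)))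
    (hγ : ∀ t : ℝ≥0, (t : ℝ≥0∞) < S →
      ∀ s ∈ Icc 0 (t : ℝ), HasDerivWithinAt γ (γ' s) (Icc 0 (t : ℝ)) s)
    (hγ' : ∀ t : ℝ≥0, (t : ℝ≥0∞) < S → ContinuousOn γ' (Icc 0 (t : ℝ))) :
    IsExplicitSolution P F W S x₀ α β γ (explicitSolution W x₀ α β γ γ') := by
  have hγc : ∀ t : ℝ≥0, (t : ℝ≥0∞) < S → ContinuousOn γ (Icc 0 (t : ℝ)) :=
    fun t ht s hs => (hγ t ht s hs).continuousWithinAt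
  have hWc : ∀ᵐ ω ∂P, Continuous fun s : ℝ => W s.toNNReal ω := by
    filter_upwards [hW.brownian.cont] with ω hω
    exact hω.comp continuous_real_toNNReal
  refine ⟨⟨fun t ht => ?_, ?_⟩, fun t ht => ?_⟩
  · refine AEStronglyMeasurable.const_mul (AEStronglyMeasurable.add aestronglyMeasurable_const
      (((hW.adapted t).const_mul _).sub (aestronglyMeasurable_integral_mul
        (intervalIntegrable_of_continuousOn_Icc t.coe_nonneg (continuousOn_deriv_mul_exp_neg
          t.coe_nonneg (hβ t ht) (hγc t ht) (hγ' t ht)))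
        (fun s _ => hW.adapted s) (hWc.mono fun ω hω => hω.continuousOn)))) _
  · filter_upwards [hWc] with ω hω
    refine continuousOn_of_forall_Icc fun t ht => ?_
    have ht0 := t.coe_nonneg
    have hB := continuousOn_primitive_zero ht0
      (intervalIntegrable_of_continuousOn_Icc ht0 (hβ t ht))
    have hE : ContinuousOn (fun s => Real.exp (-∫ r in (0 : ℝ)..s, β r)) (Icc 0 (t : ℝ)) :=
      hB.neg.rexp
    have h1 := continuousOn_primitive_zero ht0
      (intervalIntegrable_of_continuousOn_Icc ht0 ((hα t ht).mul hE))
    have h2 := continuousOn_primitive_zero ht0 (intervalIntegrable_of_continuousOn_Icc ht0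
      ((continuousOn_deriv_mul_exp_neg ht0 (hβ t ht) (hγc t ht) (hγ' t ht)).mul hω.continuousOn))
    refine (hB.rexp.mul (((continuousOn_const (c := x₀)).add h1).add
      ((((hγc t ht).mul hE).mul hω.continuousOn).sub h2))).congr fun s hs => ?_
    simp [explicitSolution, Real.coe_toNNReal s hs.1]
  · have hβt := intervalIntegrable_of_continuousOn_Icc t.coe_nonneg (hβ t ht)
    have hf : ContinuousOn _ (Icc 0 (t : ℝ)) :=
      (continuousOn_const (c := Real.exp (∫ r in (0 : ℝ)..t, β r))).mul
        (continuousOn_deriv_mul_exp_neg t.coe_nonneg (hβ t ht) (hγc t ht) (hγ' t ht))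
    refine ⟨_, (isWienerIntegral_iff (hW := hW.brownian.toIsPreBrownianReal)
      (memLp_mul_exp_integral t.coe_nonneg hβt (memLp_of_continuousOn_Icc (hγc t ht)))).2
      (IsWiener.of_hasDerivWithinAt hW.brownian
        (fun s hs => hasDerivWithinAt_mul_exp_integral t.coe_nonneg (hβ t ht) (hγ t ht) hs) hf),
      .of_forall fun ω => ?_⟩
    have h2 := exp_mul_exp_neg_cancel (∫ r in (0 : ℝ)..t, β r)
    simp only [explicitSolution, integral_mul_exp_integral (α := α) t.coe_nonneg hβt,
      intervalIntegral.integral_same, Real.exp_zero, mul_assoc,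
      intervalIntegral.integral_const_mul]
    linear_combination (γ t * W t ω) * h2

end Existence

/-! ### Gaussian laws of the explicit solution -/

section Gaussian

variable {Ω : Type*} {mΩ : MeasurableSpace Ω} {P : Measure Ω} {F : Filtration ℝ≥0 mΩ}
  {W : ℝ≥0 → Ω → ℝ} {S : ℝ≥0∞} {x₀ : ℝ} {α β γ : ℝ → ℝ} {X : ℝ≥0 → Ω → ℝ}

/-- The mean of the explicit solution. -/
def explicitMean (x₀ : ℝ) (α β : ℝ → ℝ) (t : ℝ) : ℝ :=
  Real.exp (∫ r in (0 : ℝ)..t, β r) *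
    (x₀ + ∫ s in (0 : ℝ)..t, α s * Real.exp (-∫ r in (0 : ℝ)..s, β r))

/-- The variance of the explicit solution. -/
def explicitVariance (β γ : ℝ → ℝ) (t : ℝ) : ℝ :=
  Real.exp (∫ r in (0 : ℝ)..t, 2 * β r) *
    ∫ s in (0 : ℝ)..t, γ s ^ 2 * Real.exp (-∫ r in (0 : ℝ)..s, 2 * β r)

lemma IsWiener.hasLaw_const_add {hW : IsPreBrownianReal W P} {f : ℝ → ℝ} {Y Z : Ω → ℝ}
    (h : IsWiener hW f Y) (c : ℝ) (hZ : Z =ᵐ[P] fun ω => c + Y ω) :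
    HasLaw Z (gaussianReal c (∫ s, f s ^ 2).toNNReal) P := by
  have := gaussianReal_const_add h.hasLaw c
  rw [zero_add] at this
  exact this.congr hZ

lemma IsExplicitSolution.exists_isWiener (hW : IsPreBrownianReal W P)
    (h : IsExplicitSolution P F W S x₀ α β γ X) {t : ℝ≥0} (ht : (t : ℝ≥0∞) < S)
    (hβ : IntervalIntegrable β volume 0 t) (hγ : MemLp γ 2 (volume.restrict (Ioc 0 (t : ℝ)))) :
    ∃ J : Ω → ℝ, IsWiener hW
        ((Ioc 0 (t : ℝ)).indicator fun s => γ s * Real.exp (∫ r in s..t, β r)) J ∧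
      X t =ᵐ[P] fun ω => explicitMean x₀ α β t + J ω := by
  obtain ⟨J, hJ, hXJ⟩ := h.formula t ht
  refine ⟨J, (isWienerIntegral_iff (memLp_mul_exp_integral t.coe_nonneg hβ hγ)).1 hJ, ?_⟩
  filter_upwards [hXJ] with ω hω
  rw [hω, integral_mul_exp_integral t.coe_nonneg hβ, explicitMean]
  ring

/-- The solution is its mean plus a Wiener integral; the isometry gives the variance, and squaring
the exponential doubles β. -/
theorem IsExplicitSolution.hasLaw (hW : IsPreBrownianReal W P)
    (h : IsExplicitSolution P F W S x₀ α β γ X) {t : ℝ≥0} (ht : (t : ℝ≥0∞) < S)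
    (hβ : IntervalIntegrable β volume 0 t) (hγ : MemLp γ 2 (volume.restrict (Ioc 0 (t : ℝ)))) :
    HasLaw (X t) (gaussianReal (explicitMean x₀ α β t) (explicitVariance β γ t).toNNReal) P := by
  obtain ⟨J, hJ, hX⟩ := h.exists_isWiener hW ht hβ hγ
  have hlaw := hJ.hasLaw_const_add _ hX
  convert hlaw using 3
  have h1 : (fun s => (Ioc 0 (t : ℝ)).indicator (fun s => γ s * Real.exp (∫ r in s..t, β r)) s ^ 2)
      = (Ioc 0 (t : ℝ)).indicator fun s => γ s ^ 2 * Real.exp (∫ r in s..t, 2 * β r) := by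
    funext s
    by_cases hs : s ∈ Ioc 0 (t : ℝ)
    · simp only [indicator_of_mem hs, intervalIntegral.integral_const_mul]
      rw [two_mul, Real.exp_add]
      ring
    · simp [indicator_of_notMem hs]
  rw [h1, integral_indicator measurableSet_Ioc, ← intervalIntegral.integral_of_le t.coe_nonneg,
    integral_mul_exp_integral (α := fun s => γ s ^ 2) t.coe_nonneg (hβ.const_mul 2),
    explicitVariance]

/-- A linear functional of finitely many values of X is a constant plus a sum of Wiener integrals,
and such a sum is again one Wiener integral, hence Gaussian. -/
theorem IsExplicitSolution.isGaussian (hW : IsPreBrownianReal W P)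
    (h : IsExplicitSolution P F W S x₀ α β γ X)
    (hβ : ∀ t : ℝ≥0, (t : ℝ≥0∞) < S → IntervalIntegrable β volume 0 t)
    (hγ : ∀ t : ℝ≥0, (t : ℝ≥0∞) < S → MemLp γ 2 (volume.restrict (Ioc 0 (t : ℝ)))) :
    IsGaussianProcess (fun t : {t : ℝ≥0 // (t : ℝ≥0∞) < S} => X t) P := by
  choose J hJ hXJ using fun t : {t : ℝ≥0 // (t : ℝ≥0∞) < S} =>
    h.exists_isWiener hW t.2 (hβ t t.2) (hγ t t.2)
  refine ⟨fun I => ⟨isGaussian_of_map_eq_gaussianReal fun L => ?_⟩⟩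
  have hXm : ∀ t : {t : ℝ≥0 // (t : ℝ≥0∞) < S}, AEMeasurable (X t) P := fun t =>
    ((h.adapted t t.2).mono (F.le t)).aemeasurable
  have hm : AEMeasurable (fun ω => I.restrict fun t : {t : ℝ≥0 // (t : ℝ≥0∞) < S} => X t ω) P :=
    aemeasurable_pi_lambda _ fun t => hXm t
  have hsum := IsWiener.sum (hW := hW) Finset.univ
    (fun (i : I) _ => (hJ i).const_mul (L (Pi.single i 1)))
  refine ⟨_, _, (AEMeasurable.map_map_of_aemeasurable L.measurable.aemeasurable hm).trans
    (hsum.hasLaw_const_add (∑ i : I, L (Pi.single i 1) * explicitMean x₀ α β i) ?_).map_eq⟩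
  filter_upwards [ae_all_iff.2 fun i : I => hXJ i] with ω hω
  have h1 : (I.restrict fun t : {t : ℝ≥0 // (t : ℝ≥0∞) < S} => X t ω) =
      ∑ i : I, X i ω • (Pi.single i 1 : I → ℝ) := by
    funext j
    simp [Finset.sum_apply, Pi.single_apply]
  simp only [Function.comp_apply, h1, map_sum, map_smul, smul_eq_mul, hω, add_mul,
    Finset.sum_add_distrib]
  congr 1 <;> exact Finset.sum_congr rfl fun i _ => mul_comm _ _

end Gaussian

/-! ### Differential equations for mean and variance -/

section MeanVariance

variable {S : ℝ≥0∞} {x₀ : ℝ} {α β γ : ℝ → ℝ}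

lemma toNNReal_lt_of_mem_Icc {t : ℝ≥0} (ht : (t : ℝ≥0∞) < S) {s : ℝ} (hs : s ∈ Icc 0 (t : ℝ)) :
    ((s.toNNReal : ℝ≥0) : ℝ≥0∞) < S := by
  refine lt_of_le_of_lt ?_ ht
  rw [ENNReal.coe_le_coe]
  exact Real.toNNReal_le_iff_le_coe.2 hs.2

lemma hasDerivWithinAt_Ici_of_forall_Icc {f : ℝ → ℝ} {f' : ℝ} {t : ℝ≥0} (ht : (t : ℝ≥0∞) < S)
    (h : ∀ u : ℝ≥0, (u : ℝ≥0∞) < S → (t : ℝ) ∈ Icc 0 (u : ℝ) →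
      HasDerivWithinAt f f' (Icc 0 (u : ℝ)) t) : HasDerivWithinAt f f' (Ici 0) t := by
  obtain ⟨u, htu, hu⟩ := ENNReal.lt_iff_exists_nnreal_btwn.1 ht
  rw [ENNReal.coe_lt_coe] at htu
  have htu' : (t : ℝ) < u := htu
  refine (h u hu ⟨t.coe_nonneg, htu'.le⟩).mono_of_mem_nhdsWithin ?_
  rw [← Ici_inter_Iic]
  exact inter_mem_nhdsWithin _ (Iic_mem_nhds htu')

/-- The variance obeys the equation of a mean with rate 2β, source γ² and initial value 0, so one
set of lemmas serves both. -/
lemma explicitVariance_eq_explicitMean (β γ : ℝ → ℝ) :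
    explicitVariance β γ = explicitMean 0 (fun s => γ s ^ 2) fun s => 2 * β s := by
  funext t
  simp [explicitVariance, explicitMean]

lemma explicitVariance_nonneg (β γ : ℝ → ℝ) {t : ℝ} (ht : 0 ≤ t) :
    0 ≤ explicitVariance β γ t :=
  mul_nonneg (Real.exp_pos _).le (intervalIntegral.integral_nonneg ht fun _ _ => by positivity)

lemma explicitMean_zero (x₀ : ℝ) (α β : ℝ → ℝ) : explicitMean x₀ α β 0 = x₀ := by
  simp [explicitMean]

lemma continuousOn_explicitMean {t : ℝ} (ht : 0 ≤ t) (hα : IntervalIntegrable α volume 0 t)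
    (hβ : IntervalIntegrable β volume 0 t) : ContinuousOn (explicitMean x₀ α β) (Icc 0 t) := by
  have hB := continuousOn_primitive_zero ht hβ
  have hE : ContinuousOn (fun s => Real.exp (-∫ r in (0 : ℝ)..s, β r)) (Icc 0 t) := hB.neg.rexp
  exact hB.rexp.mul (continuousOn_const.add (continuousOn_primitive_zero ht
    (IntervalIntegrable.mul_continuousOn_Icc ht hα hE)))

lemma hasDerivWithinAt_explicitMean {t : ℝ} (hα : ContinuousOn α (Icc 0 t))
    (hβ : ContinuousOn β (Icc 0 t)) {s : ℝ} (hs : s ∈ Icc 0 t) :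
    HasDerivWithinAt (explicitMean x₀ α β) (α s + β s * explicitMean x₀ α β s) (Icc 0 t) s := by
  have hE : ContinuousOn (fun s => Real.exp (-∫ r in (0 : ℝ)..s, β r)) (Icc 0 t) :=
    (continuousOn_primitive_zero (hs.1.trans hs.2)
      (intervalIntegrable_of_continuousOn_Icc (hs.1.trans hs.2) hβ)).neg.rexp
  refine ((hasDerivWithinAt_primitive hβ hs).exp.mul
    ((hasDerivWithinAt_primitive (hα.mul hE) hs).const_add x₀)).congr_deriv ?_
  have h := exp_mul_exp_neg_cancel (∫ r in (0 : ℝ)..s, β r)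
  simp only [explicitMean, Pi.mul_apply]
  linear_combination α s * h

/-- Variation of constants with vanishing noise. -/
lemma eq_explicitMean_of_hasDerivWithinAt {m : ℝ → ℝ} {t : ℝ} (ht : 0 ≤ t)
    (hα : ContinuousOn α (Icc 0 t)) (hβ : ContinuousOn β (Icc 0 t)) (h0 : m 0 = x₀)
    (hm : ∀ s ∈ Icc 0 t, HasDerivWithinAt m (α s + β s * m s) (Icc 0 t) s) :
    m t = explicitMean x₀ α β t := by
  have hmc : ContinuousOn m (Icc 0 t) := fun s hs => (hm s hs).continuousWithinAt
  have hint : ∀ s ∈ Icc 0 t, ∫ r in (0 : ℝ)..s, (α r + β r * m r) = m s - x₀ := fun s hs => by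
    rw [← h0]
    refine intervalIntegral.integral_eq_sub_of_hasDerivAt_of_le hs.1
      (hmc.mono (Icc_subset_Icc_right hs.2)) (fun r hr => (hm r ⟨hr.1.le, hr.2.le.trans hs.2⟩).hasDerivAt
        (Icc_mem_nhds hr.1 (hr.2.trans_le hs.2))) (intervalIntegrable_of_continuousOn_Icc hs.1
        ((hα.add (hβ.mul hmc)).mono (Icc_subset_Icc_right hs.2)))
  have key := (variation_of_constants x₀ ht (intervalIntegrable_of_continuousOn_Icc ht hα)
    (intervalIntegrable_of_continuousOn_Icc ht hβ) hmc (y := fun _ => 0)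
    fun s hs => by rw [hint s hs]; ring).2
  have h := exp_mul_exp_neg_cancel (∫ r in (0 : ℝ)..t, β r)
  simp only [mul_zero, intervalIntegral.integral_zero, add_zero] at key
  rw [explicitMean, ← key]
  linear_combination (-(m t)) * h

end MeanVariance

/-! ### Coefficients along a solution of the system -/

namespace IsODESolution

variable {a₀ a₁ b f : ℝ → ℝ} {x₀ : ℝ} {S : ℝ≥0∞} {A G : ℝ → ℝ}

lemma nonneg_Icc (h : IsODESolution a₀ a₁ b x₀ S A G) {t : ℝ≥0} (ht : (t : ℝ≥0∞) < S) {s : ℝ}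
    (hs : s ∈ Icc 0 (t : ℝ)) : 0 ≤ G s := by
  have := h.nonneg _ (toNNReal_lt_of_mem_Icc ht hs)
  rwa [Real.coe_toNNReal s hs.1] at this

lemma derivA_Icc (h : IsODESolution a₀ a₁ b x₀ S A G) {t : ℝ≥0} (ht : (t : ℝ≥0∞) < S) {s : ℝ}
    (hs : s ∈ Icc 0 (t : ℝ)) : HasDerivWithinAt A (gaussTransformExt a₀ (A s) (G s)
      + gaussTransformExt a₁ (A s) (G s) * A s) (Icc 0 (t : ℝ)) s := by
  have := h.derivA _ (toNNReal_lt_of_mem_Icc ht hs)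
  rw [Real.coe_toNNReal s hs.1] at this
  exact this.mono Icc_subset_Ici_self

lemma derivG_Icc (h : IsODESolution a₀ a₁ b x₀ S A G) {t : ℝ≥0} (ht : (t : ℝ≥0∞) < S) {s : ℝ}
    (hs : s ∈ Icc 0 (t : ℝ)) : HasDerivWithinAt G (gaussTransformExt b (A s) (G s) ^ 2
      + 2 * gaussTransformExt a₁ (A s) (G s) * G s) (Icc 0 (t : ℝ)) s := by
  have := h.derivG _ (toNNReal_lt_of_mem_Icc ht hs)
  rw [Real.coe_toNNReal s hs.1] at this
  exact this.mono Icc_subset_Ici_self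

lemma continuousOn_curve (h : IsODESolution a₀ a₁ b x₀ S A G) {t : ℝ≥0} (ht : (t : ℝ≥0∞) < S) :
    ContinuousOn (fun s => (A s, G s)) (Icc 0 (t : ℝ)) := fun _ hs =>
  (h.derivA_Icc ht hs).continuousWithinAt.prodMk (h.derivG_Icc ht hs).continuousWithinAt

lemma continuousOn_coeff (h : IsODESolution a₀ a₁ b x₀ S A G) (df : PartialsExtend f) {t : ℝ≥0}
    (ht : (t : ℝ≥0∞) < S) :
    ContinuousOn (fun s => gaussTransformExt f (A s) (G s)) (Icc 0 (t : ℝ)) := by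
  have := df.continuousOn_gaussExt.comp (h.continuousOn_curve ht) fun _ hs => h.nonneg_Icc ht hs
  exact this

/-- The coefficients of the linear equation are continuously differentiable in time. -/
lemma exists_deriv_coeff (h : IsODESolution a₀ a₁ b x₀ S A G) (da₀ : PartialsExtend a₀)
    (da₁ : PartialsExtend a₁) (db : PartialsExtend b) (df : PartialsExtend f) :
    ∃ φ' : ℝ → ℝ, ∀ t : ℝ≥0, (t : ℝ≥0∞) < S → ContinuousOn φ' (Icc 0 (t : ℝ)) ∧
      ∀ s ∈ Icc 0 (t : ℝ), HasDerivWithinAt (fun s => gaussTransformExt f (A s) (G s)) (φ' s)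
        (Icc 0 (t : ℝ)) s := by
  obtain ⟨-, D, hD, hDf⟩ := df.gaussExt_spec
  -- The chain rule holds within the closed half plane; this matters because the curve starts on the
  -- boundary, where G = 0.
  refine ⟨fun s => D (A s, G s) (gaussTransformExt a₀ (A s) (G s)
      + gaussTransformExt a₁ (A s) (G s) * A s, gaussTransformExt b (A s) (G s) ^ 2
      + 2 * gaussTransformExt a₁ (A s) (G s) * G s), fun t ht => ⟨?_, fun s hs => ?_⟩⟩
  · have hc := h.continuousOn_curve ht
    have hA : ContinuousOn A (Icc 0 (t : ℝ)) := continuous_fst.comp_continuousOn hc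
    have hG : ContinuousOn G (Icc 0 (t : ℝ)) := continuous_snd.comp_continuousOn hc
    have h0 := h.continuousOn_coeff da₀ ht
    have h1 := h.continuousOn_coeff da₁ ht
    have h2 := h.continuousOn_coeff db ht
    refine (hD.comp hc fun _ hs => h.nonneg_Icc ht hs).clm_apply
      ((h0.add (h1.mul hA)).prodMk ((h2.pow 2).add ((continuousOn_const.mul h1).mul hG)))
  · exact (hDf (A s, G s) (h.nonneg_Icc ht hs)).comp_hasDerivWithinAt s
      ((h.derivA_Icc ht hs).prodMk (h.derivG_Icc ht hs)) fun r hr => h.nonneg_Icc ht hr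

lemma explicitMean_eq (h : IsODESolution a₀ a₁ b x₀ S A G) (da₀ : PartialsExtend a₀)
    (da₁ : PartialsExtend a₁) {t : ℝ≥0} (ht : (t : ℝ≥0∞) < S) :
    explicitMean x₀ (fun s => gaussTransformExt a₀ (A s) (G s))
      (fun s => gaussTransformExt a₁ (A s) (G s)) t = A t :=
  (eq_explicitMean_of_hasDerivWithinAt t.coe_nonneg (h.continuousOn_coeff da₀ ht)
    (h.continuousOn_coeff da₁ ht) h.initA fun _ hs => h.derivA_Icc ht hs).symm

lemma explicitVariance_eq (h : IsODESolution a₀ a₁ b x₀ S A G)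
    (da₁ : PartialsExtend a₁) (db : PartialsExtend b) {t : ℝ≥0} (ht : (t : ℝ≥0∞) < S) :
    explicitVariance (fun s => gaussTransformExt a₁ (A s) (G s))
      (fun s => gaussTransformExt b (A s) (G s)) t = G t := by
  rw [explicitVariance_eq_explicitMean]
  exact (eq_explicitMean_of_hasDerivWithinAt t.coe_nonneg ((h.continuousOn_coeff db ht).pow 2)
    (continuousOn_const.mul (h.continuousOn_coeff da₁ ht)) h.initG
    fun _ hs => h.derivG_Icc ht hs).symm

end IsODESolution

/-! ### Equivalence with the McKean–Vlasov equation -/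

section McKeanVlasov

variable {Ω : Type*} {mΩ : MeasurableSpace Ω} {P : Measure Ω} {F : Filtration ℝ≥0 mΩ}
  {W : ℝ≥0 → Ω → ℝ} {S : ℝ≥0∞} {x₀ : ℝ} {α β γ α' β' γ' : ℝ → ℝ} {X : ℝ≥0 → Ω → ℝ}
  {a₀ a₁ b A G : ℝ → ℝ}

lemma IsWienerIntegral.congr {t : ℝ≥0} {J : Ω → ℝ} (h : IsWienerIntegral P W γ t J)
    (hγ : ∀ s ∈ Ioc 0 (t : ℝ), γ' s = γ s) : IsWienerIntegral P W γ' t J := by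
  refine ⟨h.1, fun ε hε => ?_⟩
  obtain ⟨n, τ, c, h1, h2, h3, h4⟩ := h.2 ε hε
  refine ⟨n, τ, c, h1, h2, lt_of_eq_of_lt (eLpNorm_congr_ae ?_) h3, h4⟩
  filter_upwards [ae_restrict_mem measurableSet_Ioc] with s hs
  rw [hγ s hs]

/-- The linear equation on `[0, S)` depends only on the coefficients on `[0, S)`. -/
lemma IsLinearSDESolution.congr (h : IsLinearSDESolution P F W S x₀ α β γ X)
    (hα : ∀ t : ℝ≥0, (t : ℝ≥0∞) < S → α' t = α t) (hβ : ∀ t : ℝ≥0, (t : ℝ≥0∞) < S → β' t = β t)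
    (hγ : ∀ t : ℝ≥0, (t : ℝ≥0∞) < S → γ' t = γ t) :
    IsLinearSDESolution P F W S x₀ α' β' γ' X := by
  have ext : ∀ {φ φ' : ℝ → ℝ}, (∀ t : ℝ≥0, (t : ℝ≥0∞) < S → φ' t = φ t) →
      ∀ t : ℝ≥0, (t : ℝ≥0∞) < S → ∀ s ∈ Icc 0 (t : ℝ), φ' s = φ s := fun hφ t ht s hs => by
    have := hφ _ (toNNReal_lt_of_mem_Icc ht hs)
    rwa [Real.coe_toNNReal s hs.1] at this
  have hint : ∀ {φ φ' : ℝ → ℝ}, (∀ t : ℝ≥0, (t : ℝ≥0∞) < S → φ' t = φ t) →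
      ∀ t : ℝ≥0, (t : ℝ≥0∞) < S → IntervalIntegrable φ volume 0 t →
      IntervalIntegrable φ' volume 0 t := fun hφ t ht h => by
    refine h.congr fun s hs => ?_
    rw [uIoc_of_le t.coe_nonneg] at hs
    exact (ext hφ t ht s (Ioc_subset_Icc_self hs)).symm
  refine ⟨h.toIsContinuousAdapted, fun t ht => hint hα t ht (h.integrable_α t ht),
    fun t ht => hint hβ t ht (h.integrable_β t ht), fun t ht => ?_, fun t ht => ?_⟩
  · refine (memLp_congr_ae ?_).1 (h.sq_integrable_γ t ht)
    filter_upwards [ae_restrict_mem measurableSet_Ioc] with s hs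
    exact (ext hγ t ht s (Ioc_subset_Icc_self hs)).symm
  · obtain ⟨J, hJ, hX⟩ := h.equation t ht
    refine ⟨J, hJ.congr fun s hs => ext hγ t ht s (Ioc_subset_Icc_self hs), ?_⟩
    filter_upwards [hX] with ω hω
    rw [hω, intervalIntegral.integral_congr fun s hs => ?_]
    rw [uIcc_of_le t.coe_nonneg] at hs
    simp only [ext hα t ht s hs, ext hβ t ht s hs]

lemma integral_comp_of_hasLaw {f : ℝ → ℝ} (hf : Continuous f) (pf : PolynomiallyBounded f)
    (df : PartialsExtend f) {Y : Ω → ℝ} {m v : ℝ} (hv : 0 ≤ v)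
    (h : HasLaw Y (gaussianReal m v.toNNReal) P) :
    ∫ ω, f (Y ω) ∂P = gaussTransformExt f m v := by
  rw [← gaussExt.eq_def f (m, v), ← integral_gaussianReal_eq_gaussExt hf pf df m hv, ← h.map_eq,
    integral_map h.aemeasurable hf.aestronglyMeasurable]

lemma integrable_comp_of_hasLaw {f : ℝ → ℝ} (hf : Measurable f) (pf : PolynomiallyBounded f)
    {Y : Ω → ℝ} {m : ℝ} {v : ℝ≥0} (h : HasLaw Y (gaussianReal m v) P) :
    Integrable (fun ω => f (Y ω)) P := by
  have := pf.integrable_gaussianReal hf m v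
  rw [← h.map_eq] at this
  exact this.comp_aemeasurable h.aemeasurable

lemma IsODESolution.unique (da₀ : PartialsExtend a₀) (da₁ : PartialsExtend a₁)
    (db : PartialsExtend b) {A' G' : ℝ → ℝ} (h : IsODESolution a₀ a₁ b x₀ S A G)
    (h' : IsODESolution a₀ a₁ b x₀ S A' G') {t : ℝ≥0} (ht : (t : ℝ≥0∞) < S) :
    A' t = A t ∧ G' t = G t := by
  obtain ⟨T, B, H, -, -, -, hmax⟩ := exists_maximal_IsODESolution da₀ da₁ db x₀
  obtain ⟨h1, h2⟩ := (hmax S A G h).2 t ht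
  obtain ⟨h3, h4⟩ := (hmax S A' G' h').2 t ht
  exact ⟨h3.trans h1.symm, h4.trans h2.symm⟩

/-- The expectations are frozen as coefficients, which makes the solution Gaussian. Its mean and
variance then solve the system and coincide with A and G by uniqueness. -/
theorem IsMcKeanVlasovSolution.isLinearSDESolution (hW : IsPreBrownianReal W P)
    (ca₀ : Continuous a₀) (ca₁ : Continuous a₁) (cb : Continuous b)
    (pa₀ : PolynomiallyBounded a₀) (pa₁ : PolynomiallyBounded a₁) (pb : PolynomiallyBounded b)
    (da₀ : PartialsExtend a₀) (da₁ : PartialsExtend a₁) (db : PartialsExtend b)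
    (hAG : IsODESolution a₀ a₁ b x₀ S A G)
    (h : IsMcKeanVlasovSolution P F W S x₀ a₀ a₁ b X) :
    IsLinearSDESolution P F W S x₀ (fun t => gaussTransformExt a₀ (A t) (G t))
      (fun t => gaussTransformExt a₁ (A t) (G t)) (fun t => gaussTransformExt b (A t) (G t)) X := by
  have hsde := h.sde
  set ca : ℝ → ℝ := fun t => ∫ ω, a₀ (X t.toNNReal ω) ∂P with hca
  set cb₁ : ℝ → ℝ := fun t => ∫ ω, a₁ (X t.toNNReal ω) ∂P with hcb₁
  set cc : ℝ → ℝ := fun t => ∫ ω, b (X t.toNNReal ω) ∂P with hcc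
  set m := explicitMean x₀ ca cb₁ with hm
  set v := explicitVariance cb₁ cc with hv
  have hlaw : ∀ t : ℝ≥0, (t : ℝ≥0∞) < S →
      HasLaw (X t) (gaussianReal (m t) (v t).toNNReal) P := fun t ht =>
    (hsde.isExplicitSolution hW).hasLaw hW ht (hsde.integrable_β t ht) (hsde.sq_integrable_γ t ht)
  have hcoeff : ∀ {f : ℝ → ℝ}, Continuous f → PolynomiallyBounded f → PartialsExtend f →
      ∀ t : ℝ≥0, (t : ℝ≥0∞) < S →
        ∫ ω, f (X (t : ℝ).toNNReal ω) ∂P = gaussTransformExt f (m t) (v t) :=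
    fun hf pf df t ht => by
      rw [Real.toNNReal_coe]
      exact integral_comp_of_hasLaw hf pf df (explicitVariance_nonneg _ _ t.coe_nonneg) (hlaw t ht)
  have hmv : ∀ t : ℝ≥0, (t : ℝ≥0∞) < S → ContinuousOn (fun s => (m s, v s)) (Icc 0 (t : ℝ)) :=
    fun t ht => by
      refine (continuousOn_explicitMean t.coe_nonneg (hsde.integrable_α t ht)
        (hsde.integrable_β t ht)).prodMk ?_
      rw [hv, explicitVariance_eq_explicitMean]
      refine continuousOn_explicitMean t.coe_nonneg ?_ ((hsde.integrable_β t ht).const_mul 2)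
      rw [intervalIntegrable_iff_integrableOn_Ioc_of_le t.coe_nonneg]
      exact (hsde.sq_integrable_γ t ht).integrable_sq
  -- The expectations are assumed only integrable in time. As Gauss transforms along the continuous
  -- curve (m, v) they are continuous, so that m and v become differentiable.
  have hcont : ∀ {f : ℝ → ℝ}, Continuous f → PolynomiallyBounded f → PartialsExtend f →
      ∀ t : ℝ≥0, (t : ℝ≥0∞) < S →
        ContinuousOn (fun s => ∫ ω, f (X s.toNNReal ω) ∂P) (Icc 0 (t : ℝ)) :=
    fun hf pf df t ht => by
      refine (df.continuousOn_gaussExt.comp (hmv t ht) fun s hs =>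
        explicitVariance_nonneg _ _ hs.1).congr fun s hs => ?_
      have := hcoeff hf pf df _ (toNNReal_lt_of_mem_Icc ht hs)
      rwa [Real.coe_toNNReal s hs.1] at this
  have hsol : IsODESolution a₀ a₁ b x₀ S m v := by
    refine ⟨explicitMean_zero _ _ _, by rw [hv, explicitVariance_eq_explicitMean, explicitMean_zero],
      fun t _ => explicitVariance_nonneg _ _ t.coe_nonneg, fun t ht => ?_, fun t ht => ?_⟩
    · rw [← hcoeff ca₁ pa₁ da₁ t ht, ← hcoeff cb pb db t ht]
      refine hasDerivWithinAt_Ici_of_forall_Icc ht fun u hu htu => ?_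
      rw [hv, explicitVariance_eq_explicitMean]
      exact hasDerivWithinAt_explicitMean ((hcont cb pb db u hu).pow 2)
        (continuousOn_const.mul (hcont ca₁ pa₁ da₁ u hu)) htu
    · rw [← hcoeff ca₁ pa₁ da₁ t ht, ← hcoeff ca₀ pa₀ da₀ t ht]
      exact hasDerivWithinAt_Ici_of_forall_Icc ht fun u hu htu =>
        hasDerivWithinAt_explicitMean (hcont ca₀ pa₀ da₀ u hu) (hcont ca₁ pa₁ da₁ u hu) htu
  have heq : ∀ {f : ℝ → ℝ}, Continuous f → PolynomiallyBounded f → PartialsExtend f →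
      ∀ t : ℝ≥0, (t : ℝ≥0∞) < S →
        gaussTransformExt f (A t) (G t) = ∫ ω, f (X (t : ℝ).toNNReal ω) ∂P :=
    fun hf pf df t ht => by
      obtain ⟨h1, h2⟩ := hAG.unique da₀ da₁ db hsol ht
      rw [hcoeff hf pf df t ht, h1, h2]
  exact hsde.congr (heq ca₀ pa₀ da₀) (heq ca₁ pa₁ da₁) (heq cb pb db)

/-- The one-dimensional distributions of the solution of the linear equation. -/
theorem IsExplicitSolution.hasLaw_of_isODESolution (hW : IsPreBrownianReal W P)
    (da₀ : PartialsExtend a₀) (da₁ : PartialsExtend a₁) (db : PartialsExtend b)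
    (hAG : IsODESolution a₀ a₁ b x₀ S A G)
    (h : IsExplicitSolution P F W S x₀ (fun t => gaussTransformExt a₀ (A t) (G t))
      (fun t => gaussTransformExt a₁ (A t) (G t)) (fun t => gaussTransformExt b (A t) (G t)) X)
    {t : ℝ≥0} (ht : (t : ℝ≥0∞) < S) :
    HasLaw (X t) (gaussianReal (A t) (G t).toNNReal) P := by
  have := h.hasLaw hW ht
    (intervalIntegrable_of_continuousOn_Icc t.coe_nonneg (hAG.continuousOn_coeff da₁ ht))
    (memLp_of_continuousOn_Icc (hAG.continuousOn_coeff db ht))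
  rwa [hAG.explicitMean_eq da₀ da₁ ht, hAG.explicitVariance_eq da₁ db ht] at this

/-- The law N(A_t, G_t) is known from the explicit formula, so the expectations exist and equal the
given coefficients. -/
theorem IsLinearSDESolution.isMcKeanVlasovSolution (hW : IsPreBrownianReal W P)
    (ca₀ : Continuous a₀) (ca₁ : Continuous a₁) (cb : Continuous b)
    (pa₀ : PolynomiallyBounded a₀) (pa₁ : PolynomiallyBounded a₁) (pb : PolynomiallyBounded b)
    (da₀ : PartialsExtend a₀) (da₁ : PartialsExtend a₁) (db : PartialsExtend b)
    (hAG : IsODESolution a₀ a₁ b x₀ S A G)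
    (h : IsLinearSDESolution P F W S x₀ (fun t => gaussTransformExt a₀ (A t) (G t))
      (fun t => gaussTransformExt a₁ (A t) (G t)) (fun t => gaussTransformExt b (A t) (G t)) X) :
    IsMcKeanVlasovSolution P F W S x₀ a₀ a₁ b X := by
  have hlaw : ∀ t : ℝ≥0, (t : ℝ≥0∞) < S →
      HasLaw (X t) (gaussianReal (A t) (G t).toNNReal) P := fun t ht =>
    (h.isExplicitSolution hW).hasLaw_of_isODESolution hW da₀ da₁ db hAG ht
  have hcoeff : ∀ {f : ℝ → ℝ}, Continuous f → PolynomiallyBounded f → PartialsExtend f →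
      ∀ t : ℝ≥0, (t : ℝ≥0∞) < S →
        ∫ ω, f (X (t : ℝ).toNNReal ω) ∂P = gaussTransformExt f (A t) (G t) :=
    fun hf pf df t ht => by
      rw [Real.toNNReal_coe]
      exact integral_comp_of_hasLaw hf pf df (hAG.nonneg t ht) (hlaw t ht)
  exact ⟨fun t ht => integrable_comp_of_hasLaw ca₀.measurable pa₀ (hlaw t ht),
    fun t ht => integrable_comp_of_hasLaw ca₁.measurable pa₁ (hlaw t ht),
    fun t ht => integrable_comp_of_hasLaw cb.measurable pb (hlaw t ht),
    h.congr (hcoeff ca₀ pa₀ da₀) (hcoeff ca₁ pa₁ da₁) (hcoeff cb pb db)⟩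

end McKeanVlasov

end AffineMcKeanVlasov

end

/-! ### The main theorem -/

open AffineMcKeanVlasov in
theorem mainTheorem2 (a₀ a₁ b : ℝ → ℝ) (x₀ : ℝ)
    (ha₀ : Measurable a₀) (ha₁ : Measurable a₁) (hb : Measurable b)
    (pa₀ : PolynomiallyBounded a₀) (pa₁ : PolynomiallyBounded a₁) (pb : PolynomiallyBounded b)
    (da₀ : PartialsExtend a₀) (da₁ : PartialsExtend a₁) (db : PartialsExtend b) :
    -- (i) unique maximal solution of the ODE system, up to a possible explosion time `T`
    (∃ (T : ℝ≥0∞) (A G : ℝ → ℝ), 0 < T ∧ IsODESolution a₀ a₁ b x₀ T A G ∧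
      (T ≠ ∞ → Tendsto (fun t => |A t| + |G t|) (𝓝[<] T.toReal) atTop) ∧
      ∀ (S : ℝ≥0∞) (A' G' : ℝ → ℝ), IsODESolution a₀ a₁ b x₀ S A' G' →
        S ≤ T ∧ ∀ t : ℝ≥0, (t : ℝ≥0∞) < S → A' t = A t ∧ G' t = G t) ∧
    -- (ii) on every interval `[0, S)` on which the ODE system is solved by `(A, G)`
    (∀ (S : ℝ≥0∞) (A G : ℝ → ℝ), IsODESolution a₀ a₁ b x₀ S A G →
      ∀ (Ω : Type*) (mΩ : MeasurableSpace Ω) (P : Measure Ω) [IsProbabilityMeasure P]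
        (F : Filtration ℝ≥0 mΩ) (W : ℝ≥0 → Ω → ℝ), IsBrownianFor P F W →
      let α : ℝ → ℝ := fun t => gaussTransformExt a₀ (A t) (G t)
      let β : ℝ → ℝ := fun t => gaussTransformExt a₁ (A t) (G t)
      let γ : ℝ → ℝ := fun t => gaussTransformExt b (A t) (G t)
      -- the McKean–Vlasov equation is equivalent to the linear equation
      (Continuous a₀ → Continuous a₁ → Continuous b → ∀ X : ℝ≥0 → Ω → ℝ,
        (IsMcKeanVlasovSolution P F W S x₀ a₀ a₁ b X ↔
          IsLinearSDESolution P F W S x₀ α β γ X)) ∧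
      -- the linear equation has a solution, and its solutions are given by the explicit formula
      (∀ X : ℝ≥0 → Ω → ℝ, IsLinearSDESolution P F W S x₀ α β γ X ↔
        IsExplicitSolution P F W S x₀ α β γ X) ∧
      (∃ X : ℝ≥0 → Ω → ℝ, IsExplicitSolution P F W S x₀ α β γ X) ∧
      -- the explicit solution is a Gaussian process with `X_t ∼ N(A_t, G_t)`
      (∀ X : ℝ≥0 → Ω → ℝ, IsExplicitSolution P F W S x₀ α β γ X →
        IsGaussianProcess (fun t : {t : ℝ≥0 // (t : ℝ≥0∞) < S} => X t) P ∧
        ∀ t : ℝ≥0, (t : ℝ≥0∞) < S → HasLaw (X t) (gaussianReal (A t) (G t).toNNReal) P) ∧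
      -- the integrand is continuously differentiable, and the Wiener integral in the formula
      -- is an ordinary integral after partial integration
      (∀ t : ℝ≥0, (t : ℝ≥0∞) < S →
        let f : ℝ → ℝ := fun s => γ s * Real.exp (∫ r in s..t, β r)
        ∃ f' : ℝ → ℝ, ContinuousOn f' (Icc 0 (t : ℝ)) ∧
          (∀ s ∈ Icc 0 (t : ℝ), HasDerivWithinAt f (f' s) (Icc 0 (t : ℝ)) s) ∧
          IsWienerIntegral P W f t
            (fun ω => f t * W t ω - ∫ s in (0 : ℝ)..t, f' s * W s.toNNReal ω))) := by
  refine ⟨exists_maximal_IsODESolution da₀ da₁ db x₀, ?_⟩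
  intro S A G hAG Ω mΩ P _ F W hW α β γ
  have hW' := hW.brownian.toIsPreBrownianReal
  have hα : ∀ t : ℝ≥0, (t : ℝ≥0∞) < S → ContinuousOn α (Icc 0 (t : ℝ)) :=
    fun t ht => hAG.continuousOn_coeff da₀ ht
  have hβ : ∀ t : ℝ≥0, (t : ℝ≥0∞) < S → ContinuousOn β (Icc 0 (t : ℝ)) :=
    fun t ht => hAG.continuousOn_coeff da₁ ht
  have hγ : ∀ t : ℝ≥0, (t : ℝ≥0∞) < S → MemLp γ 2 (volume.restrict (Ioc 0 (t : ℝ))) :=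
    fun t ht => memLp_of_continuousOn_Icc (hAG.continuousOn_coeff db ht)
  have hαi : ∀ t : ℝ≥0, (t : ℝ≥0∞) < S → IntervalIntegrable α volume 0 t :=
    fun t ht => intervalIntegrable_of_continuousOn_Icc t.coe_nonneg (hα t ht)
  have hβi : ∀ t : ℝ≥0, (t : ℝ≥0∞) < S → IntervalIntegrable β volume 0 t :=
    fun t ht => intervalIntegrable_of_continuousOn_Icc t.coe_nonneg (hβ t ht)
  -- Differentiability of γ in time serves twice: for the pathwise construction of a solution and
  -- for the partial integration in the last claim.
  obtain ⟨γ', hγ'⟩ := hAG.exists_deriv_coeff da₀ da₁ db db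
  refine ⟨fun ca₀ ca₁ cb X => ⟨fun h => h.isLinearSDESolution hW' ca₀ ca₁ cb pa₀ pa₁ pb da₀ da₁ db
      hAG, fun h => h.isMcKeanVlasovSolution hW' ca₀ ca₁ cb pa₀ pa₁ pb da₀ da₁ db hAG⟩,
    fun X => ⟨fun h => h.isExplicitSolution hW', fun h => h.isLinearSDESolution hW' hαi hβi hγ⟩,
    ⟨explicitSolution W x₀ α β γ γ', isExplicitSolution_explicitSolution hW hα hβ
      (fun t ht => (hγ' t ht).2) fun t ht => (hγ' t ht).1⟩,
    fun X h => ⟨h.isGaussian hW' hβi hγ,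
      fun t ht => h.hasLaw_of_isODESolution hW' da₀ da₁ db hAG ht⟩,
    fun t ht => ?_⟩
  intro f
  have hf' : ContinuousOn (fun s => Real.exp (∫ r in (0 : ℝ)..t, β r) *
      ((γ' s - γ s * β s) * Real.exp (-∫ r in (0 : ℝ)..s, β r))) (Icc 0 (t : ℝ)) :=
    continuousOn_const.mul (continuousOn_deriv_mul_exp_neg t.coe_nonneg (hβ t ht)
      (hAG.continuousOn_coeff db ht) (hγ' t ht).1)
  have hf := fun s hs => hasDerivWithinAt_mul_exp_integral t.coe_nonneg (hβ t ht) (hγ' t ht).2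
    (s := s) hs
  exact ⟨_, hf', hf, (isWienerIntegral_iff (hW := hW')
    (memLp_mul_exp_integral t.coe_nonneg (hβi t ht) (hγ t ht))).2
    (IsWiener.of_hasDerivWithinAt hW.brownian hf hf')⟩
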